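/- Let $d\in\{2,3\}$, let $\mathcal D\subset\mathbb R^d$ be a bounded polyhedral domain with a conforming simplicial mesh $\mathcal T_h$ (elements $K$, internal edges or faces $E_j$ with unit normals $n$), and let $\mathrm{Re}\ge 0$, $\mathrm{Wi}>0$, $0\le\varepsilon<1$. Let $V_h$ be the space of continuous vector fields on $\overline{\mathcal D}$, vanishing on $\partial\mathcal D$ (and extended by zero), that are polynomial of degree at most $2$ on every element; $Q_h$ the space of discontinuous piecewise affine scalar fields; $S_h$ the space of piecewise constant fields of symmetric $d\times d$ matrices. Write $(\nabla u)_{ij}=\partial_j u_i$ and $A:B=\sum_{i,j}A_{ij}B_{ij}$. Given $(u_h^n,\psi_h^n)\in V_h\times S_h$ and a time step $\Delta t$, a pair $(u,\psi)\in V_h\times S_h$ is called a solution of the log-formulation scheme if for some pressure $p\in Q_h$ and some elementwise decomposition $\nabla u=\Omega+B+N e^{-\psi}$ ($\Omega,N$ antisymmetric, $B$ symmetric and commuting with $e^{\psi}$, all with discontinuous piecewise affine entries) one has, for all $(v,q,\phi)\in V_h\times Q_h\times S_h$, $$0=\sum_K\int_K \Big[\mathrm{Re}\Big(\tfrac{u-u_h^n}{\Delta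 t}+(u_h^n\cdot\nabla)u\Big)\cdot v-p\,\mathrm{div}\,v+q\,\mathrm{div}\,u+(1-\varepsilon)\nabla u:\nabla v+\tfrac{\varepsilon}{\mathrm{Wi}}e^{\psi}:\nabla v-(\Omega\psi-\psi\Omega):\phi-2B:\phi-\tfrac1{\mathrm{Wi}}(e^{-\psi}-I):\phi\Big]+\mathcal A(\psi,\phi),$$ where the discretized material derivative $\mathcal A$ is - for the characteristic method, $\mathcal A(\psi,\phi)=\int_{\mathcal D}\frac{\psi-\psi_h^n\circ X^n(t^n)}{\Delta t}:\phi$, where $t^n=n\Delta t$ and $X^n(t):\mathcal D\to\mathcal D$ is the backward flow $\frac{d}{dt}X^n(t,x)=u_h^n(X^n(t,x))$ on $[t^n,t^{n+1}]$, $X^n(t^{n+1},x)=x$; - for the discontinuous Galerkin method, $\mathcal A(\psi,\phi)=\sum_K\int_K\frac{\psi-\psi_h^n}{\Delta t}:\phi+\sum_j\int_{E_j}|u_h^n\cdot n|\,(\psi^+-\psi^-):\phi^+$, where $\phi^\pm(x)=\lim_{\delta\to0^\pm}\phi(x+\delta u_h^n(x))$. For $\Delta t=0$ the scheme is understood after multiplication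 of the equation by $\Delta t$. **Proposition.** For each of the two methods and every $(u_h^n,\psi_h^n)\in V_h\times S_h$ there is a constant $c_0>0$, which may depend on $(u_h^n,\psi_h^n)$, $\mathcal T_h$, $\mathrm{Re}$, $\mathrm{Wi}$ and $\varepsilon$ but not on $\Delta t$, such that for all $0\le\Delta t<c_0$ (with $\Delta t=0$ excluded if $\mathrm{Re}=0$) the scheme has a unique solution $(u_h^{n+1},\psi_h^{n+1})\in V_h\times S_h$. -/

import Mathlib

open MeasureTheory Topology

noncomputable section

namespace OldroydLog

/-- Physical space `ℝ^d` with its Euclidean norm and Lebesgue measure. -/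
abbrev Space (d : ℕ) : Type := EuclideanSpace ℝ (Fin d)

/-- Real `d × d` tensors. -/
abbrev Tensor (d : ℕ) : Type := Matrix (Fin d) (Fin d) ℝ

/-- The double contraction `A : B = ∑ i j, A i j * B i j`. -/
def ddot {d : ℕ} (A B : Tensor d) : ℝ := ∑ i, ∑ j, A i j * B i j

/-- The velocity gradient, `(∇u) i j = ∂ u_i / ∂ x_j`. -/
def grad {d : ℕ} (u : Space d → Space d) (x : Space d) : Tensor d :=
  Matrix.of fun i j => fderiv ℝ u x (EuclideanSpace.single j 1) i

/-- The divergence `div u = tr ∇u`. -/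
def div {d : ℕ} (u : Space d → Space d) (x : Space d) : ℝ := (grad u x).trace

/-- `f` agrees on `s` with a real polynomial in `d` variables of total degree at most `k`. -/
def IsPolyOn {d : ℕ} (k : ℕ) (s : Set (Space d)) (f : Space d → ℝ) : Prop :=
  ∃ P : MvPolynomial (Fin d) ℝ, P.totalDegree ≤ k ∧
    ∀ x ∈ s, f x = MvPolynomial.eval (fun i => x i) P

/-! ### Meshes -/

/-- A conforming simplicial mesh in `ℝ^d`: a finite geometric simplicial complex all of whose
faces are faces of `d`-dimensional simplices. -/
structure Mesh (d : ℕ) extends Geometry.SimplicialComplex ℝ (Space d) where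
  finite_faces : faces.Finite
  pure_faces : ∀ s ∈ faces, ∃ t ∈ faces, s ⊆ t ∧ t.card = d + 1

namespace Mesh

variable {d : ℕ} (T : Mesh d)

/-- The polyhedral domain `𝒟` that is tessellated by the mesh. -/
def domain : Set (Space d) := interior T.toSimplicialComplex.space

/-- The elements `K` of the mesh (given by their vertices). -/
def Elem : Type := {s : Finset (Space d) // s ∈ T.faces ∧ s.card = d + 1}

/-- The closed simplex occupied by an element. -/
def cell (K : T.Elem) : Set (Space d) := convexHull ℝ (K.1 : Set (Space d))

/-- The internal edges (`d = 2`) or faces (`d = 3`): the `(d-1)`-dimensional simplices shared by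
two distinct elements. -/
def InternalFace : Type :=
  {s : Finset (Space d) // s ∈ T.faces ∧ s.card = d ∧
    ∃ K L : T.Elem, K ≠ L ∧ s ⊆ K.1 ∧ s ⊆ L.1}

instance : Finite T.Elem :=
  (T.finite_faces.subset (t := {s | s ∈ T.faces ∧ s.card = d + 1}) fun _ h => h.1).to_subtype

instance : Finite T.InternalFace :=
  (T.finite_faces.subset (t := {s | s ∈ T.faces ∧ s.card = d ∧
    ∃ K L : T.Elem, K ≠ L ∧ s ⊆ K.1 ∧ s ⊆ L.1}) fun _ h => h.1).to_subtype

instance : Fintype T.Elem := Fintype.ofFinite _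

instance : Fintype T.InternalFace := Fintype.ofFinite _

/-- The closed simplex occupied by an internal face. -/
def faceSet (F : T.InternalFace) : Set (Space d) := convexHull ℝ (F.1 : Set (Space d))

/-- A unit normal of an internal face; its orientation is irrelevant. -/
def normal (F : T.InternalFace) : Space d :=
  Classical.epsilon fun n : Space d =>
    ‖n‖ = 1 ∧ ∀ w ∈ vectorSpan ℝ (F.1 : Set (Space d)), inner ℝ n w = 0

/-! ### Finite element spaces -/

/-- The velocity space `(ℙ₂)^d` with homogeneous Dirichlet conditions: continuous fields that are
polynomial of degree at most `2` on every element and vanish on the boundary of the domain.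
They are regarded as functions on `ℝ^d`, extended by zero outside the domain. -/
def VelocitySpace : Set (Space d → Space d) :=
  {u | Continuous u ∧ (∀ x ∉ T.domain, u x = 0) ∧
    ∀ (K : T.Elem) (i : Fin d), IsPolyOn 2 (T.cell K) (fun x => u x i)}

/-- The pressure space `ℙ_{1,disc}`: one affine function for each element. -/
def PressureSpace : Set (T.Elem → Space d → ℝ) :=
  {p | ∀ K, IsPolyOn 1 Set.univ (p K)}

/-- The stress space `(ℙ₀)^{d(d+1)/2}`: one symmetric matrix for each element. -/
def StressSpace : Set (T.Elem → Tensor d) := {ψ | ∀ K, (ψ K).IsSymm}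

/-- Tensor fields with entries in `ℙ_{1,disc}`. -/
def TensorP1 : Set (T.Elem → Space d → Tensor d) :=
  {A | ∀ K i j, IsPolyOn 1 Set.univ (fun x => A K x i j)}

/-- The piecewise constant field on `ℝ^d` with the given elementwise values. It takes the value `0`
outside the interiors of the elements. -/
def eval (φ : T.Elem → Tensor d) (x : Space d) : Tensor d :=
  ∑ K, (interior (T.cell K)).indicator (fun _ => φ K) x

/-- Elementwise decomposition `∇u = Ω + B + N e^{-ψ}` with `Ω`, `N` antisymmetric and `B` symmetric
and commuting with `e^ψ`, all three with entries in `ℙ_{1,disc}`. -/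
def IsDecomposition (u : Space d → Space d) (ψ : T.Elem → Tensor d)
    (Ω B N : T.Elem → Space d → Tensor d) : Prop :=
  Ω ∈ T.TensorP1 ∧ B ∈ T.TensorP1 ∧ N ∈ T.TensorP1 ∧
  ∀ K, ∀ x ∈ interior (T.cell K),
    (Ω K x).transpose = -Ω K x ∧ (N K x).transpose = -N K x ∧ (B K x).IsSymm ∧
    Commute (B K x) (NormedSpace.exp (ψ K)) ∧
    grad u x = Ω K x + B K x + N K x * NormedSpace.exp (-ψ K)

/-! ### The two schemes -/

/-- The part common to both schemes of the discrete variational form, multiplied by the time step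
`Δt`. The field `ψold` is the value at the previous time from which `ψ` is updated. -/
def form (Re Wi ε Δt : ℝ) (un : Space d → Space d) (ψold : T.Elem → Space d → Tensor d)
    (u : Space d → Space d) (p : T.Elem → Space d → ℝ) (ψ : T.Elem → Tensor d)
    (Ω B : T.Elem → Space d → Tensor d)
    (v : Space d → Space d) (q : T.Elem → Space d → ℝ) (φ : T.Elem → Tensor d) : ℝ :=
  ∑ K, ∫ x in T.cell K,
    (Re * inner ℝ ((u x - un x) + Δt • fderiv ℝ u x (un x)) (v x)
      + Δt * (-(p K x * div v x) + q K x * div u x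
          + (1 - ε) * ddot (grad u x) (grad v x)
          + ε / Wi * ddot (NormedSpace.exp (ψ K)) (grad v x))
      + ddot (ψ K - ψold K x) (φ K)
      - Δt * ddot (Ω K x * ψ K - ψ K * Ω K x) (φ K)
      - Δt * (2 * ddot (B K x) (φ K))
      - Δt * (1 / Wi * ddot (NormedSpace.exp (-ψ K) - 1) (φ K)))

/-- `X` is the backward flow of the velocity field `w` on the time interval `[a, b]`: for every
`x` in the domain, `X · x` stays in the domain, `d/dt X t x = w (X t x)` and `X b x = x`. -/
def IsBackwardFlow (w : Space d → Space d) (a b : ℝ) (X : ℝ → Space d → Space d) : Prop :=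
  ∀ x ∈ T.domain, X b x = x ∧ ∀ t ∈ Set.Icc a b,
    X t x ∈ T.domain ∧ HasDerivWithinAt (fun s => X s x) (w (X t x)) (Set.Icc a b) t

/-- One step of the log-formulation with the characteristic method, from time `tn` to `tn + Δt`:
`(u, ψ)` belongs to the discrete spaces and, with some discrete pressure `p`, satisfies the
discrete system (multiplied by `Δt`) for all test functions. -/
def IsCharacteristicStep (Re Wi ε tn Δt : ℝ) (un : Space d → Space d) (ψn : T.Elem → Tensor d)
    (u : Space d → Space d) (ψ : T.Elem → Tensor d) : Prop :=
  u ∈ T.VelocitySpace ∧ ψ ∈ T.StressSpace ∧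
  ∃ p ∈ T.PressureSpace, ∃ Ω B N : T.Elem → Space d → Tensor d, ∃ X : ℝ → Space d → Space d,
    T.IsDecomposition u ψ Ω B N ∧ T.IsBackwardFlow un tn (tn + Δt) X ∧
    ∀ v ∈ T.VelocitySpace, ∀ q ∈ T.PressureSpace, ∀ φ ∈ T.StressSpace,
      0 = T.form Re Wi ε Δt un (fun _ x => T.eval ψn (X tn x)) u p ψ Ω B v q φ

/-- Downstream value `φ⁺(x) = lim_{δ → 0⁺} φ(x + δ w(x))`. -/
def downstream (w : Space d → Space d) (φ : T.Elem → Tensor d) (x : Space d) : Tensor d :=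
  Filter.limUnder (𝓝[>] (0 : ℝ)) fun δ => T.eval φ (x + δ • w x)

/-- Upstream value `φ⁻(x) = lim_{δ → 0⁻} φ(x + δ w(x))`. -/
def upstream (w : Space d → Space d) (φ : T.Elem → Tensor d) (x : Space d) : Tensor d :=
  Filter.limUnder (𝓝[<] (0 : ℝ)) fun δ => T.eval φ (x + δ • w x)

/-- The upwind jump term `∑_j ∫_{E_j} |w · n| ⟦ψ⟧ : φ⁺`, where `⟦ψ⟧ = ψ⁺ - ψ⁻` and `E_j` carries the
`(d-1)`-dimensional surface measure. Points with `w · n = 0` do not contribute. -/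
def jumpTerm (w : Space d → Space d) (ψ φ : T.Elem → Tensor d) : ℝ :=
  ∑ F : T.InternalFace, ∫ x in T.faceSet F,
    |inner ℝ (w x) (T.normal F)| *
      ddot (T.downstream w ψ x - T.upstream w ψ x) (T.downstream w φ x) ∂μHE[d - 1]

/-- One step of the log-formulation with the discontinuous Galerkin method: `(u, ψ)` belongs to the
discrete spaces and, with some discrete pressure `p`, satisfies the discrete system (multiplied by
`Δt`) for all test functions. -/
def IsDGStep (Re Wi ε Δt : ℝ) (un : Space d → Space d) (ψn : T.Elem → Tensor d)
    (u : Space d → Space d) (ψ : T.Elem → Tensor d) : Prop :=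
  u ∈ T.VelocitySpace ∧ ψ ∈ T.StressSpace ∧
  ∃ p ∈ T.PressureSpace, ∃ Ω B N : T.Elem → Space d → Tensor d,
    T.IsDecomposition u ψ Ω B N ∧
    ∀ v ∈ T.VelocitySpace, ∀ q ∈ T.PressureSpace, ∀ φ ∈ T.StressSpace,
      0 = T.form Re Wi ε Δt un (fun K _ => ψn K) u p ψ Ω B v q φ + Δt * T.jumpTerm un ψ φ

end Mesh

end OldroydLog

end

/-! Velocity and pressure can be eliminated. For a given stress, the velocity solves a linear
problem on the discretely divergence-free subspace, coercive for small `Δt > 0`. Its solution is `u₀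
+ W e^ψ`, and `u₀` and the linear operator `W` are bounded uniformly in `Δt`, because the stress
load carries the same factor `Δt` as the viscous term (`exists_velocity_solution`). A pressure is
recovered by duality in finite dimension (`form_eq_zero_iff`). What remains is an equation `ψ = a +
Δt H(ψ)`, where `a` is the elementwise average of the old, possibly transported, stress. If `H` is
locally Lipschitz, then for small `Δt` a contraction on a ball gives a solution that is unique in
that ball (`exists_unique_fixedPoint_of_small`).

Two points need an argument. First, `H` contains `Ωψ - ψΩ + 2B`, built from a decomposition that is
not unique when eigenvalues of `ψ` coincide and whose coefficients are singular there. This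
combination is the preimage of `G e^ψ + e^ψ Gᵀ` under the derivative of the exponential at `ψ`
(`stretching_eq`). That derivative is invertible at symmetric `ψ`, so the combination is unique,
linear in `G` and `C¹` in `ψ` (`contDiffAt_stretching`).

Second, uniqueness among all solutions needs an a priori bound (`energy_bound`). The equation is
tested with `e^ψ - 1`, the gradient of the convex free energy `tr (e^ψ - ψ)`. The stretching gives
twice `∇u : e^ψ`, its trace part vanishing by discrete incompressibility; the contribution of `W
e^ψ` has the good sign and that of `u₀` grows at most linearly in the energy. Relaxation dissipates,
and by convexity the jump term is bounded below by a multiple of `-(1 + energy)`. For small `Δt`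
everything is absorbed, and the energy controls every entry of `ψ`.

On a mesh, stress and test tensors are constant on elements, so only integrals of velocity gradients
and averages of the old stress enter. Both schemes thus become instances of one algebraic scheme
(`form_eq_scheme`). The case `Δt = 0` is a pure mass problem. -/

noncomputable section

namespace OldroydLog

variable {d : ℕ}

/-! ### Tensor calculus and the algebraic scheme, without reference to a mesh. -/

section Algebraic

open scoped Matrix.Norms.Operator
open Matrix

/-! ### Spectral calculus for symmetric tensors -/

/-- `ψ` is diagonalized by the orthogonal matrix `U` with eigenvalues `l`. -/
structure IsEigenframe (ψ U : Tensor d) (l : Fin d → ℝ) : Prop where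
  mul_transpose : U * Uᵀ = 1
  transpose_mul : Uᵀ * U = 1
  eq : ψ = U * diagonal l * Uᵀ

theorem exists_isEigenframe {ψ : Tensor d} (hψ : ψ.IsSymm) : ∃ U l, IsEigenframe ψ U l := by
  have hH : ψ.IsHermitian := by
    rw [Matrix.IsHermitian, Matrix.conjTranspose_eq_transpose_of_trivial]; exact hψ
  refine ⟨hH.eigenvectorUnitary, hH.eigenvalues, ?_, ?_, ?_⟩
  · have := Unitary.coe_mul_star_self hH.eigenvectorUnitary
    rwa [Unitary.coe_star, Matrix.star_eq_conjTranspose,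
      Matrix.conjTranspose_eq_transpose_of_trivial] at this
  · have := Unitary.coe_star_mul_self hH.eigenvectorUnitary
    rwa [Matrix.star_eq_conjTranspose,
      Matrix.conjTranspose_eq_transpose_of_trivial] at this
  · have := hH.spectral_theorem
    rw [Unitary.conjStarAlgAut_apply, Matrix.star_eq_conjTranspose,
      Matrix.conjTranspose_eq_transpose_of_trivial] at this
    exact this

namespace IsEigenframe

variable {ψ U : Tensor d} {l : Fin d → ℝ}

theorem exp_eq (h : IsEigenframe ψ U l) :
    NormedSpace.exp ψ = U * diagonal (fun i => Real.exp (l i)) * Uᵀ := by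
  have hinv : U⁻¹ = Uᵀ := Matrix.inv_eq_right_inv h.mul_transpose
  have hu : IsUnit U := ⟨⟨U, Uᵀ, h.mul_transpose, h.transpose_mul⟩, rfl⟩
  rw [h.eq, ← hinv, Matrix.exp_conj _ _ hu, Matrix.exp_diagonal]
  congr 3
  ext i
  rw [Pi.coe_exp, Real.exp_eq_exp_ℝ]

theorem neg (h : IsEigenframe ψ U l) : IsEigenframe (-ψ) U (fun i => -l i) :=
  ⟨h.mul_transpose, h.transpose_mul, by
    have : diagonal (fun i => -l i) = -diagonal l := by
      rw [Matrix.diagonal_neg]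
    rw [this, Matrix.mul_neg, Matrix.neg_mul, ← h.eq]⟩

theorem exp (h : IsEigenframe ψ U l) :
    IsEigenframe (NormedSpace.exp ψ) U (fun i => Real.exp (l i)) :=
  ⟨h.mul_transpose, h.transpose_mul, h.exp_eq⟩

/-- The tensor `X` in the frame `U`. -/
theorem conj_conj (h : IsEigenframe ψ U l) (X : Tensor d) : U * (Uᵀ * X * U) * Uᵀ = X := by
  rw [show U * (Uᵀ * X * U) * Uᵀ = (U * Uᵀ) * X * (U * Uᵀ) by simp only [Matrix.mul_assoc],
    h.mul_transpose]; simp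

theorem conj_conj' (h : IsEigenframe ψ U l) (X : Tensor d) : Uᵀ * (U * X * Uᵀ) * U = X := by
  rw [show Uᵀ * (U * X * Uᵀ) * U = (Uᵀ * U) * X * (Uᵀ * U) by simp only [Matrix.mul_assoc],
    h.transpose_mul]; simp

theorem conj_mul_conj (h : IsEigenframe ψ U l) (X Y : Tensor d) :
    (U * X * Uᵀ) * (U * Y * Uᵀ) = U * (X * Y) * Uᵀ := by
  rw [show (U * X * Uᵀ) * (U * Y * Uᵀ) = U * X * (Uᵀ * U) * Y * Uᵀ by simp only [Matrix.mul_assoc],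
    h.transpose_mul]; simp only [Matrix.mul_assoc, Matrix.mul_one]

theorem conj_injective (h : IsEigenframe ψ U l) {X Y : Tensor d}
    (hXY : U * X * Uᵀ = U * Y * Uᵀ) : X = Y := by
  rw [← h.conj_conj' X, hXY, h.conj_conj']

theorem exp_neg_eq (h : IsEigenframe ψ U l) :
    NormedSpace.exp (-ψ) = U * diagonal (fun i => Real.exp (-l i)) * Uᵀ := h.neg.exp_eq

theorem isSymm (h : IsEigenframe ψ U l) : ψ.IsSymm := by
  rw [h.eq, Matrix.IsSymm]
  simp [Matrix.mul_assoc]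

theorem trace_eq (h : IsEigenframe ψ U l) : ψ.trace = ∑ i, l i := by
  rw [h.eq, Matrix.trace_mul_cycle, h.transpose_mul, Matrix.one_mul, Matrix.trace_diagonal]

end IsEigenframe

theorem isSymm_exp {ψ : Tensor d} (hψ : ψ.IsSymm) : (NormedSpace.exp ψ).IsSymm := by
  rw [Matrix.IsSymm, ← Matrix.exp_transpose, hψ]

/-- In an eigenframe, commuting with `e^ψ` forces the entry `i j` to vanish unless `exp (l i) = exp
(l j)`, and the real exponential is injective. -/
theorem commute_of_commute_exp {ψ B : Tensor d} (hψ : ψ.IsSymm)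
    (h : Commute B (NormedSpace.exp ψ)) : Commute B ψ := by
  obtain ⟨U, l, hU⟩ := exists_isEigenframe hψ
  set B' := Uᵀ * B * U with hB'
  have hB : B = U * B' * Uᵀ := (hU.conj_conj B).symm
  have h1 : B' * diagonal (fun i => Real.exp (l i)) = diagonal (fun i => Real.exp (l i)) * B' := by
    have := h.eq
    rw [hB, hU.exp_eq, hU.conj_mul_conj, hU.conj_mul_conj] at this
    exact hU.conj_injective this
  have h2 : B' * diagonal l = diagonal l * B' := by
    ext i j
    have := congrFun (congrFun h1 i) j
    rw [Matrix.mul_diagonal, Matrix.diagonal_mul] at this ⊢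
    by_cases hij : B' i j = 0
    · simp [hij]
    · have h3 : Real.exp (l j) = Real.exp (l i) := by
        apply mul_left_cancel₀ hij; rw [this]; ring
      rw [Real.exp_injective h3]; ring
  show B * ψ = ψ * B
  rw [hB, hU.eq, hU.conj_mul_conj, hU.conj_mul_conj, h2]

/-! ### Decomposition of a velocity gradient -/

/-- The linear map `X ↦ (a i j * X i j + b i j * X j i)`. -/
def entrywise (a b : Tensor d) : Tensor d →ₗ[ℝ] Tensor d where
  toFun X := Matrix.of fun i j => a i j * X i j + b i j * X j i
  map_add' X Y := by ext i j; simp; ring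
  map_smul' r X := by ext i j; simp; ring

@[simp] theorem entrywise_apply (a b X : Tensor d) (i j : Fin d) :
    entrywise a b X i j = a i j * X i j + b i j * X j i := rfl

/-- The linear map `X ↦ U X V`. -/
def conjLinear (U V : Tensor d) : Tensor d →ₗ[ℝ] Tensor d where
  toFun X := U * X * V
  map_add' X Y := by simp [Matrix.mul_add, Matrix.add_mul]
  map_smul' r X := by simp

@[simp] theorem conjLinear_apply (U V X : Tensor d) : conjLinear U V X = U * X * V := rfl

/-- In an eigenframe the problem decouples into the pairs of entries `i j`, `j i`. For distinct
eigenvalues, `B` vanishes there and the two equations determine `Ω` and `N`; for equal eigenvalues,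
`N = 0` and `Ω`, `B` are the antisymmetric and symmetric parts. Linearity in `G` is what later makes
the fields piecewise affine. -/
theorem exists_linear_decomposition {ψ : Tensor d} (hψ : ψ.IsSymm) :
    ∃ Ω B N : Tensor d →ₗ[ℝ] Tensor d, ∀ G, (Ω G)ᵀ = -Ω G ∧ (N G)ᵀ = -N G ∧ (B G).IsSymm ∧
      Commute (B G) (NormedSpace.exp ψ) ∧ G = Ω G + B G + N G * NormedSpace.exp (-ψ) := by
  classical
  obtain ⟨U, l, hU⟩ := exists_isEigenframe hψ
  set μ : Fin d → ℝ := fun i => Real.exp (-l i) with hμ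
  have hne : ∀ i j, l i ≠ l j → μ j - μ i ≠ 0 := fun i j h h0 => h (by
    have := Real.exp_injective (sub_eq_zero.1 h0); linarith)
  -- For distinct eigenvalues the system is `Ω i j + N i j * μ j = X i j`, `-Ω i j - N i j * μ i = X
  -- j i`; its sum gives `N i j`.
  let Ω' : Tensor d →ₗ[ℝ] Tensor d := entrywise
    (.of fun i j => if l i = l j then 1 / 2 else -(μ i / (μ j - μ i)))
    (.of fun i j => if l i = l j then -(1 / 2) else -(μ j / (μ j - μ i)))
  let B' : Tensor d →ₗ[ℝ] Tensor d := entrywise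
    (.of fun i j => if l i = l j then 1 / 2 else 0) (.of fun i j => if l i = l j then 1 / 2 else 0)
  let N' : Tensor d →ₗ[ℝ] Tensor d := entrywise
    (.of fun i j => if l i = l j then 0 else 1 / (μ j - μ i))
    (.of fun i j => if l i = l j then 0 else 1 / (μ j - μ i))
  have hanti : ∀ X : Tensor d, Xᵀ = -X → (U * X * Uᵀ)ᵀ = -(U * X * Uᵀ) := fun X h => by
    rw [Matrix.transpose_mul, Matrix.transpose_mul, Matrix.transpose_transpose, h]
    simp [Matrix.mul_assoc]
  refine ⟨conjLinear U Uᵀ ∘ₗ Ω' ∘ₗ conjLinear Uᵀ U, conjLinear U Uᵀ ∘ₗ B' ∘ₗ conjLinear Uᵀ U,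
    conjLinear U Uᵀ ∘ₗ N' ∘ₗ conjLinear Uᵀ U, fun G => ?_⟩
  simp only [LinearMap.comp_apply, conjLinear_apply]
  set X := Uᵀ * G * U with hX
  refine ⟨hanti _ ?_, hanti _ ?_, ?_, ?_, ?_⟩
  · ext i j
    rw [Matrix.neg_apply]
    simp only [Ω', transpose_apply, entrywise_apply, Matrix.of_apply]
    by_cases h : l i = l j
    · simp only [h, if_true]; ring
    · have h' : ¬ l j = l i := fun e => h e.symm
      have e : μ i - μ j = -(μ j - μ i) := by ring
      simp only [h, h', if_false, e, div_neg]; ring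
  · ext i j
    rw [Matrix.neg_apply]
    simp only [N', transpose_apply, entrywise_apply, Matrix.of_apply]
    by_cases h : l i = l j
    · simp [h]
    · have h' : ¬ l j = l i := fun e => h e.symm
      have e : μ i - μ j = -(μ j - μ i) := by ring
      simp only [h, h', if_false, e, div_neg]; ring
  · rw [Matrix.IsSymm, Matrix.transpose_mul, Matrix.transpose_mul, Matrix.transpose_transpose,
      Matrix.mul_assoc]
    congr 2
    ext i j
    simp only [B', transpose_apply, entrywise_apply, Matrix.of_apply, eq_comm (a := l j)]
    ring
  · show _ * _ = _ * _
    rw [hU.exp_eq, hU.conj_mul_conj, hU.conj_mul_conj]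
    congr 2
    ext i j
    simp only [B', Matrix.mul_diagonal, Matrix.diagonal_mul, entrywise_apply, Matrix.of_apply]
    by_cases h : l i = l j
    · simp [h]; ring
    · simp [h]
  · rw [hU.exp_neg_eq, hU.conj_mul_conj, ← Matrix.add_mul, ← Matrix.mul_add, ← Matrix.add_mul,
      ← Matrix.mul_add]
    rw [← hU.conj_conj G, ← hX]
    congr 2
    ext i j
    simp only [Ω', B', N', Matrix.add_apply, Matrix.mul_diagonal, entrywise_apply, Matrix.of_apply]
    by_cases h : l i = l j
    · simp [h]; ring
    · have := hne i j h
      simp only [h, if_false]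
      change _ = _ + _ * μ j
      field_simp
      ring

/-! ### The derivative of the matrix exponential -/

theorem contDiff_exp {n : WithTop ℕ∞} : ContDiff ℝ n (NormedSpace.exp : Tensor d → Tensor d) :=
  contDiff_iff_contDiffAt.2 fun x => (NormedSpace.exp_analytic (𝕂 := ℝ) x).contDiffAt

theorem hasFDerivAt_exp (ψ : Tensor d) :
    HasFDerivAt (NormedSpace.exp : Tensor d → Tensor d) (fderiv ℝ NormedSpace.exp ψ) ψ :=
  ((contDiff_exp (n := 1)).differentiable one_ne_zero ψ).hasFDerivAt

/-- Conjugation by `e^{tΩ}` commutes with the exponential; both sides are derivatives at `t = 0` of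
the same curve. -/
theorem fderiv_exp_commutator (ψ Ω : Tensor d) :
    fderiv ℝ NormedSpace.exp ψ (Ω * ψ - ψ * Ω) =
      Ω * NormedSpace.exp ψ - NormedSpace.exp ψ * Ω := by
  have hd : ∀ Y : Tensor d, HasDerivAt
      (fun t : ℝ => NormedSpace.exp (t • Ω) * Y * NormedSpace.exp (t • -Ω)) (Ω * Y - Y * Ω) 0 := by
    intro Y
    have h1 := hasDerivAt_exp_smul_const (𝕂 := ℝ) Ω 0
    have h2 := hasDerivAt_exp_smul_const (𝕂 := ℝ) (-Ω) 0
    have := (h1.mul_const Y).mul h2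
    exact this.congr_deriv (by simp [sub_eq_add_neg])
  have h1 := hd ψ
  have h0 : NormedSpace.exp ((0 : ℝ) • Ω) * ψ * NormedSpace.exp ((0 : ℝ) • -Ω) = ψ := by simp
  have h2 := HasFDerivAt.comp_hasDerivAt (x := (0 : ℝ))
    (f := fun t : ℝ => NormedSpace.exp (t • Ω) * ψ * NormedSpace.exp (t • -Ω)) (l := NormedSpace.exp)
    (l' := fderiv ℝ NormedSpace.exp ψ) (by rw [h0]; exact hasFDerivAt_exp ψ) h1
  refine h2.unique ((hd (NormedSpace.exp ψ)).congr_of_eventuallyEq (.of_forall fun t => ?_))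
  have hu : IsUnit (NormedSpace.exp (t • Ω)) := Matrix.isUnit_exp _
  simp only [Function.comp, smul_neg, Matrix.exp_neg]
  exact Matrix.exp_conj _ _ hu

theorem fderiv_exp_of_commute {ψ B : Tensor d} (h : Commute B ψ) :
    fderiv ℝ NormedSpace.exp ψ B = NormedSpace.exp ψ * B := by
  have h1 : HasDerivAt (fun t : ℝ => ψ + t • B) B 0 := by
    exact (((hasDerivAt_id (0 : ℝ)).smul_const B).const_add ψ).congr_deriv (by simp)
  have h2 := HasFDerivAt.comp_hasDerivAt (x := (0 : ℝ)) (f := fun t : ℝ => ψ + t • B)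
    (l := NormedSpace.exp) (l' := fderiv ℝ NormedSpace.exp ψ)
    (by rw [zero_smul, add_zero]; exact hasFDerivAt_exp ψ) h1
  have h3 : HasDerivAt (fun t : ℝ => NormedSpace.exp ψ * NormedSpace.exp (t • B))
      (NormedSpace.exp ψ * B) 0 := by
    exact ((hasDerivAt_exp_smul_const (𝕂 := ℝ) B 0).const_mul (NormedSpace.exp ψ)).congr_deriv
      (by simp)
  refine h2.unique (h3.congr_of_eventuallyEq (.of_forall fun t => ?_))
  exact Matrix.exp_add_of_commute _ _ (h.symm.smul_right t)

/-- Every `H` is a commutator with `ψ` plus a tensor commuting with `ψ`, and the derivative is known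
on both. In an eigenframe it multiplies entries by the divided differences of `exp`, or by `exp (l
i)` when eigenvalues coincide, and none of these factors vanishes. -/
theorem fderiv_exp_injective {ψ : Tensor d} (hψ : ψ.IsSymm) :
    Function.Injective (fderiv ℝ (NormedSpace.exp : Tensor d → Tensor d) ψ) := by
  classical
  rw [injective_iff_map_eq_zero]
  intro H hH
  obtain ⟨U, l, hU⟩ := exists_isEigenframe hψ
  set X := Uᵀ * H * U with hX
  let Ω' : Tensor d := .of fun i j => if l i = l j then 0 else X i j / (l j - l i)
  let B' : Tensor d := .of fun i j => if l i = l j then X i j else 0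
  have e1 : X = Ω' * diagonal l - diagonal l * Ω' + B' := by
    ext i j
    simp only [Ω', B', Matrix.add_apply, Matrix.sub_apply, Matrix.mul_diagonal,
      Matrix.diagonal_mul, Matrix.of_apply]
    by_cases h : l i = l j
    · simp [h]
    · have : l j - l i ≠ 0 := fun e => h (by linarith)
      simp only [h, if_false]; field_simp; ring
  have hB : Commute (U * B' * Uᵀ) ψ := by
    show _ * _ = _ * _
    rw [hU.eq, hU.conj_mul_conj, hU.conj_mul_conj]
    congr 2
    ext i j
    simp only [B', Matrix.mul_diagonal, Matrix.diagonal_mul, Matrix.of_apply]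
    by_cases h : l i = l j
    · simp [h]; ring
    · simp [h]
  have e2 : H = (U * Ω' * Uᵀ) * ψ - ψ * (U * Ω' * Uᵀ) + U * B' * Uᵀ := by
    rw [hU.eq, hU.conj_mul_conj, hU.conj_mul_conj, ← Matrix.sub_mul, ← Matrix.mul_sub,
      ← Matrix.add_mul, ← Matrix.mul_add, ← e1, hU.conj_conj]
  rw [e2, map_add, fderiv_exp_commutator, fderiv_exp_of_commute hB, hU.exp_eq, hU.conj_mul_conj,
    hU.conj_mul_conj, hU.conj_mul_conj, ← Matrix.sub_mul, ← Matrix.mul_sub,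
      ← Matrix.add_mul, ← Matrix.mul_add] at hH
  have h0 := hU.conj_injective (hH.trans (by simp : (0 : Tensor d) = U * 0 * Uᵀ))
  have hX0 : X = 0 := by
    ext i j
    have := congrFun (congrFun h0 i) j
    simp only [Ω', B', Matrix.add_apply, Matrix.sub_apply, Matrix.mul_diagonal,
      Matrix.diagonal_mul, Matrix.of_apply, Matrix.zero_apply] at this ⊢
    by_cases h : l i = l j
    · simpa [h] using this
    · have h1 : Real.exp (l j) - Real.exp (l i) ≠ 0 := fun e =>
        h (Real.exp_injective (by linarith))
      have h2 : l j - l i ≠ 0 := fun e => h (by linarith)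
      simp only [h, if_false, mul_zero, add_zero] at this
      have h3 : X i j / (l j - l i) * (Real.exp (l j) - Real.exp (l i)) = 0 := by linarith
      rcases mul_eq_zero.1 h3 with h4 | h4
      · exact (div_eq_zero_iff.1 h4).resolve_right h2
      · exact absurd h4 h1
  rw [← hU.conj_conj H, ← hX, hX0]; simp

theorem isUnit_fderiv_exp {ψ : Tensor d} (hψ : ψ.IsSymm) :
    IsUnit (fderiv ℝ (NormedSpace.exp : Tensor d → Tensor d) ψ) := by
  let e := (LinearEquiv.ofInjectiveEndo
    (fderiv ℝ (NormedSpace.exp : Tensor d → Tensor d) ψ : Tensor d →ₗ[ℝ] Tensor d)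
      (fderiv_exp_injective hψ)).toContinuousLinearEquiv
  refine ⟨ContinuousLinearEquiv.toUnit e, ?_⟩
  ext1 x
  rfl

/-- The linear map `G ↦ G e^ψ + e^ψ Gᵀ`. -/
def upperConvected (ψ : Tensor d) : Tensor d →ₗ[ℝ] Tensor d where
  toFun G := G * NormedSpace.exp ψ + NormedSpace.exp ψ * Gᵀ
  map_add' X Y := by simp only [Matrix.add_mul, Matrix.transpose_add, Matrix.mul_add]; abel
  map_smul' r X := by simp

/-- The stretching of `ψ` by a velocity gradient `G`: the preimage of `G e^ψ + e^ψ Gᵀ` under the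
derivative of the exponential at `ψ`. -/
def stretching (ψ : Tensor d) : Tensor d →ₗ[ℝ] Tensor d :=
  (Ring.inverse (fderiv ℝ NormedSpace.exp ψ) : Tensor d →L[ℝ] Tensor d).toLinearMap ∘ₗ
    upperConvected ψ

/-- In `G e^ψ + e^ψ Gᵀ` the two terms from `N` cancel, and what is left is the derivative of `exp`
applied to the right-hand side. Hence the terms of the scheme do not depend on the chosen
decomposition. -/
theorem stretching_eq {ψ G Ω B N : Tensor d} (hψ : ψ.IsSymm) (hΩ : Ωᵀ = -Ω) (hN : Nᵀ = -N)
    (hB : B.IsSymm) (hc : Commute B (NormedSpace.exp ψ))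
    (hG : G = Ω + B + N * NormedSpace.exp (-ψ)) :
    stretching ψ G = Ω * ψ - ψ * Ω + (2 : ℝ) • B := by
  have hu := isUnit_fderiv_exp hψ
  have hcψ := commute_of_commute_exp hψ hc
  have key : upperConvected ψ G = fderiv ℝ NormedSpace.exp ψ (Ω * ψ - ψ * Ω + (2 : ℝ) • B) := by
    rw [map_add, fderiv_exp_commutator, map_smul, fderiv_exp_of_commute hcψ]
    have hsy := isSymm_exp hψ.neg
    have e1 : NormedSpace.exp (-ψ) * NormedSpace.exp ψ = 1 := by
      rw [← Matrix.exp_add_of_commute _ _ ((Commute.refl ψ).neg_left)]; simp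
    have e2 : NormedSpace.exp ψ * NormedSpace.exp (-ψ) = 1 := by
      rw [← Matrix.exp_add_of_commute _ _ ((Commute.refl ψ).neg_right)]; simp
    show G * NormedSpace.exp ψ + NormedSpace.exp ψ * Gᵀ = _
    rw [hG]
    simp only [Matrix.transpose_add, Matrix.transpose_mul, hΩ, hN, hB.eq, hsy.eq, Matrix.add_mul,
      Matrix.mul_add]
    rw [Matrix.mul_assoc N, e1, ← Matrix.mul_assoc _ (NormedSpace.exp (-ψ)), e2, hc.eq, two_smul]
    simp only [Matrix.mul_one, Matrix.one_mul, Matrix.mul_neg]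
    abel
  show Ring.inverse (fderiv ℝ NormedSpace.exp ψ) (upperConvected ψ G) = _
  rw [key, ← mul_apply_eq_comp, Ring.inverse_mul_cancel _ hu]
  rfl

theorem isSymm_stretching {ψ : Tensor d} (hψ : ψ.IsSymm) (G : Tensor d) :
    (stretching ψ G).IsSymm := by
  obtain ⟨Ω, B, N, h⟩ := exists_linear_decomposition hψ
  obtain ⟨h1, h2, h3, h4, h5⟩ := h G
  rw [stretching_eq hψ h1 h2 h3 h4 h5, Matrix.IsSymm]
  simp only [Matrix.transpose_add, Matrix.transpose_sub, Matrix.transpose_mul, hψ.eq, h1,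
    Matrix.transpose_smul, h3.eq, Matrix.mul_neg, Matrix.neg_mul]
  abel

/-! ### Contraction and trace inequalities -/

theorem ddot_eq_trace (A B : Tensor d) : ddot A B = (A * Bᵀ).trace := by
  simp [ddot, Matrix.trace, Matrix.mul_apply]

theorem ddot_comm (A B : Tensor d) : ddot A B = ddot B A := by
  simp [ddot, mul_comm]

theorem ddot_add_left (A B C : Tensor d) : ddot (A + B) C = ddot A C + ddot B C := by
  simp [ddot, add_mul, Finset.sum_add_distrib]

theorem ddot_sub_left (A B C : Tensor d) : ddot (A - B) C = ddot A C - ddot B C := by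
  simp [ddot, sub_mul, Finset.sum_sub_distrib]

theorem ddot_smul_left (r : ℝ) (A B : Tensor d) : ddot (r • A) B = r * ddot A B := by
  simp [ddot, Finset.mul_sum, mul_assoc]

theorem ddot_sub_right (A B C : Tensor d) : ddot A (B - C) = ddot A B - ddot A C := by
  simp [ddot, mul_sub, Finset.sum_sub_distrib]

theorem ddot_self_nonneg (A : Tensor d) : 0 ≤ ddot A A :=
  Finset.sum_nonneg fun _ _ => Finset.sum_nonneg fun _ _ => mul_self_nonneg _

theorem ddot_self_eq_zero {A : Tensor d} (h : ddot A A = 0) : A = 0 := by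
  ext i j
  have h1 := (Finset.sum_eq_zero_iff_of_nonneg
    (fun _ _ => Finset.sum_nonneg fun _ _ => mul_self_nonneg _)).1 h i (Finset.mem_univ i)
  have h2 := (Finset.sum_eq_zero_iff_of_nonneg
    (fun _ _ => mul_self_nonneg _)).1 h1 j (Finset.mem_univ j)
  exact mul_self_eq_zero.1 h2

theorem ddot_one (A : Tensor d) : ddot A 1 = A.trace := by
  rw [ddot_eq_trace]; simp

/-- Commutators with `ψ` are orthogonal to functions of `ψ`, and antisymmetric tensors to symmetric
ones, so only `B` survives on either side. This is the work of the stress in the energy balance. -/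
theorem ddot_stretching {ψ : Tensor d} (hψ : ψ.IsSymm) (G : Tensor d) :
    ddot (stretching ψ G) (NormedSpace.exp ψ - 1) = 2 * ddot G (NormedSpace.exp ψ) - 2 * G.trace := by
  obtain ⟨Ω, B, N, h⟩ := exists_linear_decomposition hψ
  obtain ⟨h1, h2, h3, h4, h5⟩ := h G
  set Ω' := Ω G
  set B' := B G
  set N' := N G
  have hE := isSymm_exp hψ
  have hE' := isSymm_exp hψ.neg
  have htr0 : ∀ {X : Tensor d}, Xᵀ = -X → X.trace = 0 := fun {X} hX => by
    have := congrArg Matrix.trace hX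
    rw [Matrix.trace_transpose, Matrix.trace_neg] at this; linarith
  have htr : ∀ {X S : Tensor d}, Xᵀ = -X → S.IsSymm → (X * S).trace = 0 := fun {X S} hX hS => by
    have := Matrix.trace_transpose (X * S)
    rw [Matrix.transpose_mul, hX, hS.eq, Matrix.mul_neg, Matrix.trace_neg, Matrix.trace_mul_comm]
      at this
    linarith
  have e1 : NormedSpace.exp (-ψ) * NormedSpace.exp ψ = 1 := by
    rw [← Matrix.exp_add_of_commute _ _ ((Commute.refl ψ).neg_left)]; simp
  have hc : ψ * NormedSpace.exp ψ = NormedSpace.exp ψ * ψ :=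
    ((Commute.refl ψ).exp_right).eq
  rw [stretching_eq hψ h1 h2 h3 h4 h5, ddot_sub_right, ddot_one]
  have t1 : ddot (Ω' * ψ - ψ * Ω' + (2 : ℝ) • B') (NormedSpace.exp ψ)
      = 2 * ddot B' (NormedSpace.exp ψ) := by
    rw [ddot_add_left, ddot_smul_left, ddot_eq_trace (_ - _), hE.eq, Matrix.sub_mul,
      Matrix.trace_sub, Matrix.mul_assoc, hc, Matrix.mul_assoc ψ, Matrix.trace_mul_comm ψ,
      Matrix.mul_assoc]
    ring
  have t2 : (Ω' * ψ - ψ * Ω' + (2 : ℝ) • B').trace = 2 * B'.trace := by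
    rw [Matrix.trace_add, Matrix.trace_sub, Matrix.trace_mul_comm Ω', Matrix.trace_smul]
    simp
  have t3 : ddot G (NormedSpace.exp ψ) = ddot B' (NormedSpace.exp ψ) := by
    rw [ddot_eq_trace, ddot_eq_trace, hE.eq, h5, Matrix.add_mul, Matrix.add_mul, Matrix.mul_assoc N',
      e1, Matrix.trace_add, Matrix.trace_add, htr h1 hE, Matrix.mul_one, htr0 h2]
    ring
  have t4 : G.trace = B'.trace := by
    rw [h5, Matrix.trace_add, Matrix.trace_add, htr h2 hE', htr0 h1]; ring
  rw [t1, t2, t3, t4]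

/-- The double contraction in two eigenframes. -/
theorem ddot_eigenframes {A C U W : Tensor d} {a c : Fin d → ℝ} (hA : IsEigenframe A U a)
    (hC : IsEigenframe C W c) :
    ddot A C = ∑ i, ∑ k, (Uᵀ * W) i k ^ 2 * (a i * c k) := by
  rw [ddot_eq_trace, hC.isSymm.eq, hA.eq, hC.eq]
  have : (U * diagonal a * Uᵀ * (W * diagonal c * Wᵀ)).trace
      = ((diagonal a * (Uᵀ * W) * diagonal c) * (Uᵀ * W)ᵀ).trace := by
    rw [show U * diagonal a * Uᵀ * (W * diagonal c * Wᵀ)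
      = U * (diagonal a * Uᵀ * W * diagonal c * Wᵀ) by simp only [Matrix.mul_assoc],
      Matrix.trace_mul_comm]
    simp only [Matrix.mul_assoc, Matrix.transpose_mul, Matrix.transpose_transpose]
  rw [this, ← ddot_eq_trace, ddot]
  refine Finset.sum_congr rfl fun i _ => Finset.sum_congr rfl fun k _ => ?_
  rw [Matrix.mul_diagonal, Matrix.diagonal_mul]
  ring

theorem sum_sq_row {V : Tensor d} (h : V * Vᵀ = 1) (i : Fin d) : ∑ k, V i k ^ 2 = 1 := by
  have := congrFun (congrFun h i) i
  simpa [Matrix.mul_apply, pow_two] using this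

/-- Convexity of `tr ∘ exp`. -/
theorem trace_exp_sub_le {ψ a : Tensor d} (hψ : ψ.IsSymm) (ha : a.IsSymm) :
    (NormedSpace.exp ψ).trace - (NormedSpace.exp a).trace ≤ ddot (ψ - a) (NormedSpace.exp ψ) := by
  obtain ⟨U, l, hU⟩ := exists_isEigenframe hψ
  obtain ⟨W, m, hW⟩ := exists_isEigenframe ha
  have hV : (Uᵀ * W) * (Uᵀ * W)ᵀ = 1 := by
    rw [Matrix.transpose_mul, Matrix.transpose_transpose, Matrix.mul_assoc, ← Matrix.mul_assoc W,
      hW.mul_transpose, Matrix.one_mul, hU.transpose_mul]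
  have hV' : (Uᵀ * W)ᵀ * ((Uᵀ * W)ᵀ)ᵀ = 1 := by
    rw [Matrix.transpose_mul, Matrix.transpose_transpose, Matrix.transpose_mul,
      Matrix.transpose_transpose, Matrix.mul_assoc, ← Matrix.mul_assoc U,
      hU.mul_transpose, Matrix.one_mul, hW.transpose_mul]
  set V := Uᵀ * W with hVdef
  -- The squares `V i k ^ 2` form a doubly stochastic matrix. With these common weights the claim
  -- reduces to the scalar tangent inequality `exp l * (m - l + 1) ≤ exp m`.
  have e1 : (NormedSpace.exp ψ).trace = ∑ i, ∑ k, V i k ^ 2 * Real.exp (l i) := by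
    rw [hU.exp.trace_eq]
    refine Finset.sum_congr rfl fun i _ => ?_
    rw [← Finset.sum_mul, sum_sq_row hV, one_mul]
  have e2 : (NormedSpace.exp a).trace = ∑ i, ∑ k, V i k ^ 2 * Real.exp (m k) := by
    rw [hW.exp.trace_eq, Finset.sum_comm]
    refine Finset.sum_congr rfl fun k _ => ?_
    rw [← Finset.sum_mul]
    have := sum_sq_row hV' k
    simp only [Matrix.transpose_apply] at this
    rw [this, one_mul]
  have e3 : ddot ψ (NormedSpace.exp ψ) = ∑ i, ∑ k, V i k ^ 2 * (l i * Real.exp (l i)) := by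
    rw [ddot_eigenframes hU hU.exp, hU.transpose_mul]
    refine Finset.sum_congr rfl fun i _ => ?_
    rw [← Finset.sum_mul, sum_sq_row hV, one_mul, Finset.sum_eq_single i]
    · simp
    · intro k _ hk; simp [Matrix.one_apply_ne hk.symm]
    · simp
  have e4 : ddot a (NormedSpace.exp ψ) = ∑ i, ∑ k, V i k ^ 2 * (Real.exp (l i) * m k) := by
    rw [ddot_comm, ddot_eigenframes hU.exp hW]
  rw [ddot_sub_left, e1, e2, e3, e4]
  simp only [← Finset.sum_sub_distrib]
  refine Finset.sum_le_sum fun i _ => Finset.sum_le_sum fun k _ => ?_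
  have hc : Real.exp (l i) * (m k - l i + 1) ≤ Real.exp (m k) := by
    have := Real.add_one_le_exp (m k - l i)
    calc _ ≤ Real.exp (l i) * Real.exp (m k - l i) :=
          mul_le_mul_of_nonneg_left this (Real.exp_pos _).le
      _ = _ := by rw [← Real.exp_add]; ring_nf
  nlinarith [sq_nonneg (V i k)]

/-- The free energy density `tr (e^ψ - ψ)`. -/
def energy (ψ : Tensor d) : ℝ := (NormedSpace.exp ψ).trace - ψ.trace

theorem energy_sub_le {ψ a : Tensor d} (hψ : ψ.IsSymm) (ha : a.IsSymm) :
    energy ψ - energy a ≤ ddot (ψ - a) (NormedSpace.exp ψ - 1) := by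
  have := trace_exp_sub_le hψ ha
  rw [ddot_sub_right, ddot_one, Matrix.trace_sub]
  simp only [energy]
  linarith

/-- Coercivity of the energy, from the scalar inequality `|x| ≤ exp x - x`. -/
theorem sum_abs_eigenvalues_le_energy {ψ U : Tensor d} {l : Fin d → ℝ} (h : IsEigenframe ψ U l) :
    ∑ i, |l i| ≤ energy ψ := by
  rw [energy, h.exp.trace_eq, h.trace_eq, ← Finset.sum_sub_distrib]
  refine Finset.sum_le_sum fun i _ => ?_
  have h1 := Real.add_one_le_exp (l i)
  rcases abs_cases (l i) with ⟨e, he⟩ | ⟨e, he⟩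
  · rw [e]
    have := Real.quadratic_le_exp_of_nonneg he
    nlinarith [sq_nonneg (l i - 1)]
  · rw [e]; linarith [Real.exp_pos (l i)]

theorem energy_nonneg {ψ : Tensor d} (hψ : ψ.IsSymm) : 0 ≤ energy ψ := by
  obtain ⟨U, l, h⟩ := exists_isEigenframe hψ
  exact (Finset.sum_nonneg fun _ _ => abs_nonneg _).trans (sum_abs_eigenvalues_le_energy h)

theorem trace_exp_le {ψ : Tensor d} (hψ : ψ.IsSymm) :
    (NormedSpace.exp ψ).trace ≤ 2 * energy ψ := by
  obtain ⟨U, l, h⟩ := exists_isEigenframe hψ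
  have h1 := sum_abs_eigenvalues_le_energy h
  have h2 : ψ.trace ≤ ∑ i, |l i| := by
    rw [h.trace_eq]; exact Finset.sum_le_sum fun i _ => le_abs_self _
  have : (NormedSpace.exp ψ).trace = energy ψ + ψ.trace := by simp [energy]
  linarith

theorem abs_entry_le_sum {ψ U : Tensor d} {l : Fin d → ℝ} (h : IsEigenframe ψ U l) (i j : Fin d) :
    |ψ i j| ≤ ∑ k, |l k| := by
  have hU : ∀ i k, |U i k| ≤ 1 := fun i k => by
    have h1 := sum_sq_row h.mul_transpose i
    have h2 : U i k ^ 2 ≤ 1 := h1 ▸ Finset.single_le_sum (f := fun k => U i k ^ 2)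
      (fun _ _ => sq_nonneg _) (Finset.mem_univ k)
    exact (sq_le_one_iff_abs_le_one _).1 h2
  have : ψ i j = ∑ k, U i k * l k * U j k := by
    conv_lhs => rw [h.eq]
    rw [Matrix.mul_apply]
    simp [Matrix.mul_diagonal]
  rw [this]
  refine (Finset.abs_sum_le_sum_abs _ _).trans (Finset.sum_le_sum fun k _ => ?_)
  rw [abs_mul, abs_mul]
  have h1 := hU i k
  have h2 := hU j k
  have h3 := abs_nonneg (l k)
  calc |U i k| * |l k| * |U j k| ≤ 1 * |l k| * 1 := by gcongr
    _ = _ := by ring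

theorem abs_entry_le_energy {ψ : Tensor d} (hψ : ψ.IsSymm) (i j : Fin d) : |ψ i j| ≤ energy ψ := by
  obtain ⟨U, l, h⟩ := exists_isEigenframe hψ
  exact (abs_entry_le_sum h i j).trans (sum_abs_eigenvalues_le_energy h)

theorem abs_exp_entry_le {ψ : Tensor d} (hψ : ψ.IsSymm) (i j : Fin d) :
    |NormedSpace.exp ψ i j| ≤ (NormedSpace.exp ψ).trace := by
  obtain ⟨U, l, h⟩ := exists_isEigenframe hψ
  refine (abs_entry_le_sum h.exp i j).trans (le_of_eq ?_)
  rw [h.exp.trace_eq]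
  exact Finset.sum_congr rfl fun k _ => abs_of_pos (Real.exp_pos _)

/-- On eigenvalues, `(exp (-l) - 1) * (exp l - 1) = 2 - exp l - exp (-l) ≤ 0`: relaxation dissipates
free energy. -/
theorem relaxation_nonpos {ψ : Tensor d} (hψ : ψ.IsSymm) :
    ddot (NormedSpace.exp (-ψ) - 1) (NormedSpace.exp ψ - 1) ≤ 0 := by
  obtain ⟨U, l, h⟩ := exists_isEigenframe hψ
  have e1 : NormedSpace.exp (-ψ) * NormedSpace.exp ψ = 1 := by
    rw [← Matrix.exp_add_of_commute _ _ ((Commute.refl ψ).neg_left)]; simp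
  rw [ddot_sub_left, ddot_sub_right, ddot_comm 1, ddot_one, ddot_one, ddot_eq_trace,
    (isSymm_exp hψ).eq, e1, h.neg.exp.trace_eq, Matrix.trace_sub, h.exp.trace_eq, Matrix.trace_one]
  have : (Fintype.card (Fin d) : ℝ) = ∑ _i : Fin d, (1 : ℝ) := by simp
  rw [this, ← Finset.sum_sub_distrib, ← Finset.sum_sub_distrib, ← Finset.sum_sub_distrib]
  refine Finset.sum_nonpos fun i _ => ?_
  have h1 := Real.add_one_le_exp (l i)
  have h2 := Real.add_one_le_exp (-l i)
  linarith

/-! ### Smoothness of the stretching -/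

theorem contDiffAt_inverse_fderiv_apply {E : Type*} [NormedAddCommGroup E] [NormedSpace ℝ E]
    [CompleteSpace E] {f : E → E} (hf : ContDiff ℝ 2 f) {x : E} (hx : IsUnit (fderiv ℝ f x))
    {h : E × E → E} (hh : ContDiff ℝ 1 h) (y : E) :
    ContDiffAt ℝ 1 (fun z : E × E => Ring.inverse (fderiv ℝ f z.1) (h z)) (x, y) := by
  obtain ⟨e, he⟩ := hx
  have h1 : ContDiff ℝ 1 (fderiv ℝ f) := hf.fderiv_right (by norm_num)
  have hr := contDiffAt_ringInverse ℝ (n := 1) e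
  rw [he] at hr
  have h2 : ContDiffAt ℝ 1 (fun z : E × E => Ring.inverse (fderiv ℝ f z.1)) (x, y) :=
    ContDiffAt.comp (x, y) (g := Ring.inverse) (f := fun z : E × E => fderiv ℝ f z.1) hr
      (h1.contDiffAt.comp _ contDiffAt_fst)
  exact h2.clm_apply hh.contDiffAt

/-- Eigenframes need not depend continuously on `ψ`; regularity comes instead from the smoothness of
inversion at a unit, applied to the derivative of `exp`. -/
theorem contDiffAt_stretching {ψ : Tensor d} (hψ : ψ.IsSymm) (G : Tensor d) :
    ContDiffAt ℝ 1 (fun z : Tensor d × Tensor d => stretching z.1 z.2) (ψ, G) := by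
  have hT : ContDiff ℝ 1 (fun X : Tensor d => Xᵀ) :=
    (LinearMap.toContinuousLinearMap
      (Matrix.transposeLinearEquiv (Fin d) (Fin d) ℝ ℝ).toLinearMap).contDiff
  have h3 : ContDiff ℝ 1 (fun z : Tensor d × Tensor d =>
      z.2 * NormedSpace.exp z.1 + NormedSpace.exp z.1 * z.2ᵀ) :=
    (contDiff_snd.mul (contDiff_exp.comp contDiff_fst)).add
      ((contDiff_exp.comp contDiff_fst).mul (hT.comp contDiff_snd))
  exact contDiffAt_inverse_fderiv_apply contDiff_exp (isUnit_fderiv_exp hψ) h3 G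

/-! ### A fixed point theorem for small perturbations of the identity -/

/-- Banach's theorem on a ball of `S`; the assumed bound on all solutions extends uniqueness beyond
the ball. The parameter `p` ranges over a compact ball because the velocity solution operator itself
varies with `δ`, and `c` must not. -/
theorem exists_unique_fixedPoint_of_small {E P : Type*} [NormedAddCommGroup E] [NormedSpace ℝ E]
    [FiniteDimensional ℝ E] [NormedAddCommGroup P] [NormedSpace ℝ P] [FiniteDimensional ℝ P]
    (S : Submodule ℝ E) (H : E × P → E) (hH : ∀ x ∈ S, ∀ p, ContDiffAt ℝ 1 H (x, p))
    -- `R₀` bounds the data, `R₁` every solution, `C` the parameter.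
    (hS : ∀ x ∈ S, ∀ p, H (x, p) ∈ S) (R₀ R₁ C : ℝ) :
    ∃ c : ℝ, 0 < c ∧ ∀ δ : ℝ, 0 ≤ δ → δ < c → ∀ a ∈ S, ‖a‖ ≤ R₀ → ∀ p : P, ‖p‖ ≤ C →
      (∀ x ∈ S, x = a + δ • H (x, p) → ‖x‖ ≤ R₁) → ∃! x, x ∈ S ∧ x = a + δ • H (x, p) := by
  have : ProperSpace E := FiniteDimensional.proper_real E
  have : ProperSpace P := FiniteDimensional.proper_real P
  -- The ball must contain every solution (`R₁`) and leave room for a perturbation of the data of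
  -- size one (`R₀ + 1`).
  set R := max R₁ (R₀ + 1) with hR
  have hSc : IsClosed (S : Set E) := S.closed_of_finiteDimensional
  have hcB : IsCompact (Metric.closedBall (0 : E) R ∩ S) :=
    (isCompact_closedBall _ _).inter_right hSc
  have hK : IsCompact ((Metric.closedBall (0 : E) R ∩ S) ×ˢ Metric.closedBall (0 : P) C) :=
    hcB.prod (isCompact_closedBall _ _)
  set D := (Metric.closedBall (0 : E) R ∩ S) ×ˢ Metric.closedBall (0 : P) C with hD
  have hll : LocallyLipschitzOn D H := by
    rintro ⟨x, p⟩ hx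
    obtain ⟨K, t, ht, hL⟩ := (hH x hx.1.2 p).exists_lipschitzOnWith
    exact ⟨K, t, mem_nhdsWithin_of_mem_nhds ht, hL⟩
  obtain ⟨K, hKL⟩ := LocallyLipschitzOn.exists_lipschitzOnWith_of_compact hK hll
  obtain ⟨M, hM⟩ := hK.exists_bound_of_continuousOn hKL.continuousOn
  set M' := max M 0
  have hM'0 : 0 ≤ M' := le_max_right _ _
  -- This bound gives both `δ * K ≤ 1 / 2` (contraction) and `δ * M' ≤ 1` (the ball is mapped to
  -- itself).
  refine ⟨1 / (2 * (K + 1) * (M' + 1)), by positivity, ?_⟩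
  intro δ hδ0 hδ a ha haR p hp hap
  have hδ' : δ * (2 * (K + 1) * (M' + 1)) < 1 := by rwa [lt_div_iff₀ (by positivity)] at hδ
  have hK0 : (0 : ℝ) ≤ K := K.2
  have hδK : δ * K ≤ 1 / 2 := by nlinarith [mul_nonneg hδ0 hK0, mul_nonneg hδ0 hM'0, mul_nonneg (mul_nonneg hδ0 hK0) hM'0]
  have hδM : δ * M' ≤ 1 := by nlinarith [mul_nonneg hδ0 hK0, mul_nonneg hδ0 hM'0, mul_nonneg (mul_nonneg hδ0 hK0) hM'0]
  set B := Metric.closedBall (0 : E) R ∩ S with hB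
  have hpD : ∀ x ∈ B, (x, p) ∈ D := fun x hx => ⟨hx, by simpa using hp⟩
  set Φ : E → E := fun x => a + δ • H (x, p) with hΦ
  have hmaps : Set.MapsTo Φ B B := by
    intro x hx
    refine ⟨?_, S.add_mem ha (S.smul_mem _ (hS x hx.2 p))⟩
    rw [mem_closedBall_zero_iff]
    have h1 : ‖H (x, p)‖ ≤ M' := (hM _ (hpD x hx)).trans (le_max_left _ _)
    calc ‖a + δ • H (x, p)‖ ≤ ‖a‖ + ‖δ • H (x, p)‖ := norm_add_le _ _
      _ ≤ R₀ + 1 := by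
        rw [norm_smul, Real.norm_of_nonneg hδ0]
        have := mul_le_mul_of_nonneg_left h1 hδ0
        linarith
      _ ≤ R := le_max_right _ _
  have hdist : ∀ x ∈ B, ∀ y ∈ B, dist (Φ x) (Φ y) ≤ 1 / 2 * dist x y := by
    intro x hx y hy
    have h1 := hKL.dist_le_mul _ (hpD x hx) _ (hpD y hy)
    have h2 : dist (x, p) (y, p) = dist x y := by simp [Prod.dist_eq]
    rw [h2] at h1
    simp only [hΦ, dist_add_left]
    rw [dist_smul₀, Real.norm_of_nonneg hδ0]
    have h3 := mul_le_mul_of_nonneg_left h1 hδ0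
    have h4 := mul_le_mul_of_nonneg_right hδK (dist_nonneg (x := x) (y := y))
    linarith
  have haB : a ∈ B := ⟨by rw [mem_closedBall_zero_iff]; exact haR.trans ((by linarith : R₀ ≤ R₀ + 1).trans (le_max_right _ _)), ha⟩
  have hcontr : ContractingWith (1 / 2) (hmaps.restrict Φ B B) := by
    refine ⟨by norm_num, LipschitzWith.of_dist_le_mul fun x y => ?_⟩
    have := hdist x x.2 y y.2
    simpa [Subtype.dist_eq] using this
  obtain ⟨x, hxB, hx, -⟩ := ContractingWith.exists_fixedPoint' hcB.isComplete hmaps hcontr haB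
    (edist_ne_top _ _)
  refine ⟨x, ⟨hxB.2, hx.symm⟩, ?_⟩
  rintro y ⟨hyS, hy⟩
  have hyB : y ∈ B := ⟨by
    rw [mem_closedBall_zero_iff]; exact (hap y hyS hy).trans (le_max_left _ _), hyS⟩
  have h1 := hdist y hyB x hxB
  rw [show Φ y = y from hy.symm, show Φ x = x from hx] at h1
  have := dist_nonneg (x := y) (y := x)
  exact dist_le_zero.1 (by linarith)

/-! ### The discrete velocity problem -/

section Velocity

variable {V E : Type*} [NormedAddCommGroup V] [InnerProductSpace ℝ V] [FiniteDimensional ℝ V]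
  [NormedAddCommGroup E] [NormedSpace ℝ E] [FiniteDimensional ℝ E]

theorem exists_bilinear_bound (g : E →ₗ[ℝ] V →ₗ[ℝ] ℝ) : ∃ C, 0 ≤ C ∧ ∀ e v, |g e v| ≤ C * ‖e‖ * ‖v‖ := by
  let G : E →L[ℝ] V →L[ℝ] ℝ := LinearMap.toContinuousLinearMap
    ((LinearMap.toContinuousLinearMap : (V →ₗ[ℝ] ℝ) ≃ₗ[ℝ] V →L[ℝ] ℝ).toLinearMap ∘ₗ g)
  exact ⟨‖G‖, G.opNorm_nonneg, fun e v => G.le_opNorm₂ e v⟩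

theorem exists_coercive (m : V →ₗ[ℝ] V →ₗ[ℝ] ℝ) (hm : ∀ v, v ≠ 0 → 0 < m v v) :
    ∃ k : ℝ, 0 < k ∧ ∀ v, k * ‖v‖ ^ 2 ≤ m v v := by
  have : ProperSpace V := FiniteDimensional.proper_real V
  let G : V →L[ℝ] V →L[ℝ] ℝ := LinearMap.toContinuousLinearMap
    ((LinearMap.toContinuousLinearMap : (V →ₗ[ℝ] ℝ) ≃ₗ[ℝ] V →L[ℝ] ℝ).toLinearMap ∘ₗ m)
  have hG : ∀ v, G v v = m v v := fun v => rfl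
  have hc : Continuous fun v => m v v := by
    simp only [← hG]; fun_prop
  rcases (Metric.sphere (0 : V) 1).eq_empty_or_nonempty with h | h
  · refine ⟨1, one_pos, fun v => ?_⟩
    by_cases hv : v = 0
    · simp [hv]
    · exfalso
      have : ‖v‖⁻¹ • v ∈ Metric.sphere (0 : V) 1 := by
        rw [mem_sphere_zero_iff_norm, norm_smul, norm_inv, norm_norm,
          inv_mul_cancel₀ (norm_ne_zero_iff.2 hv)]
      rw [h] at this; exact this
  · obtain ⟨x, hx, hmin⟩ := (isCompact_sphere (0 : V) 1).exists_isMinOn h hc.continuousOn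
    have hx0 : x ≠ 0 := by
      rintro rfl; simp at hx
    refine ⟨m x x, hm x hx0, fun v => ?_⟩
    by_cases hv : v = 0
    · simp [hv]
    · have hn : ‖v‖ ≠ 0 := norm_ne_zero_iff.2 hv
      have hmem : ‖v‖⁻¹ • v ∈ Metric.sphere (0 : V) 1 := by
        rw [mem_sphere_zero_iff_norm, norm_smul, norm_inv, norm_norm, inv_mul_cancel₀ hn]
      have := hmin hmem
      simp only [Set.mem_ofPred_eq, map_smul, LinearMap.smul_apply, smul_eq_mul] at this
      calc m x x * ‖v‖ ^ 2 ≤ ‖v‖⁻¹ * (‖v‖⁻¹ * m v v) * ‖v‖ ^ 2 := by gcongr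
        _ = m v v := by field_simp

/-- The response to the old velocity is bounded by the mass term and the response `W` to the stress
by the viscous term, whose factor `δ` cancels against that of the load; so `C` does not depend on
`δ`. Testing the equation of `W e` with `W e` gives the sign of `g e (W e)`. -/
theorem exists_velocity_solution (m c : V →ₗ[ℝ] V →ₗ[ℝ] ℝ) (hm : ∀ v, v ≠ 0 → 0 < m v v)
    (g : E →ₗ[ℝ] V →ₗ[ℝ] ℝ) (f : V →ₗ[ℝ] ℝ) (Z : Submodule ℝ V) (Re κ η : ℝ) (hRe : 0 ≤ Re)
    (hκ : 0 < κ) (hη : 0 ≤ η) :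
    ∃ c₁ : ℝ, 0 < c₁ ∧ ∃ C : ℝ, ∀ δ : ℝ, 0 < δ → δ < c₁ → ∃ u₀ ∈ Z, ∃ W : E →L[ℝ] V, ‖u₀‖ ≤ C ∧ ‖W‖ ≤ C ∧
      (∀ e, W e ∈ Z) ∧ (∀ e, g e (W e) ≤ 0) ∧
      ∀ e u, (u ∈ Z ∧ ∀ v ∈ Z,
        Re * (m u v - f v + δ * c u v) + δ * (κ * inner ℝ u v + η * g e v) = 0) ↔ u = u₀ + W e := by
  obtain ⟨Cc, hCc0, hCc⟩ := exists_bilinear_bound c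
  obtain ⟨Cg, hCg0, hCg⟩ := exists_bilinear_bound g
  obtain ⟨km, hkm, hkmm⟩ := exists_coercive m hm
  set Cf := ‖LinearMap.toContinuousLinearMap f‖
  have hf : ∀ v, f v ≤ Cf * ‖v‖ := fun v =>
    (le_abs_self _).trans ((LinearMap.toContinuousLinearMap f).le_opNorm v)
  -- Below this threshold convection is absorbed by half of the mass term; the two entries of the
  -- maximum bound `u₀` and `W`.
  refine ⟨km / (2 * (Cc + 1)), by positivity, max (2 * Cf / km) (η * Cg / κ), ?_⟩
  intro δ hδ hδc
  have hδC : δ * Cc ≤ km / 2 := by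
    rw [lt_div_iff₀ (by positivity)] at hδc
    nlinarith
  let a : V →ₗ[ℝ] V →ₗ[ℝ] ℝ := Re • (m + δ • c) + (δ * κ) • innerₗ V
  have ha : ∀ u v, a u v = Re * (m u v + δ * c u v) + δ * κ * inner ℝ u v := fun u v => rfl
  have hco : ∀ v, Re * (km / 2 * ‖v‖ ^ 2) + δ * κ * ‖v‖ ^ 2 ≤ a v v := by
    intro v
    rw [ha, real_inner_self_eq_norm_sq]
    have h1 := hkmm v
    have h2 := neg_le_of_abs_le (hCc v v)
    have h3 : km / 2 * ‖v‖ ^ 2 ≤ m v v + δ * c v v := by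
      have h4 := mul_le_mul_of_nonneg_left h2 hδ.le
      have h5 := mul_le_mul_of_nonneg_right hδC (sq_nonneg ‖v‖)
      nlinarith
    have := mul_le_mul_of_nonneg_left h3 hRe
    linarith
  let r : (V →ₗ[ℝ] ℝ) →ₗ[ℝ] Module.Dual ℝ Z := Z.subtype.dualMap
  let T : Z →ₗ[ℝ] Module.Dual ℝ Z := r ∘ₗ a ∘ₗ Z.subtype
  have hT : ∀ z w : Z, T z w = a z w := fun z w => rfl
  have hinj : Function.Injective T := by
    rw [injective_iff_map_eq_zero]
    intro z hz
    have h0 : a z z = 0 := by rw [← hT, hz]; rfl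
    have h1 := hco z
    rw [h0] at h1
    have h2 : 0 ≤ Re * (km / 2 * ‖(z : V)‖ ^ 2) := by positivity
    have h3 : ‖(z : V)‖ ^ 2 ≤ 0 := by
      by_contra hne
      push Not at hne
      have := mul_pos (mul_pos hδ hκ) hne
      linarith
    have h4 : ‖(z : V)‖ = 0 := by nlinarith [sq_nonneg ‖(z : V)‖]
    exact Subtype.ext (norm_eq_zero.1 h4)
  let e := LinearMap.linearEquivOfInjective T hinj (Subspace.dual_finrank_eq).symm
  have heT : ∀ z, e z = T z := fun z => rfl
  have hes : ∀ ℓ, ∀ w : Z, a (e.symm ℓ) w = ℓ w := fun ℓ w => by rw [← hT, ← heT, e.apply_symm_apply]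
  let u₀ : Z := e.symm (Re • r f)
  let Wl : E →ₗ[ℝ] Z := -((δ * η) • (e.symm.toLinearMap ∘ₗ r ∘ₗ g))
  have hWl : ∀ x, Wl x = -((δ * η) • e.symm (r (g x))) := fun x => rfl
  have hu₀ : ∀ w : Z, a u₀ w = Re * f w := fun w => hes _ w
  have hW : ∀ x (w : Z), a (Wl x) w = -(δ * η * g x w) := fun x w => by
    rw [hWl]
    have := hes (r (g x)) w
    simp only [Submodule.coe_neg, Submodule.coe_smul, map_neg, map_smul, LinearMap.neg_apply,
      LinearMap.smul_apply, this, smul_eq_mul]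
    rfl
  let W : E →L[ℝ] V := LinearMap.toContinuousLinearMap (Z.subtype ∘ₗ Wl)
  have hWW : ∀ x, W x = (Wl x : V) := fun x => rfl
  have hmem : ∀ x, W x ∈ Z := fun x => (Wl x).2
  have hWb : ∀ x, ‖W x‖ ≤ η * Cg / κ * ‖x‖ := by
    intro x
    have h1 := hco (W x)
    rw [show a (W x) (W x) = _ from hW x (Wl x)] at h1
    have h2 := neg_le_of_abs_le (hCg x (W x))
    have h3 : 0 ≤ Re * (km / 2 * ‖W x‖ ^ 2) := by positivity
    have h4 : δ * (κ * ‖W x‖ ^ 2) ≤ δ * (η * (Cg * ‖x‖ * ‖W x‖)) := by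
      have := mul_le_mul_of_nonneg_left h2 (mul_nonneg hδ.le hη)
      rw [← hWW] at h1
      linarith
    have h5 := le_of_mul_le_mul_left h4 hδ
    rw [div_mul_eq_mul_div, le_div_iff₀ hκ]
    by_cases h6 : ‖W x‖ = 0
    · rw [h6, zero_mul]; positivity
    · have h7 : 0 < ‖W x‖ := lt_of_le_of_ne (norm_nonneg _) (Ne.symm h6)
      refine le_of_mul_le_mul_right ?_ h7
      linarith
  refine ⟨u₀, u₀.2, W, ?_, ?_, hmem, ?_, ?_⟩
  · refine le_trans ?_ (le_max_left _ _)
    have h1 := hco u₀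
    rw [hu₀] at h1
    have h2 := mul_le_mul_of_nonneg_left (hf u₀) hRe
    rw [le_div_iff₀ hkm]
    by_cases h6 : ‖(u₀ : V)‖ = 0
    · rw [h6, zero_mul]; positivity
    · have h7 : 0 < ‖(u₀ : V)‖ := lt_of_le_of_ne (norm_nonneg _) (Ne.symm h6)
      -- The viscous term makes the next inequality strict, so `Re` can be cancelled even though `Re
      -- = 0` is allowed; in that case `u₀ = 0`.
      have h8 : 0 < δ * κ * ‖(u₀ : V)‖ ^ 2 := by positivity
      have h9 : Re * (km / 2 * ‖(u₀ : V)‖ ^ 2) < Re * (Cf * ‖(u₀ : V)‖) := by linarith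
      have h10 := lt_of_mul_lt_mul_left h9 hRe
      have : (km / 2 * ‖(u₀ : V)‖) * ‖(u₀ : V)‖ < Cf * ‖(u₀ : V)‖ := by linarith
      have := lt_of_mul_lt_mul_right this h7.le
      linarith
  · exact (W.opNorm_le_bound (by positivity) hWb).trans (le_max_right _ _)
  · intro x
    rcases hη.eq_or_lt with h | h
    · have : W x = 0 := by
        rw [hWW, hWl, ← h]; simp
      rw [this, map_zero]
    · have h1 := hco (W x)
      rw [show a (W x) (W x) = _ from hW x (Wl x), ← hWW] at h1
      have h2 : 0 ≤ Re * (km / 2 * ‖W x‖ ^ 2) + δ * κ * ‖W x‖ ^ 2 := by positivity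
      have h3 : 0 ≤ -(δ * η * g x (W x)) := by linarith
      by_contra hne
      push Not at hne
      have := mul_pos (mul_pos hδ h) hne
      linarith
  · intro x u
    have hsol : ∀ v ∈ Z, a (u₀ + W x) v = Re * f v - δ * η * g x v := fun v hv => by
      rw [map_add, LinearMap.add_apply, hWW, hu₀ ⟨v, hv⟩, hW x ⟨v, hv⟩]; ring
    constructor
    · rintro ⟨huZ, hu⟩
      have hd : T (⟨u, huZ⟩ - (u₀ + ⟨W x, hmem x⟩)) = 0 := by
        ext w
        rw [hT]
        have h1 := hu w w.2
        have h2 := hsol w w.2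
        have h3 := ha u w
        simp only [Submodule.coe_sub, Submodule.coe_add, map_sub, LinearMap.sub_apply,
          LinearMap.zero_apply]
        rw [h2, h3]
        linarith
      have := hinj (hd.trans (map_zero T).symm)
      exact congrArg Subtype.val (sub_eq_zero.1 this)
    · rintro rfl
      refine ⟨Z.add_mem u₀.2 (hmem x), fun v hv => ?_⟩
      have h1 := hsol v hv
      rw [ha] at h1
      linarith

end Velocity

/-! ### The algebraic scheme and its reduction to an equation for the stress. -/

/-- The algebraic data of one time step: velocities `V`, pressures `Q`, elements `ι`. The forms are
the stiffness form `A`, the mass form `m`, the convection form `c` and the divergence form `b`;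
`g K v` is the integral of `∇v` over `K`, `vol K` the volume of `K`, and `j L K` the coefficient
of `ψ L : φ K` in the jump term. -/
structure LogScheme (d : ℕ) (V Q ι : Type*) [AddCommGroup V] [Module ℝ V] [AddCommGroup Q]
    [Module ℝ Q] [Fintype ι] where
  A : V →ₗ[ℝ] V →ₗ[ℝ] ℝ
  m : V →ₗ[ℝ] V →ₗ[ℝ] ℝ
  c : V →ₗ[ℝ] V →ₗ[ℝ] ℝ
  b : Q →ₗ[ℝ] V →ₗ[ℝ] ℝ
  g : ι → V →ₗ[ℝ] Tensor d
  vol : ι → ℝ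
  j : ι → ι → ℝ
  A_symm : ∀ u v, A u v = A v u
  A_pos : ∀ v, v ≠ 0 → 0 < A v v
  m_pos : ∀ v, v ≠ 0 → 0 < m v v
  vol_pos : ∀ K, 0 < vol K
  trace_g : ∀ u, (∀ q, b q u = 0) → ∑ K, (g K u).trace = 0
  jumpBound : ℝ
  jumpBound_nonneg : 0 ≤ jumpBound
  le_jump : ∀ ψ : ι → Tensor d, (∀ K, (ψ K).IsSymm) →
    -jumpBound * (1 + ∑ K, energy (ψ K)) ≤
      ∑ L, ∑ K, j L K * ddot (ψ L) (NormedSpace.exp (ψ K) - 1)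

namespace LogScheme

variable {V Q ι : Type*} [AddCommGroup V] [Module ℝ V] [AddCommGroup Q] [Module ℝ Q] [Fintype ι]
  (D : LogScheme d V Q ι)

/-- The discrete variational form. -/
def form (Re Wi ε δ : ℝ) (un : V) (a : ι → Tensor d) (u : V) (p : Q) (ψ : ι → Tensor d)
    (v : V) (q : Q) (φ : ι → Tensor d) : ℝ :=
  Re * (D.m (u - un) v + δ * D.c u v)
    + δ * (-D.b p v + D.b q u + (1 - ε) * D.A u v
      + ε / Wi * ∑ K, ddot (NormedSpace.exp (ψ K)) (D.g K v))
    + ∑ K, D.vol K * ddot (ψ K - a K) (φ K)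
    - δ * ∑ K, ddot (stretching (ψ K) (D.g K u)) (φ K)
    - δ * (1 / Wi * ∑ K, D.vol K * ddot (NormedSpace.exp (-ψ K) - 1) (φ K))
    + δ * ∑ L, ∑ K, D.j L K * ddot (ψ L) (φ K)

/-- Discretely divergence free velocities. -/
def divFree : Submodule ℝ V := (LinearMap.range D.b).dualCoannihilator

theorem mem_divFree {v : V} : v ∈ D.divFree ↔ ∀ q, D.b q v = 0 := by
  rw [divFree, Submodule.mem_dualCoannihilator]
  exact ⟨fun h q => h _ ⟨q, rfl⟩, by rintro h _ ⟨q, rfl⟩; exact h q⟩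

/-- Fields of symmetric tensors. -/
def symmetric (d : ℕ) (ι : Type*) : Submodule ℝ (ι → Tensor d) where
  carrier := {ψ | ∀ K, (ψ K).IsSymm}
  add_mem' h h' K := (h K).add (h' K)
  zero_mem' _ := Matrix.isSymm_zero
  smul_mem' r _ h K := (h K).smul r

/-- The contraction of elementwise entries with the velocity gradient. -/
def stressForm : (ι → Fin d → Fin d → ℝ) →ₗ[ℝ] V →ₗ[ℝ] ℝ :=
  LinearMap.mk₂ ℝ (fun e v => ∑ K, ddot (Matrix.of (e K)) (D.g K v))
    (fun e e' v => by
      rw [← Finset.sum_add_distrib]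
      exact Finset.sum_congr rfl fun K _ => ddot_add_left (Matrix.of (e K)) (Matrix.of (e' K)) _)
    (fun r e v => by
      rw [smul_eq_mul, Finset.mul_sum]
      exact Finset.sum_congr rfl fun K _ => ddot_smul_left r (Matrix.of (e K)) _)
    (fun e v v' => by
      rw [← Finset.sum_add_distrib]
      refine Finset.sum_congr rfl fun K _ => ?_
      rw [map_add, ddot_comm, ddot_add_left, ddot_comm, ddot_comm (D.g K v')])
    (fun r e v => by
      rw [smul_eq_mul, Finset.mul_sum]
      refine Finset.sum_congr rfl fun K _ => ?_
      rw [map_smul, ddot_comm, ddot_smul_left, ddot_comm])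

/-- The entries of `e^ψ`. -/
def expEntries (ψ : ι → Tensor d) : ι → Fin d → Fin d → ℝ := fun K i j => NormedSpace.exp (ψ K) i j

theorem stressForm_expEntries (ψ : ι → Tensor d) (v : V) :
    D.stressForm (expEntries ψ) v = ∑ K, ddot (NormedSpace.exp (ψ K)) (D.g K v) := rfl

/-- The rate of change of the stress in the element `K` for the velocity `u`. -/
def rate (Wi : ℝ) (u : V) (ψ : ι → Tensor d) (K : ι) : Tensor d :=
  (D.vol K)⁻¹ • stretching (ψ K) (D.g K u) + (1 / Wi) • (NormedSpace.exp (-ψ K) - 1)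
    - (D.vol K)⁻¹ • ∑ L, D.j L K • ψ L

theorem isSymm_rate (Wi : ℝ) (u : V) {ψ : ι → Tensor d} (hψ : ∀ K, (ψ K).IsSymm) (K : ι) :
    (D.rate Wi u ψ K).IsSymm := by
  refine Matrix.IsSymm.sub (Matrix.IsSymm.add ((isSymm_stretching (hψ K) _).smul _)
    (((isSymm_exp (hψ K).neg).sub Matrix.isSymm_one).smul _)) (Matrix.IsSymm.smul ?_ _)
  have h : (fun K => ∑ L, D.j L K • ψ L) ∈ symmetric d ι := by
    intro K
    rw [Matrix.IsSymm, Matrix.transpose_sum]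
    exact Finset.sum_congr rfl fun L _ => ((hψ L).smul _)
  exact h K

theorem ddot_sum_left {κ : Type*} (s : Finset κ) (f : κ → Tensor d) (B : Tensor d) :
    ddot (∑ k ∈ s, f k) B = ∑ k ∈ s, ddot (f k) B := by
  classical
  induction s using Finset.induction_on with
  | empty => simp [ddot]
  | insert k s hk ih => rw [Finset.sum_insert hk, Finset.sum_insert hk, ddot_add_left, ih]

theorem ddot_rate (Wi : ℝ) (u : V) (ψ φ : ι → Tensor d) :
    ∑ K, D.vol K * ddot (D.rate Wi u ψ K) (φ K) =
      ∑ K, ddot (stretching (ψ K) (D.g K u)) (φ K)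
      + 1 / Wi * ∑ K, D.vol K * ddot (NormedSpace.exp (-ψ K) - 1) (φ K)
      - ∑ L, ∑ K, D.j L K * ddot (ψ L) (φ K) := by
  rw [Finset.sum_comm (f := fun L K => D.j L K * ddot (ψ L) (φ K)), Finset.mul_sum,
    ← Finset.sum_add_distrib, ← Finset.sum_sub_distrib]
  refine Finset.sum_congr rfl fun K _ => ?_
  have hv := (D.vol_pos K).ne'
  rw [rate, ddot_sub_left, ddot_add_left, ddot_smul_left, ddot_smul_left, ddot_smul_left,
    ddot_sum_left]
  simp only [ddot_smul_left]
  field_simp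

theorem form_eq (Re Wi ε δ : ℝ) (un : V) (a : ι → Tensor d) (u : V) (p : Q) (ψ : ι → Tensor d)
    (v : V) (q : Q) (φ : ι → Tensor d) :
    D.form Re Wi ε δ un a u p ψ v q φ =
      Re * (D.m u v - D.m un v + δ * D.c u v)
      + δ * ((1 - ε) * D.A u v + ε / Wi * D.stressForm (expEntries ψ) v)
      - δ * D.b p v + δ * D.b q u
      + ∑ K, D.vol K * ddot (ψ K - (a K + δ • D.rate Wi u ψ K)) (φ K) := by
  have h : ∑ K, D.vol K * ddot (ψ K - (a K + δ • D.rate Wi u ψ K)) (φ K) =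
      ∑ K, D.vol K * ddot (ψ K - a K) (φ K) - δ * ∑ K, D.vol K * ddot (D.rate Wi u ψ K) (φ K) := by
    rw [Finset.mul_sum, ← Finset.sum_sub_distrib]
    refine Finset.sum_congr rfl fun K _ => ?_
    rw [← sub_sub, ddot_sub_left _ (δ • _), ddot_smul_left]
    ring
  rw [h, ddot_rate, stressForm_expEntries, form, map_sub, LinearMap.sub_apply]
  ring

/-- Only existence of a pressure is asked for, so no inf-sup condition is needed: in finite
dimension, a functional vanishing on the discretely divergence-free velocities lies in the range of
`b`. -/
theorem form_eq_zero_iff [FiniteDimensional ℝ V] {Re Wi ε δ : ℝ} (hδ : δ ≠ 0) {un : V}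
    {a : ι → Tensor d} (ha : ∀ K, (a K).IsSymm) {u : V} {ψ : ι → Tensor d}
    (hψ : ∀ K, (ψ K).IsSymm) :
    (∃ p, ∀ v q φ, (∀ K, (φ K).IsSymm) → 0 = D.form Re Wi ε δ un a u p ψ v q φ) ↔
      (u ∈ D.divFree ∧ ∀ v ∈ D.divFree, Re * (D.m u v - D.m un v + δ * D.c u v)
        + δ * ((1 - ε) * D.A u v + ε / Wi * D.stressForm (expEntries ψ) v) = 0) ∧
      ψ = a + δ • D.rate Wi u ψ := by
  constructor
  · rintro ⟨p, h⟩
    simp only [form_eq] at h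
    have h0 : ∀ K : ι, (0 : ι → Tensor d) K |>.IsSymm := fun K => Matrix.isSymm_zero
    have hd0 : ∀ X : Tensor d, ddot X 0 = 0 := fun X => by simp [ddot]
    refine ⟨⟨D.mem_divFree.2 fun q => ?_, fun v hv => ?_⟩, ?_⟩
    · have := h 0 q 0 h0
      simp only [map_zero, Pi.zero_apply, hd0, mul_zero, Finset.sum_const_zero, add_zero,
        sub_zero, zero_add] at this
      exact (mul_eq_zero.1 this.symm).resolve_left hδ
    · have := h v 0 0 h0
      rw [D.mem_divFree.1 hv] at this
      simp only [map_zero, LinearMap.zero_apply, Pi.zero_apply, hd0, mul_zero,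
        Finset.sum_const_zero, add_zero, sub_zero] at this
      exact this.symm
    -- The residual is symmetric, hence an admissible test field for itself.
    · set r : ι → Tensor d := fun K => ψ K - (a K + δ • D.rate Wi u ψ K) with hr
      have hrs : ∀ K, (r K).IsSymm := fun K =>
        (hψ K).sub ((ha K).add ((D.isSymm_rate Wi u hψ K).smul δ))
      have := h 0 0 r hrs
      simp only [map_zero, LinearMap.zero_apply, mul_zero, add_zero, sub_zero, zero_add] at this
      have h1 := (Finset.sum_eq_zero_iff_of_nonneg
        (fun K _ => mul_nonneg (D.vol_pos K).le (ddot_self_nonneg (r K)))).1 this.symm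
      ext1 K
      have h2 := (mul_eq_zero.1 (h1 K (Finset.mem_univ K))).resolve_left (D.vol_pos K).ne'
      exact sub_eq_zero.1 (ddot_self_eq_zero h2)
  · rintro ⟨⟨hu, hv⟩, hψe⟩
    let ℓ : V →ₗ[ℝ] ℝ := Re • (D.m u - D.m un + δ • D.c u)
      + δ • ((1 - ε) • D.A u + (ε / Wi) • D.stressForm (expEntries ψ))
    have hℓ : ∀ v, ℓ v = Re * (D.m u v - D.m un v + δ * D.c u v)
        + δ * ((1 - ε) * D.A u v + ε / Wi * D.stressForm (expEntries ψ) v) := fun v => rfl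
    have hmem : δ⁻¹ • ℓ ∈ LinearMap.range D.b := by
      rw [← Subspace.dualCoannihilator_dualAnnihilator_eq (W := LinearMap.range D.b)]
      rw [Submodule.mem_dualAnnihilator]
      intro v hv'
      rw [LinearMap.smul_apply, hℓ, hv v hv', smul_zero]
    obtain ⟨p, hp⟩ := hmem
    refine ⟨p, fun v q φ _ => ?_⟩
    rw [form_eq, hp, LinearMap.smul_apply, D.mem_divFree.1 hu, ← hℓ]
    have : ∀ K, ψ K - (a K + δ • D.rate Wi u ψ K) = 0 := fun K =>
      sub_eq_zero.2 (congrFun hψe K)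
    simp only [this, smul_eq_mul]
    have h0 : ∀ X : Tensor d, ddot 0 X = 0 := fun X => by simp [ddot]
    simp only [h0, mul_zero, Finset.sum_const_zero]
    field_simp
    ring

/-! ### A priori bound -/

theorem exists_vol_le : ∃ v₀ : ℝ, 0 < v₀ ∧ ∀ K, v₀ ≤ D.vol K := by
  rcases isEmpty_or_nonempty ι with h | h
  · exact ⟨1, one_pos, fun K => (h.false K).elim⟩
  · obtain ⟨K, hK⟩ := Finite.exists_min D.vol
    exact ⟨D.vol K, D.vol_pos K, hK⟩

theorem norm_tensor_le {X : Tensor d} {r : ℝ} (hr : 0 ≤ r) (h : ∀ i j, |X i j| ≤ r) :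
    ‖X‖ ≤ d * r := by
  rw [Matrix.linfty_opNorm_def]
  have : (Finset.univ.sup fun i => ∑ j, ‖X i j‖₊) ≤ (⟨d * r, by positivity⟩ : NNReal) := by
    refine Finset.sup_le fun i _ => ?_
    refine NNReal.coe_le_coe.1 ?_
    push_cast
    calc ∑ j, ‖X i j‖ ≤ ∑ _j : Fin d, r := Finset.sum_le_sum fun j _ => h i j
      _ = d * r := by simp
  exact_mod_cast this

theorem continuous_energy : Continuous (energy : Tensor d → ℝ) := by
  have h : Continuous (NormedSpace.exp : Tensor d → Tensor d) := (contDiff_exp (n := 0)).continuous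
  have ht : Continuous (fun X : Tensor d => X.trace) := Continuous.matrix_trace continuous_id
  exact (ht.comp h).sub ht

theorem exists_energy_le (R₀ : ℝ) (hR₀ : 0 ≤ R₀) :
    ∃ M : ℝ, 0 ≤ M ∧ ∀ a : Tensor d, (∀ i j, |a i j| ≤ R₀) → energy a ≤ M := by
  obtain ⟨M, hM⟩ := (isCompact_closedBall (0 : Tensor d) (d * R₀)).exists_bound_of_continuousOn
    continuous_energy.continuousOn
  refine ⟨max M 0, le_max_right _ _, fun a ha => ?_⟩
  exact (le_abs_self _).trans ((hM a (by
    rw [mem_closedBall_zero_iff]; exact norm_tensor_le hR₀ ha)).trans (le_max_left _ _))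

theorem abs_ddot_exp_le {ψ : Tensor d} (hψ : ψ.IsSymm) (G : Tensor d) {r : ℝ}
    (h : ∀ i j, |G i j| ≤ r) : ddot (NormedSpace.exp ψ) G ≤ 2 * (d * d * r) * energy ψ := by
  have h1 : ddot (NormedSpace.exp ψ) G ≤ ∑ _i : Fin d, ∑ _j : Fin d, (NormedSpace.exp ψ).trace * r := by
    refine Finset.sum_le_sum fun i _ => Finset.sum_le_sum fun j _ => ?_
    refine (le_abs_self _).trans ?_
    rw [abs_mul]
    exact mul_le_mul (abs_exp_entry_le hψ i j) (h i j) (abs_nonneg _)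
      ((abs_nonneg _).trans (abs_exp_entry_le hψ i j))
  -- For `d = 0` the hypothesis on the entries is void and does not give `0 ≤ r`.
  rcases Nat.eq_zero_or_pos d with rfl | hd
  · simp [ddot]
  · have hr : 0 ≤ r := (abs_nonneg _).trans (h ⟨0, hd⟩ ⟨0, hd⟩)
    refine h1.trans ?_
    simp only [Finset.sum_const, Finset.card_univ, Fintype.card_fin, nsmul_eq_mul]
    have := mul_le_mul_of_nonneg_right (trace_exp_le hψ) (by positivity : 0 ≤ d * d * r)
    linarith

/-- Every discrete stress solving the scheme has bounded energy if the time step is small. -/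
theorem energy_bound {Wi : ℝ} (hWi : 0 < Wi) (R₀ C : ℝ) (hR₀ : 0 ≤ R₀) (hC : 0 ≤ C) :
    ∃ c₂ : ℝ, 0 < c₂ ∧ ∃ R, 0 ≤ R ∧ ∀ δ, 0 ≤ δ → δ < c₂ → ∀ (a ψ : ι → Tensor d) (u₀ w : V),
      (∀ K, (a K).IsSymm) → (∀ K, (ψ K).IsSymm) → (∀ K i j, |a K i j| ≤ R₀) →
      (∀ K i j, |D.g K u₀ i j| ≤ C) → (u₀ + w) ∈ D.divFree →
      D.stressForm (expEntries ψ) w ≤ 0 → ψ = a + δ • D.rate Wi (u₀ + w) ψ →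
      ∑ K, energy (ψ K) ≤ R := by
  obtain ⟨v₀, hv₀, hvol⟩ := D.exists_vol_le
  obtain ⟨M, hM0, hM⟩ := exists_energy_le (d := d) R₀ hR₀
  -- The first summand bounds the work of the stress on `u₀`: a factor 2 from the stretching and
  -- another from `tr e^ψ ≤ 2 * energy`.
  set B := 4 * (d * d * C) + D.jumpBound
  have hj := D.jumpBound_nonneg
  have hB : 0 ≤ B := by positivity
  -- The threshold gives `δ * B ≤ v₀ / 2`, so that half of `v₀ * 𝓔` absorbs the growth terms; `M`
  -- bounds the energy of the data on each element.
  refine ⟨v₀ / (2 * (B + 1)), by positivity, 2 / v₀ * (∑ K, D.vol K * M + v₀ / 2), ?_, ?_⟩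
  · have : 0 ≤ ∑ K, D.vol K * M := Finset.sum_nonneg fun K _ => mul_nonneg (D.vol_pos K).le hM0
    positivity
  intro δ hδ0 hδ a ψ u₀ w ha hψ haR hg hu hw heq
  rw [lt_div_iff₀ (by positivity)] at hδ
  have hδB : δ * B ≤ v₀ / 2 := by nlinarith
  set 𝓔 := ∑ K, energy (ψ K) with h𝓔
  have h𝓔0 : 0 ≤ 𝓔 := Finset.sum_nonneg fun K _ => energy_nonneg (hψ K)
  have h1 : ∑ K, D.vol K * ddot (ψ K - a K) (NormedSpace.exp (ψ K) - 1) =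
      δ * ∑ K, D.vol K * ddot (D.rate Wi (u₀ + w) ψ K) (NormedSpace.exp (ψ K) - 1) := by
    rw [Finset.mul_sum]
    refine Finset.sum_congr rfl fun K _ => ?_
    have : ψ K - a K = δ • D.rate Wi (u₀ + w) ψ K := by
      conv_lhs => rw [heq]
      simp
    rw [this, ddot_smul_left]; ring
  have h2 : v₀ * 𝓔 - ∑ K, D.vol K * M ≤
      ∑ K, D.vol K * ddot (ψ K - a K) (NormedSpace.exp (ψ K) - 1) := by
    rw [h𝓔, Finset.mul_sum, ← Finset.sum_sub_distrib]
    refine Finset.sum_le_sum fun K _ => ?_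
    have e1 := mul_le_mul_of_nonneg_left (energy_sub_le (hψ K) (ha K)) (D.vol_pos K).le
    have e2 := mul_le_mul_of_nonneg_left (hM (a K) (haR K)) (D.vol_pos K).le
    have e3 := mul_le_mul_of_nonneg_right (hvol K) (energy_nonneg (hψ K))
    linarith
  have h3 : ∑ K, D.vol K * ddot (D.rate Wi (u₀ + w) ψ K) (NormedSpace.exp (ψ K) - 1) ≤
      4 * (d * d * C) * 𝓔 + D.jumpBound * (1 + 𝓔) := by
    rw [ddot_rate]
    -- The trace part sums to zero because `u₀ + w` is discretely divergence free.
    have e1 : ∑ K, ddot (stretching (ψ K) (D.g K (u₀ + w))) (NormedSpace.exp (ψ K) - 1) =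
        2 * D.stressForm (expEntries ψ) (u₀ + w) := by
      rw [stressForm_expEntries]
      simp only [ddot_stretching (hψ _)]
      rw [Finset.sum_sub_distrib, ← Finset.mul_sum, ← Finset.mul_sum,
        D.trace_g _ (D.mem_divFree.1 hu)]
      simp [ddot_comm]
    have e2 : D.stressForm (expEntries ψ) u₀ ≤ 2 * (d * d * C) * 𝓔 := by
      rw [stressForm_expEntries, h𝓔, Finset.mul_sum]
      exact Finset.sum_le_sum fun K _ => abs_ddot_exp_le (hψ K) _ (hg K)
    have e3 : 1 / Wi * ∑ K, D.vol K * ddot (NormedSpace.exp (-ψ K) - 1)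
        (NormedSpace.exp (ψ K) - 1) ≤ 0 := by
      refine mul_nonpos_of_nonneg_of_nonpos (by positivity) (Finset.sum_nonpos fun K _ => ?_)
      exact mul_nonpos_of_nonneg_of_nonpos (D.vol_pos K).le (relaxation_nonpos (hψ K))
    have e4 := D.le_jump ψ hψ
    -- The work of the stress on `w` is dropped because of its sign `hw`; no bound on `w` is needed.
    rw [e1, map_add]
    linarith
  have h4 : v₀ / 2 * 𝓔 ≤ ∑ K, D.vol K * M + v₀ / 2 := by
    have e1 := mul_le_mul_of_nonneg_left h3 hδ0
    have e2 : 4 * (d * d * C) * 𝓔 + D.jumpBound * (1 + 𝓔) ≤ B * (1 + 𝓔) := by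
      have : 0 ≤ 4 * (d * d * C) := by positivity
      simp only [B]; nlinarith
    have e3 := mul_le_mul_of_nonneg_left e2 hδ0
    have e4 := mul_le_mul_of_nonneg_right hδB (by linarith : 0 ≤ 1 + 𝓔)
    linarith
  calc 𝓔 = 2 / v₀ * (v₀ / 2 * 𝓔) := by field_simp
    _ ≤ _ := mul_le_mul_of_nonneg_left h4 (by positivity)

/-! ### Well-posedness -/

/-- The rate as a function of the stress and of the affine solution operator of the velocity. -/
def rateMap {V : Type*} [NormedAddCommGroup V] [InnerProductSpace ℝ V]
    (D : LogScheme d V Q ι) (Wi : ℝ)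
    (z : (ι → Tensor d) × (V × ((ι → Fin d → Fin d → ℝ) →L[ℝ] V))) : ι → Tensor d :=
  D.rate Wi (z.2.1 + z.2.2 (expEntries z.1)) z.1

theorem contDiffAt_rateMap {V : Type*} [NormedAddCommGroup V] [InnerProductSpace ℝ V]
    [FiniteDimensional ℝ V] (D : LogScheme d V Q ι) (Wi : ℝ) {ψ : ι → Tensor d}
    (hψ : ∀ K, (ψ K).IsSymm) (p : V × ((ι → Fin d → Fin d → ℝ) →L[ℝ] V)) :
    ContDiffAt ℝ 1 (D.rateMap Wi) (ψ, p) := by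
  have hK : ∀ K, ContDiff ℝ 1 (fun z : (ι → Tensor d) × (V × ((ι → Fin d → Fin d → ℝ) →L[ℝ] V)) =>
      z.1 K) := fun K => (contDiff_apply ℝ (Tensor d) K).comp contDiff_fst
  have hexp : ContDiff ℝ 1 (fun z : (ι → Tensor d) × (V × ((ι → Fin d → Fin d → ℝ) →L[ℝ] V)) =>
      expEntries z.1) := by
    refine contDiff_pi.2 fun K => contDiff_pi.2 fun i => contDiff_pi.2 fun j => ?_
    have h1 : ContDiff ℝ 1 (fun X : Tensor d => X i j) :=
      (LinearMap.toContinuousLinearMap (Matrix.entryLinearMap ℝ ℝ i j)).contDiff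
    exact h1.comp (contDiff_exp.comp (hK K))
  have hu : ContDiff ℝ 1 (fun z : (ι → Tensor d) × (V × ((ι → Fin d → Fin d → ℝ) →L[ℝ] V)) =>
      z.2.1 + z.2.2 (expEntries z.1)) :=
    (contDiff_fst.comp contDiff_snd).add ((contDiff_snd.comp contDiff_snd).clm_apply hexp)
  refine contDiffAt_pi.2 fun K => ?_
  have hg : ContDiff ℝ 1 (fun v : V => D.g K v) :=
    (LinearMap.toContinuousLinearMap (D.g K)).contDiff
  have h1 := ContDiffAt.comp (ψ, p)
    (f := fun z : (ι → Tensor d) × (V × ((ι → Fin d → Fin d → ℝ) →L[ℝ] V)) =>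
      (z.1 K, D.g K (z.2.1 + z.2.2 (expEntries z.1))))
    (contDiffAt_stretching (hψ K) _) ((hK K).prodMk (hg.comp hu)).contDiffAt
  have h2 : ContDiff ℝ 1 (fun z : (ι → Tensor d) × (V × ((ι → Fin d → Fin d → ℝ) →L[ℝ] V)) =>
      (1 / Wi) • (NormedSpace.exp (-z.1 K) - 1) - (D.vol K)⁻¹ • ∑ L, D.j L K • z.1 L) :=
    ((contDiff_exp.comp (hK K).neg).sub contDiff_const).const_smul _ |>.sub
      ((ContDiff.sum fun L _ => (hK L).const_smul _).const_smul _)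
  have h3 := (h1.const_smul (D.vol K)⁻¹).add h2.contDiffAt
  refine h3.congr_of_eventuallyEq (.of_forall fun z => ?_)
  simp only [rateMap, rate]
  exact add_sub_assoc _ _ _

/-- The threshold depends on `a` only through `R₀`. This matters for characteristics, where `a`
changes with the time step. -/
theorem exists_unique_aux {V : Type*} [NormedAddCommGroup V] [InnerProductSpace ℝ V]
    [FiniteDimensional ℝ V] (D : LogScheme d V Q ι) (hA : ∀ u v, D.A u v = inner ℝ u v)
    {Re Wi ε : ℝ} (hRe : 0 ≤ Re) (hWi : 0 < Wi) (hε₀ : 0 ≤ ε) (hε₁ : ε < 1) (un : V) (R₀ : ℝ)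
    (hR₀ : 0 ≤ R₀) :
    ∃ c₀ : ℝ, 0 < c₀ ∧ ∀ δ, 0 < δ → δ < c₀ → ∀ a : ι → Tensor d, (∀ K, (a K).IsSymm) →
      (∀ K i j, |a K i j| ≤ R₀) → ∃! Y : V × (ι → Tensor d), (∀ K, (Y.2 K).IsSymm) ∧
        ∃ p, ∀ v q φ, (∀ K, (φ K).IsSymm) → 0 = D.form Re Wi ε δ un a Y.1 p Y.2 v q φ := by
  obtain ⟨c₁, hc₁, C, hvel⟩ := exists_velocity_solution D.m D.c D.m_pos D.stressForm (D.m un)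
    D.divFree Re (1 - ε) (ε / Wi) hRe (by linarith) (by positivity)
  have hgC : ∃ C' : ℝ, 0 ≤ C' ∧ ∀ u : V, ‖u‖ ≤ C → ∀ K i j, |D.g K u i j| ≤ C' := by
    let G : V →ₗ[ℝ] (ι → Fin d → Fin d → ℝ) := LinearMap.pi fun K => LinearMap.pi fun i =>
      LinearMap.pi fun j => Matrix.entryLinearMap ℝ ℝ i j ∘ₗ D.g K
    refine ⟨‖LinearMap.toContinuousLinearMap G‖ * max C 0, by positivity, fun u hu K i j => ?_⟩
    have h1 := (LinearMap.toContinuousLinearMap G).le_opNorm u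
    have h2 : |D.g K u i j| ≤ ‖G u‖ :=
      (norm_le_pi_norm (G u K i) j).trans ((norm_le_pi_norm (G u K) i).trans (norm_le_pi_norm (G u) K))
    refine h2.trans (h1.trans ?_)
    gcongr
    exact hu.trans (le_max_left _ _)
  obtain ⟨C', hC', hgC'⟩ := hgC
  obtain ⟨c₂, hc₂, R, hR, hen⟩ := D.energy_bound hWi R₀ C' hR₀ hC'
  -- The factors `d` pass from bounds on entries to the operator norm, the largest absolute row sum.
  obtain ⟨c₃, hc₃, hfix⟩ := exists_unique_fixedPoint_of_small (symmetric d ι) (D.rateMap Wi)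
    (fun ψ hψ p => D.contDiffAt_rateMap Wi hψ p) (fun ψ hψ p K => D.isSymm_rate Wi _ hψ K)
    (d * R₀) (d * R) C
  refine ⟨min c₁ (min c₂ c₃), by positivity, fun δ hδ hδc a ha haR => ?_⟩
  obtain ⟨u₀, hu₀, W, hu₀C, hWC, hWZ, hW0, hiff⟩ := hvel δ hδ (hδc.trans_le (min_le_left _ _))
  have hδ₂ : δ < c₂ := hδc.trans_le ((min_le_right _ _).trans (min_le_left _ _))
  have hδ₃ : δ < c₃ := hδc.trans_le ((min_le_right _ _).trans (min_le_right _ _))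
  have haN : ‖a‖ ≤ d * R₀ := (pi_norm_le_iff_of_nonneg (by positivity)).2 fun K =>
    norm_tensor_le hR₀ (haR K)
  have hap : ∀ ψ ∈ symmetric d ι, ψ = a + δ • D.rateMap Wi (ψ, (u₀, W)) → ‖ψ‖ ≤ d * R := by
    intro ψ hψ heq
    have h1 := hen δ hδ.le hδ₂ a ψ u₀ (W (expEntries ψ)) ha hψ haR (hgC' u₀ hu₀C)
      (D.divFree.add_mem hu₀ (hWZ _)) (hW0 _) heq
    refine (pi_norm_le_iff_of_nonneg (by positivity)).2 fun K => norm_tensor_le hR fun i j => ?_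
    exact (abs_entry_le_energy (hψ K) i j).trans ((Finset.single_le_sum
      (f := fun K => energy (ψ K)) (fun K _ => energy_nonneg (hψ K)) (Finset.mem_univ K)).trans h1)
  obtain ⟨ψ, ⟨hψS, hψ⟩, huniq⟩ := hfix δ hδ.le hδ₃ a ha haN (u₀, W)
    (by rw [Prod.norm_def]; exact max_le hu₀C hWC) hap
  simp only [← hA] at hiff
  refine ⟨(u₀ + W (expEntries ψ), ψ), ⟨hψS, ?_⟩, ?_⟩
  · rw [D.form_eq_zero_iff hδ.ne' ha hψS]
    exact ⟨(hiff _ _).2 rfl, hψ⟩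
  · rintro ⟨u, ψ'⟩ ⟨hψ'S, h⟩
    rw [D.form_eq_zero_iff hδ.ne' ha hψ'S] at h
    have hu := (hiff _ _).1 h.1
    have hψ' : ψ' = ψ := huniq ψ' ⟨hψ'S, by
      rw [rateMap, ← hu]; exact h.2⟩
    subst hψ'
    exact Prod.ext hu rfl

/-- The stiffness form is positive definite and serves as the inner product on velocities. -/
theorem exists_unique_step [FiniteDimensional ℝ V] {Re Wi ε : ℝ} (hRe : 0 ≤ Re) (hWi : 0 < Wi)
    (hε₀ : 0 ≤ ε) (hε₁ : ε < 1) (un : V) (R₀ : ℝ) (hR₀ : 0 ≤ R₀) :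
    ∃ c₀ : ℝ, 0 < c₀ ∧ ∀ δ, 0 < δ → δ < c₀ → ∀ a : ι → Tensor d, (∀ K, (a K).IsSymm) →
      (∀ K i j, |a K i j| ≤ R₀) → ∃! Y : V × (ι → Tensor d), (∀ K, (Y.2 K).IsSymm) ∧
        ∃ p, ∀ v q φ, (∀ K, (φ K).IsSymm) → 0 = D.form Re Wi ε δ un a Y.1 p Y.2 v q φ := by
  let core : InnerProductSpace.Core ℝ V :=
    { inner := fun u v => D.A u v
      conj_inner_symm := fun u v => by simpa using D.A_symm v u
      re_inner_nonneg := fun u => by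
        by_cases h : u = 0
        · simp [h]
        · simpa using (D.A_pos u h).le
      add_left := fun u v w => by simp
      smul_left := fun u v r => by simp
      definite := fun u h => by
        by_contra hu
        exact (D.A_pos u hu).ne' h }
  let _ : NormedAddCommGroup V := core.toNormedAddCommGroup
  let _ : InnerProductSpace ℝ V := InnerProductSpace.ofCore core.toCore
  exact exists_unique_aux D (fun u v => rfl) hRe hWi hε₀ hε₁ un R₀ hR₀

end LogScheme

end Algebraic

/-! ### Polynomial functions -/

theorem hasFDerivAt_eval (P : MvPolynomial (Fin d) ℝ) (x : Space d) :
    HasFDerivAt (fun y : Space d => MvPolynomial.eval (fun i => y i) P)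
      (∑ j, MvPolynomial.eval (fun i => x i) (MvPolynomial.pderiv j P) •
        (EuclideanSpace.proj j : Space d →L[ℝ] ℝ)) x := by
  classical
  induction P using MvPolynomial.induction_on with
  | C a => simpa using hasFDerivAt_const a x
  | add p q hp hq =>
    simp only [map_add, add_smul, Finset.sum_add_distrib]
    exact hp.add hq
  | mul_X p n hp =>
    have hX : HasFDerivAt (fun y : Space d => y n) (EuclideanSpace.proj n : Space d →L[ℝ] ℝ) x :=
      (EuclideanSpace.proj n : Space d →L[ℝ] ℝ).hasFDerivAt
    have := hp.mul hX
    simp only [map_mul, MvPolynomial.eval_X]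
    refine this.congr_fderiv ?_
    simp only [Derivation.leibniz, smul_eq_mul, map_add, map_mul, MvPolynomial.eval_X,
      MvPolynomial.pderiv_X, add_smul, Finset.sum_add_distrib, Finset.smul_sum, smul_smul]
    congr 1
    rw [Finset.sum_eq_single n]
    · simp
    · intro j _ hj
      simp [Pi.single_eq_of_ne hj.symm]
    · simp

theorem fderiv_eval_single (P : MvPolynomial (Fin d) ℝ) (x : Space d) (j : Fin d) :
    fderiv ℝ (fun y : Space d => MvPolynomial.eval (fun i => y i) P) x (EuclideanSpace.single j 1) =
      MvPolynomial.eval (fun i => x i) (MvPolynomial.pderiv j P) := by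
  classical
  rw [(hasFDerivAt_eval P x).fderiv]
  simp only [sum_apply, smul_apply, smul_eq_mul]
  rw [Finset.sum_eq_single j]
  · simp
  · intro k _ hk
    simp [hk]
  · simp

theorem totalDegree_pderiv_le (P : MvPolynomial (Fin d) ℝ) (j : Fin d) :
    (MvPolynomial.pderiv j P).totalDegree ≤ P.totalDegree - 1 := by
  classical
  rw [P.as_sum, map_sum, ← P.as_sum]
  refine MvPolynomial.totalDegree_finsetSum_le fun s hs => ?_
  rw [MvPolynomial.pderiv_monomial]
  by_cases h : s j = 0
  · simp [h]
  · refine (MvPolynomial.totalDegree_monomial_le _ _).trans ?_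
    have h1 : (s.sum fun _ => id) ≤ P.totalDegree := MvPolynomial.le_totalDegree hs
    have h2 : s - Finsupp.single j 1 + Finsupp.single j 1 = s :=
      tsub_add_cancel_of_le (Finsupp.single_le_iff.2 (Nat.one_le_iff_ne_zero.2 h))
    have h3 : (s.sum fun _ => id) = ((s - Finsupp.single j 1).sum fun _ => id) + 1 := by
      conv_lhs => rw [← h2]
      rw [Finsupp.sum_add_index' (fun _ => rfl) (fun _ _ _ => rfl)]
      simp
    omega

theorem continuous_eval_poly (P : MvPolynomial (Fin d) ℝ) :
    Continuous fun y : Space d => MvPolynomial.eval (fun i => y i) P :=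
  (MvPolynomial.continuous_eval P).comp (by fun_prop)

namespace IsPolyOn

variable {k : ℕ} {s : Set (Space d)} {f g : Space d → ℝ}

theorem add (hf : IsPolyOn k s f) (hg : IsPolyOn k s g) : IsPolyOn k s (fun x => f x + g x) := by
  obtain ⟨P, hP, hP'⟩ := hf
  obtain ⟨Q, hQ, hQ'⟩ := hg
  exact ⟨P + Q, (MvPolynomial.totalDegree_add _ _).trans (max_le hP hQ), fun x hx => by
    rw [map_add, ← hP' x hx, ← hQ' x hx]⟩

theorem const_mul (r : ℝ) (hf : IsPolyOn k s f) : IsPolyOn k s (fun x => r * f x) := by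
  obtain ⟨P, hP, hP'⟩ := hf
  exact ⟨r • P, (MvPolynomial.totalDegree_smul_le _ _).trans hP, fun x hx => by
    rw [MvPolynomial.smul_eval, ← hP' x hx]⟩

theorem const (r : ℝ) : IsPolyOn k s (fun _ => r) :=
  ⟨MvPolynomial.C r, by simp, fun x _ => by simp⟩

theorem sum {ι : Type*} (t : Finset ι) {F : ι → Space d → ℝ} (h : ∀ i ∈ t, IsPolyOn k s (F i)) :
    IsPolyOn k s (fun x => ∑ i ∈ t, F i x) := by
  classical
  induction t using Finset.induction_on with
  | empty => simpa using const 0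
  | insert i t hi ih =>
    simp only [Finset.sum_insert hi]
    exact (h i (Finset.mem_insert_self _ _)).add (ih fun j hj => h j (Finset.mem_insert_of_mem hj))

theorem continuous (hf : IsPolyOn k Set.univ f) : Continuous f := by
  obtain ⟨P, -, hP⟩ := hf
  exact (continuous_eval_poly P).congr fun x => (hP x trivial).symm

end IsPolyOn

namespace Mesh

variable (T : Mesh d)

/-! ### Geometry of the mesh -/

theorem convex_cell (K : T.Elem) : Convex ℝ (T.cell K) := convex_convexHull ℝ _

theorem isCompact_cell (K : T.Elem) : IsCompact (T.cell K) := K.1.finite_toSet.isCompact_convexHull ℝ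

theorem interior_cell_nonempty (K : T.Elem) : (interior (T.cell K)).Nonempty := by
  rw [cell, interior_convexHull_nonempty_iff_affineSpan_eq_top]
  have h := T.indep K.2.1
  have := (h.affineSpan_eq_top_iff_card_eq_finrank_add_one).2 (by simp [K.2.2])
  simpa using this

theorem closure_interior_cell (K : T.Elem) : closure (interior (T.cell K)) = T.cell K := by
  rw [(T.convex_cell K).closure_interior_eq_closure_of_nonempty_interior
    (T.interior_cell_nonempty K), (T.isCompact_cell K).isClosed.closure_eq]

theorem cell_subset_space (K : T.Elem) : T.cell K ⊆ T.toSimplicialComplex.space :=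
  T.convexHull_subset_space K.2.1

theorem interior_cell_subset_domain (K : T.Elem) : interior (T.cell K) ⊆ T.domain :=
  interior_mono (T.cell_subset_space K)

theorem space_eq : T.toSimplicialComplex.space = ⋃ K, T.cell K := by
  refine Set.Subset.antisymm ?_ (Set.iUnion_subset T.cell_subset_space)
  intro x hx
  obtain ⟨s, hs, hx⟩ := T.mem_space_iff.1 hx
  obtain ⟨t, ht, hst, hc⟩ := T.pure_faces s hs
  exact Set.mem_iUnion.2 ⟨⟨t, ht, hc⟩, convexHull_mono (by exact_mod_cast hst) hx⟩

theorem exists_mem_cell {x : Space d} (hx : x ∈ T.domain) : ∃ K, x ∈ T.cell K := by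
  have := interior_subset hx
  rw [T.space_eq] at this
  exact Set.mem_iUnion.1 this

theorem isBounded_domain : Bornology.IsBounded T.domain := by
  refine Bornology.IsBounded.subset ?_ interior_subset
  rw [T.space_eq]
  exact (isCompact_iUnion T.isCompact_cell).isBounded

theorem isOpen_domain : IsOpen T.domain := isOpen_interior

theorem exists_notMem_domain (hd : 0 < d) : ∃ x, x ∉ T.domain := by
  have : Nonempty (Fin d) := ⟨⟨0, hd⟩⟩
  by_contra! h
  have := T.isBounded_domain
  rw [Set.eq_univ_of_forall h] at this
  exact NormedSpace.unbounded_univ ℝ (Space d) this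

/-- Two elements meet inside the hull of their common vertices; these are at most `d` points, whose
hull has empty interior. -/
theorem disjoint_interior_cell {K L : T.Elem} (h : K ≠ L) :
    Disjoint (interior (T.cell K)) (interior (T.cell L)) := by
  classical
  rw [Set.disjoint_iff_inter_eq_empty, ← interior_inter]
  by_contra hne
  have h1 : T.cell K ∩ T.cell L ⊆ convexHull ℝ ((K.1 ∩ L.1 : Finset (Space d)) : Set (Space d)) := by
    rw [Finset.coe_inter]
    exact T.inter_subset_convexHull K.2.1 L.2.1
  have h2 := (Set.nonempty_iff_ne_empty.2 hne).mono (interior_mono h1)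
  rw [interior_convexHull_nonempty_iff_affineSpan_eq_top] at h2
  have hlt : (K.1 ∩ L.1).card < d + 1 := by
    refine lt_of_lt_of_eq (Finset.card_lt_card ?_) K.2.2
    refine (Finset.inter_subset_left.ssubset_of_ne fun e => h ?_)
    have hs : K.1 ⊆ L.1 := Finset.inter_eq_left.1 e
    exact Subtype.ext (Finset.eq_of_subset_of_card_le hs (by rw [K.2.2, L.2.2]))
  have hind : AffineIndependent ℝ ((↑) : (K.1 ∩ L.1 : Finset (Space d)) → Space d) :=
    (T.indep K.2.1).mono (by exact_mod_cast Finset.inter_subset_left)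
  have := (hind.affineSpan_eq_top_iff_card_eq_finrank_add_one).1 (by
    rw [Subtype.range_coe]; exact h2)
  simp at this
  omega

theorem ae_mem_interior (K : T.Elem) :
    ∀ᵐ x ∂(volume.restrict (T.cell K)), x ∈ interior (T.cell K) := by
  have h0 : volume (frontier (T.cell K)) = 0 := (T.convex_cell K).addHaar_frontier volume
  rw [ae_restrict_iff' (T.isCompact_cell K).measurableSet]
  have : ∀ᵐ x ∂(volume : Measure (Space d)), x ∉ frontier (T.cell K) := measure_eq_zero_iff_ae_notMem.1 h0
  filter_upwards [this] with x hx hxK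
  by_contra hi
  exact hx ⟨subset_closure hxK, hi⟩

theorem cell_ae_eq_interior (K : T.Elem) :
    volume.restrict (interior (T.cell K)) = volume.restrict (T.cell K) := by
  refine Measure.restrict_congr_set ?_
  refine interior_ae_eq_of_null_frontier ((T.convex_cell K).addHaar_frontier volume)

theorem integral_congr_cell {K : T.Elem} {E : Type*} [NormedAddCommGroup E] [NormedSpace ℝ E]
    {f g : Space d → E} (h : ∀ x ∈ interior (T.cell K), f x = g x) :
    ∫ x in T.cell K, f x = ∫ x in T.cell K, g x :=
  integral_congr_ae ((T.ae_mem_interior K).mono h)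

/-- The volume of an element. -/
def vol (K : T.Elem) : ℝ := (volume (T.cell K)).toReal

theorem vol_pos (K : T.Elem) : 0 < T.vol K := by
  refine ENNReal.toReal_pos ?_ (T.isCompact_cell K).measure_ne_top
  exact ((isOpen_interior.measure_pos _ (T.interior_cell_nonempty K)).trans_le
    (measure_mono interior_subset)).ne'

theorem integral_const_cell (K : T.Elem) (r : ℝ) : ∫ _x in T.cell K, r = T.vol K * r := by
  rw [setIntegral_const, smul_eq_mul]; rfl

/-! ### Functions with a continuous extension from the interior of an element -/

/-- `f` agrees in the interior of the element `K` with a continuous function on the whole space. -/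
def HasExt (K : T.Elem) (f : Space d → ℝ) : Prop :=
  ∃ g : Space d → ℝ, Continuous g ∧ ∀ x ∈ interior (T.cell K), f x = g x

namespace HasExt

variable {T} {K : T.Elem} {f g : Space d → ℝ}

theorem of_continuous (hf : Continuous f) : T.HasExt K f := ⟨f, hf, fun _ _ => rfl⟩

theorem add (hf : T.HasExt K f) (hg : T.HasExt K g) : T.HasExt K (fun x => f x + g x) := by
  obtain ⟨f', hf', h⟩ := hf
  obtain ⟨g', hg', h'⟩ := hg
  exact ⟨_, hf'.add hg', fun x hx => congrArg₂ (· + ·) (h x hx) (h' x hx)⟩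

theorem mul (hf : T.HasExt K f) (hg : T.HasExt K g) : T.HasExt K (fun x => f x * g x) := by
  obtain ⟨f', hf', h⟩ := hf
  obtain ⟨g', hg', h'⟩ := hg
  exact ⟨_, hf'.mul hg', fun x hx => congrArg₂ (· * ·) (h x hx) (h' x hx)⟩

theorem sum {ι : Type*} (t : Finset ι) {F : ι → Space d → ℝ} (h : ∀ i ∈ t, T.HasExt K (F i)) :
    T.HasExt K (fun x => ∑ i ∈ t, F i x) := by
  classical
  induction t using Finset.induction_on with
  | empty => simpa using of_continuous continuous_const
  | insert i t hi ih =>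
    simp only [Finset.sum_insert hi]
    exact (h i (Finset.mem_insert_self _ _)).add (ih fun j hj => h j (Finset.mem_insert_of_mem hj))

theorem integrableOn (hf : T.HasExt K f) : IntegrableOn f (T.cell K) := by
  obtain ⟨g, hg, h⟩ := hf
  have h1 : IntegrableOn g (T.cell K) := hg.continuousOn.integrableOn_compact (T.isCompact_cell K)
  exact Integrable.congr h1 ((T.ae_mem_interior K).mono fun x hx => (h x hx).symm)

theorem eq_zero_of_integral (hf : T.HasExt K f) (h0 : ∀ x, 0 ≤ f x)
    (hint : ∫ x in T.cell K, f x = 0) : ∀ x ∈ interior (T.cell K), f x = 0 := by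
  have h1 := (setIntegral_eq_zero_iff_of_nonneg_ae (.of_forall h0) hf.integrableOn).1 hint
  obtain ⟨g, hg, h⟩ := hf
  rw [← T.cell_ae_eq_interior] at h1
  have h2 : g =ᵐ[volume.restrict (interior (T.cell K))] 0 := by
    filter_upwards [h1, ae_restrict_mem isOpen_interior.measurableSet] with x hx hxi
    rw [← h x hxi, hx]
  intro x hx
  rw [h x hx]
  exact Measure.eqOn_open_of_ae_eq h2 isOpen_interior hg.continuousOn continuousOn_const hx

end HasExt

/-! ### The finite element spaces as submodules -/

/-- The velocity space as a submodule. -/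
def velocity : Submodule ℝ (Space d → Space d) where
  carrier := T.VelocitySpace
  add_mem' {u v} hu hv := ⟨hu.1.add hv.1, fun x hx => by simp [hu.2.1 x hx, hv.2.1 x hx],
    fun K i => (hu.2.2 K i).add (hv.2.2 K i)⟩
  zero_mem' := ⟨continuous_const, fun _ _ => rfl, fun _ _ => IsPolyOn.const 0⟩
  smul_mem' r u hu := ⟨hu.1.const_smul r, fun x hx => by simp [hu.2.1 x hx],
    fun K i => (hu.2.2 K i).const_mul r⟩

/-- The pressure space as a submodule. -/
def pressure : Submodule ℝ (T.Elem → Space d → ℝ) where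
  carrier := T.PressureSpace
  add_mem' hp hq K := (hp K).add (hq K)
  zero_mem' _ := IsPolyOn.const 0
  smul_mem' r _ hp K := (hp K).const_mul r

variable {T}

theorem VelocitySpace.eq_zero {u : Space d → Space d} (hu : u ∈ T.VelocitySpace)
    (h : ∀ K, ∀ x ∈ interior (T.cell K), u x = 0) : u = 0 := by
  funext x
  by_cases hx : x ∈ T.domain
  · obtain ⟨K, hK⟩ := T.exists_mem_cell hx
    have hcl : IsClosed {y | u y = 0} := isClosed_eq hu.1 continuous_const
    have : closure (interior (T.cell K)) ⊆ {y | u y = 0} := hcl.closure_subset_iff.2 (h K)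
    rw [T.closure_interior_cell] at this
    exact this hK
  · exact hu.2.1 x hx

/-- A discrete velocity is determined by its coordinates on the elements, which lie in the image of
the polynomials of degree at most 2. -/
instance : FiniteDimensional ℝ T.velocity := by
  let ev : ∀ K : T.Elem, MvPolynomial (Fin d) ℝ →ₗ[ℝ] (T.cell K → ℝ) := fun K =>
    LinearMap.pi fun x => (MvPolynomial.aeval (fun i => x.1 i)).toLinearMap
  have hev : ∀ K P x, ev K P x = MvPolynomial.eval (fun i => x.1 i) P := fun K P x => by
    simp [ev, MvPolynomial.aeval_eq_eval]
  let S : ∀ K : T.Elem, Submodule ℝ (T.cell K → ℝ) := fun K =>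
    (MvPolynomial.restrictTotalDegree (Fin d) ℝ 2).map (ev K)
  let Φ : T.velocity →ₗ[ℝ] ∀ K : T.Elem, Fin d → S K := LinearMap.pi fun K => LinearMap.pi fun i =>
    LinearMap.codRestrict (S K)
      { toFun := fun u x => u.1 x.1 i
        map_add' := fun u v => by ext x; simp
        map_smul' := fun r u => by ext x; simp }
      (fun u => by
        obtain ⟨P, hP, h⟩ := u.2.2.2 K i
        exact ⟨P, (MvPolynomial.mem_restrictTotalDegree _ _ _).2 hP, by
          ext x; rw [hev]; exact (h x x.2).symm⟩)
  have hΦ : ∀ u K i (x : T.cell K), (Φ u K i : T.cell K → ℝ) x = u.1 x.1 i := fun _ _ _ _ => rfl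
  refine Module.Finite.of_injective Φ ?_
  rw [injective_iff_map_eq_zero]
  intro u hu
  refine Subtype.ext (VelocitySpace.eq_zero u.2 fun K x hx => ?_)
  ext i
  have := hΦ u K i ⟨x, interior_subset hx⟩
  rw [hu] at this
  exact this.symm

/-- In each element the gradient of a discrete velocity is an affine tensor field. -/
theorem VelocitySpace.exists_grad {u : Space d → Space d} (hu : u ∈ T.VelocitySpace) (K : T.Elem) :
    ∃ G : Space d → Tensor d, (∀ i j, IsPolyOn 1 Set.univ fun x => G x i j) ∧
      ∀ x ∈ interior (T.cell K), DifferentiableAt ℝ u x ∧ grad u x = G x := by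
  choose P hP hPu using hu.2.2 K
  refine ⟨fun x => .of fun i j => MvPolynomial.eval (fun k => x k) (MvPolynomial.pderiv j (P i)),
    fun i j => ⟨MvPolynomial.pderiv j (P i), (totalDegree_pderiv_le _ _).trans (by
      have := hP i; omega), fun x _ => rfl⟩, fun x hx => ?_⟩
  have hev : ∀ i, (fun y => u y i) =ᶠ[𝓝 x] fun y => MvPolynomial.eval (fun k => y k) (P i) :=
    fun i => Filter.eventuallyEq_of_mem (isOpen_interior.mem_nhds hx)
      fun y hy => hPu i y (interior_subset hy)
  have hd : DifferentiableAt ℝ u x := differentiableAt_euclidean.2 fun i =>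
    (hasFDerivAt_eval (P i) x).differentiableAt.congr_of_eventuallyEq (hev i)
  refine ⟨hd, ?_⟩
  ext i j
  have h1 : HasFDerivAt (fun y => u y i)
      ((EuclideanSpace.proj i : Space d →L[ℝ] ℝ) ∘L fderiv ℝ u x) x :=
    (EuclideanSpace.proj i : Space d →L[ℝ] ℝ).hasFDerivAt.comp x hd.hasFDerivAt
  have h2 : fderiv ℝ (fun y => u y i) x (EuclideanSpace.single j 1) =
      fderiv ℝ u x (EuclideanSpace.single j 1) i := by
    rw [h1.fderiv]; rfl
  change _ = MvPolynomial.eval (fun k => x k) (MvPolynomial.pderiv j (P i))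
  rw [← fderiv_eval_single, ← (hev i).fderiv_eq, h2]
  rfl

theorem fderiv_apply_eq_sum (u : Space d → Space d) (x w : Space d) (i : Fin d) :
    fderiv ℝ u x w i = ∑ j, grad u x i j * w j := by
  conv_lhs => rw [← (EuclideanSpace.basisFun (Fin d) ℝ).sum_repr w]
  rw [map_sum]
  simp [grad, mul_comm]

theorem VelocitySpace.hasExt_grad {u : Space d → Space d} (hu : u ∈ T.VelocitySpace) (K : T.Elem)
    (i j : Fin d) : T.HasExt K fun x => grad u x i j := by
  obtain ⟨G, hG, h⟩ := exists_grad hu K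
  exact ⟨_, (hG i j).continuous, fun x hx => congrFun (congrFun (h x hx).2 i) j⟩

theorem VelocitySpace.continuous_coord {u : Space d → Space d} (hu : u ∈ T.VelocitySpace)
    (i : Fin d) : Continuous fun x => u x i :=
  (EuclideanSpace.proj i : Space d →L[ℝ] ℝ).continuous.comp hu.1

theorem VelocitySpace.grad_add {u v : Space d → Space d} (hu : u ∈ T.VelocitySpace)
    (hv : v ∈ T.VelocitySpace) {K : T.Elem} {x : Space d} (hx : x ∈ interior (T.cell K)) :
    grad (u + v) x = grad u x + grad v x := by
  obtain ⟨_, -, h⟩ := exists_grad hu K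
  obtain ⟨_, -, h'⟩ := exists_grad hv K
  ext i j
  simp [grad, fderiv_add (h x hx).1 (h' x hx).1]

theorem grad_smul (r : ℝ) (u : Space d → Space d) (x : Space d) :
    grad (r • u) x = r • grad u x := by
  ext i j
  simp [grad, fderiv_const_smul_field]

theorem inner_eq_sum (x y : Space d) : inner ℝ x y = ∑ i, x i * y i := by
  rw [PiLp.inner_apply]
  simp [mul_comm]

/-- A discrete velocity whose gradient vanishes in every element is zero. -/
theorem VelocitySpace.eq_zero_of_grad (hd : 0 < d) {u : Space d → Space d}
    (hu : u ∈ T.VelocitySpace) (h : ∀ K, ∀ x ∈ interior (T.cell K), grad u x = 0) : u = 0 := by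
  have hconst : ∀ K, ∃ c, ∀ x ∈ T.cell K, u x = c := by
    intro K
    obtain ⟨x₀, hx₀⟩ := T.interior_cell_nonempty K
    obtain ⟨G, -, hG⟩ := exists_grad hu K
    refine ⟨u x₀, fun x hx => ?_⟩
    have hcl : IsClosed {y | u y = u x₀} := isClosed_eq hu.1 continuous_const
    have hsub : interior (T.cell K) ⊆ {y | u y = u x₀} := fun y hy =>
      isOpen_interior.is_const_of_fderiv_eq_zero (𝕜 := ℝ) (T.convex_cell K).interior.isPreconnected
        (fun z hz => (hG z hz).1.differentiableWithinAt) (fun z hz => by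
          ext w i
          rw [fderiv_apply_eq_sum, h K z hz]
          simp) hy hx₀
    have := hcl.closure_subset_iff.2 hsub
    rw [T.closure_interior_cell] at this
    exact this hx
  choose c hc using hconst
  -- The field is constant on each element, so its range over the whole space is finite. It is also
  -- connected, hence a single point, and `u` vanishes somewhere. Connectedness of the domain is not
  -- needed.
  have hfin : (Set.range u).Finite := by
    refine ((Set.finite_range c).union (Set.finite_singleton 0)).subset ?_
    rintro _ ⟨x, rfl⟩
    by_cases hx : x ∈ T.domain
    · obtain ⟨K, hK⟩ := T.exists_mem_cell hx
      exact Or.inl ⟨K, (hc K x hK).symm⟩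
    · exact Or.inr (hu.2.1 x hx)
  have hsub : (Set.range u).Subsingleton := by
    by_contra hns
    exact (isPreconnected_range hu.1).infinite_of_nontrivial (Set.not_subsingleton_iff.1 hns) hfin
  obtain ⟨y, hy⟩ := T.exists_notMem_domain hd
  funext x
  exact (hsub ⟨x, rfl⟩ ⟨y, rfl⟩).trans (hu.2.1 y hy)

end Mesh

/-! ### Lipschitz continuity of piecewise Lipschitz functions -/

/-- Along a segment, the distance of `f` from its initial value has lower right slope at most `L`
times the length, and a function with such a slope grows at most linearly. -/
theorem lipschitzWith_of_closed_cover {E F ι : Type*} [NormedAddCommGroup E] [NormedSpace ℝ E]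
    [NormedAddCommGroup F] [Finite ι] {f : E → F} (hf : Continuous f) (S : ι → Set E)
    (hS : ∀ i, IsClosed (S i)) (hcov : ∀ x, ∃ i, x ∈ S i) {L : NNReal}
    (hL : ∀ i, LipschitzOnWith L f (S i)) : LipschitzWith L f := by
  refine LipschitzWith.of_dist_le_mul fun y x => ?_
  let γ : ℝ → E := fun t => x + t • (y - x)
  have hγ : Continuous γ := by fun_prop
  have hγd : ∀ s t, dist (γ s) (γ t) = |s - t| * dist y x := fun s t => by
    rw [dist_eq_norm, show γ s - γ t = (s - t) • (y - x) by simp only [γ, sub_smul]; abel,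
      norm_smul, Real.norm_eq_abs, dist_eq_norm]
  have hc : Continuous fun t => dist (f (γ t)) (f x) := by fun_prop
  have key := image_le_of_liminf_slope_right_le_deriv_boundary (f := fun t => dist (f (γ t)) (f x))
    (a := 0) (b := 1) hc.continuousOn (B := fun t => L * dist y x * t)
    (B' := fun _ => L * dist y x) (by simp [γ]) (by fun_prop)
    (fun t _ => ((hasDerivWithinAt_id t (Set.Ici t)).const_mul
      ((L : ℝ) * dist y x)).congr_deriv (mul_one _)) ?_
    (Set.right_mem_Icc.2 zero_le_one)
  · have h1 : γ 1 = y := by simp [γ]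
    simpa [h1] using key
  · intro t _ r hr
    -- With finitely many pieces, one of them is met at times arbitrarily close to `t` from the
    -- right; being closed, it contains `γ t` as well.
    have hex : ∃ i, ∃ᶠ z in 𝓝[>] t, γ z ∈ S i := by
      by_contra! h
      obtain ⟨z, hz⟩ := (Filter.eventually_all.2 h).exists
      obtain ⟨i, hi⟩ := hcov (γ z)
      exact hz i hi
    obtain ⟨i, hi⟩ := hex
    have hti : γ t ∈ S i := (hS i).mem_of_frequently_of_tendsto hi
      (hγ.continuousAt.tendsto.mono_left nhdsWithin_le_nhds)
    refine (hi.and_eventually self_mem_nhdsWithin).mono ?_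
    rintro z ⟨hz, hzt⟩
    have hzt' : 0 < z - t := sub_pos.2 hzt
    refine lt_of_le_of_lt ?_ hr
    rw [slope_def_field, div_le_iff₀ hzt']
    have h1 := (hL i).dist_le_mul _ hz _ hti
    rw [hγd, abs_of_pos hzt'] at h1
    have h2 := dist_triangle (f (γ z)) (f (γ t)) (f x)
    linarith

theorem norm_le_sum_abs (x : Space d) : ‖x‖ ≤ ∑ i, |x i| := by
  conv_lhs => rw [← (EuclideanSpace.basisFun (Fin d) ℝ).sum_repr x]
  refine (norm_sum_le _ _).trans (Finset.sum_le_sum fun i _ => ?_)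
  rw [norm_smul]
  simp

theorem exists_lipschitzOn_eval (P : MvPolynomial (Fin d) ℝ) {s : Set (Space d)}
    (hs : IsCompact s) (hc : Convex ℝ s) : ∃ C : NNReal,
      LipschitzOnWith C (fun y : Space d => MvPolynomial.eval (fun i => y i) P) s := by
  have hcont : Continuous fun x : Space d =>
      (∑ j, MvPolynomial.eval (fun i => x i) (MvPolynomial.pderiv j P) •
        (EuclideanSpace.proj j : Space d →L[ℝ] ℝ)) :=
    continuous_finsetSum _ fun j _ => (continuous_eval_poly _).smul continuous_const
  obtain ⟨C, hC⟩ := hs.exists_bound_of_continuousOn hcont.continuousOn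
  refine ⟨⟨max C 0, le_max_right _ _⟩, hc.lipschitzOnWith_of_nnnorm_hasFDerivWithin_le
    (fun x _ => (hasFDerivAt_eval P x).hasFDerivWithinAt) fun x hx => ?_⟩
  exact NNReal.coe_le_coe.1 ((hC x hx).trans (le_max_left _ _))

namespace Mesh

variable {T : Mesh d}

theorem VelocitySpace.exists_lipschitzOn_cell {u : Space d → Space d} (hu : u ∈ T.VelocitySpace)
    (K : T.Elem) : ∃ C : NNReal, LipschitzOnWith C u (T.cell K) := by
  choose P hP hPu using hu.2.2 K
  choose C hC using fun i => exists_lipschitzOn_eval (P i) (T.isCompact_cell K) (T.convex_cell K)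
  refine ⟨∑ i, C i, LipschitzOnWith.of_dist_le_mul fun x hx y hy => ?_⟩
  rw [dist_eq_norm]
  refine (norm_le_sum_abs _).trans ?_
  push_cast
  rw [Finset.sum_mul]
  refine Finset.sum_le_sum fun i _ => ?_
  have := (hC i).dist_le_mul x hx y hy
  rw [Real.dist_eq] at this
  rw [PiLp.sub_apply, show u x i = _ from hPu i x hx, show u y i = _ from hPu i y hy]
  exact this

theorem VelocitySpace.exists_lipschitz {u : Space d → Space d} (hu : u ∈ T.VelocitySpace) :
    ∃ L : NNReal, LipschitzWith L u := by
  choose C hC using fun K => VelocitySpace.exists_lipschitzOn_cell hu K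
  refine ⟨∑ K, C K, lipschitzWith_of_closed_cover hu.1
    (fun o : Option T.Elem => o.elim T.domainᶜ T.cell) ?_ ?_ ?_⟩
  · rintro (_ | K)
    · exact T.isOpen_domain.isClosed_compl
    · exact (T.isCompact_cell K).isClosed
  · intro x
    by_cases hx : x ∈ T.domain
    · obtain ⟨K, hK⟩ := T.exists_mem_cell hx
      exact ⟨some K, hK⟩
    · exact ⟨none, hx⟩
  · rintro (_ | K)
    · refine LipschitzOnWith.of_dist_le_mul fun x hx y hy => ?_
      rw [hu.2.1 x hx, hu.2.1 y hy, dist_self]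
      positivity
    · exact (hC K).weaken (Finset.single_le_sum (fun _ _ => zero_le) (Finset.mem_univ K))

theorem VelocitySpace.exists_bound {u : Space d → Space d} (hu : u ∈ T.VelocitySpace) :
    ∃ M : NNReal, ∀ x, ‖u x‖ ≤ M := by
  have hcpt : IsCompact (closure T.domain) := T.isBounded_domain.isCompact_closure
  obtain ⟨M, hM⟩ := hcpt.exists_bound_of_continuousOn hu.1.continuousOn
  refine ⟨⟨max M 0, le_max_right _ _⟩, fun x => ?_⟩
  by_cases hx : x ∈ T.domain
  · exact (hM x (subset_closure hx)).trans (le_max_left _ _)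
  · rw [hu.2.1 x hx, norm_zero]; exact le_max_right _ _

end Mesh

/-! ### Flows of Lipschitz vector fields -/

section Flow

variable {E : Type*} [NormedAddCommGroup E] [NormedSpace ℝ E] {w : E → E} {L : NNReal}
  {X Y : ℝ → E} {a b : ℝ}

theorem dist_forward_le (hw : LipschitzWith L w) (hab : a ≤ b)
    (hX : ∀ t ∈ Set.Icc a b, HasDerivWithinAt X (w (X t)) (Set.Icc a b) t)
    (hY : ∀ t ∈ Set.Icc a b, HasDerivWithinAt Y (w (Y t)) (Set.Icc a b) t) :
    dist (X b) (Y b) ≤ dist (X a) (Y a) * Real.exp (L * (b - a)) := by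
  have hr : ∀ {Z : ℝ → E}, (∀ t ∈ Set.Icc a b, HasDerivWithinAt Z (w (Z t)) (Set.Icc a b) t) →
      ∀ t ∈ Set.Ico a b, HasDerivWithinAt Z (w (Z t)) (Set.Ici t) t := fun hZ t ht =>
    (hZ t (Set.Ico_subset_Icc_self ht)).mono_of_mem_nhdsWithin (Icc_mem_nhdsGE_of_mem ht)
  exact dist_le_of_trajectories_ODE (v := fun _ => w) (fun _ => hw)
    (fun t ht => (hX t ht).continuousWithinAt) (hr hX)
    (fun t ht => (hY t ht).continuousWithinAt) (hr hY) le_rfl b (Set.right_mem_Icc.2 hab)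

theorem hasDerivWithinAt_reverse
    (hX : ∀ t ∈ Set.Icc a b, HasDerivWithinAt X (w (X t)) (Set.Icc a b) t) :
    ∀ t ∈ Set.Icc a b, HasDerivWithinAt (fun s => X (a + b - s)) (-w (X (a + b - t)))
      (Set.Icc a b) t := by
  intro t ht
  have hmaps : Set.MapsTo (fun s => a + b - s) (Set.Icc a b) (Set.Icc a b) := fun s hs =>
    ⟨by linarith [hs.2], by linarith [hs.1]⟩
  have h1 : HasDerivWithinAt (fun s : ℝ => a + b - s) (-1) (Set.Icc a b) t :=
    (hasDerivWithinAt_id t _).const_sub (a + b)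
  exact ((hX _ (hmaps ht)).scomp t h1 hmaps).congr_deriv (by simp)

theorem dist_backward_le (hw : LipschitzWith L w) (hab : a ≤ b)
    (hX : ∀ t ∈ Set.Icc a b, HasDerivWithinAt X (w (X t)) (Set.Icc a b) t)
    (hY : ∀ t ∈ Set.Icc a b, HasDerivWithinAt Y (w (Y t)) (Set.Icc a b) t) :
    dist (X a) (Y a) ≤ dist (X b) (Y b) * Real.exp (L * (b - a)) := by
  have := dist_forward_le (w := fun x => -w x) (L := L) hw.neg hab (hasDerivWithinAt_reverse hX)
    (hasDerivWithinAt_reverse hY)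
  simpa using this

theorem exists_backward_solution [CompleteSpace E] (hw : LipschitzWith L w) {M : NNReal}
    (hM : ∀ x, ‖w x‖ ≤ M) (hab : a ≤ b) (x : E) :
    ∃ X : ℝ → E, X b = x ∧ ∀ t ∈ Set.Icc a b, HasDerivWithinAt X (w (X t)) (Set.Icc a b) t := by
  -- The datum is posed at the final time `b`. A ball of radius `M * (b - a)` suffices because the
  -- speed never exceeds `M`, so the solution exists on the whole interval.
  have hPL : IsPicardLindelof (fun _ => w) (⟨b, Set.right_mem_Icc.2 hab⟩ : Set.Icc a b) x
      (M * ⟨b - a, sub_nonneg.2 hab⟩) 0 M L :=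
    { lipschitzOnWith := fun _ _ => hw.lipschitzOnWith
      continuousOn := fun _ _ => continuousOn_const
      norm_le := fun _ _ y _ => hM y
      mul_max_le := by
        have h : max (b - b) (b - a) = b - a := max_eq_right (by linarith)
        change (M : ℝ) * max (b - b) (b - a) ≤ M * (b - a) - 0
        rw [h, sub_zero] }
  exact hPL.exists_eq_forall_mem_Icc_hasDerivWithinAt₀

end Flow

/-! ### Characteristics of a discrete velocity. -/

namespace Mesh

variable {T : Mesh d}

theorem exists_isBackwardFlow {u : Space d → Space d} (hu : u ∈ T.VelocitySpace) {a b : ℝ}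
    (hab : a ≤ b) : ∃ X, T.IsBackwardFlow u a b X := by
  obtain ⟨L, hL⟩ := VelocitySpace.exists_lipschitz hu
  obtain ⟨M, hM⟩ := VelocitySpace.exists_bound hu
  choose X hXb hX using fun x => exists_backward_solution hL hM hab x
  refine ⟨fun t x => X x t, fun x hx => ⟨hXb x, fun t ht => ⟨?_, hX x t ht⟩⟩⟩
  -- Outside the domain the velocity vanishes. A trajectory there at time `t` would stay at rest
  -- until time `b`, but it then has to be at `x`, inside the domain.
  by_contra hn
  have hsub : Set.Icc t b ⊆ Set.Icc a b := Set.Icc_subset_Icc_left ht.1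
  have h0 := hu.2.1 _ hn
  have h1 := dist_forward_le hL ht.2 (X := X x) (Y := fun _ => X x t)
    (fun s hs => (hX x s (hsub hs)).mono hsub) (fun s _ => by
      rw [h0]; exact hasDerivWithinAt_const _ _ _)
  rw [dist_self, zero_mul] at h1
  have h2 := dist_le_zero.1 h1
  rw [hXb] at h2
  exact hn (show X x t ∈ T.domain by rw [← h2]; exact hx)

theorem IsBackwardFlow.dist_le {u : Space d → Space d} {a b : ℝ} (hab : a ≤ b)
    {X Y : ℝ → Space d → Space d} {L : NNReal} (hL : LipschitzWith L u)
    (hX : T.IsBackwardFlow u a b X) (hY : T.IsBackwardFlow u a b Y) {x y : Space d}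
    (hx : x ∈ T.domain) (hy : y ∈ T.domain) :
    dist (X a x) (Y a y) ≤ dist x y * Real.exp (L * (b - a)) := by
  have := dist_backward_le hL hab (X := fun s => X s x) (Y := fun s => Y s y)
    (fun t ht => ((hX x hx).2 t ht).2) (fun t ht => ((hY y hy).2 t ht).2)
  rwa [(hX x hx).1, (hY y hy).1] at this

theorem IsBackwardFlow.eqOn {u : Space d → Space d} (hu : u ∈ T.VelocitySpace) {a b : ℝ}
    (hab : a ≤ b) {X Y : ℝ → Space d → Space d} (hX : T.IsBackwardFlow u a b X)
    (hY : T.IsBackwardFlow u a b Y) {x : Space d} (hx : x ∈ T.domain) : X a x = Y a x := by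
  obtain ⟨L, hL⟩ := VelocitySpace.exists_lipschitz hu
  have := hX.dist_le hab hL hY hx hx
  rw [dist_self, zero_mul] at this
  exact dist_le_zero.1 this

theorem IsBackwardFlow.continuousOn {u : Space d → Space d} (hu : u ∈ T.VelocitySpace) {a b : ℝ}
    (hab : a ≤ b) {X : ℝ → Space d → Space d} (hX : T.IsBackwardFlow u a b X) :
    ContinuousOn (X a) T.domain := by
  obtain ⟨L, hL⟩ := VelocitySpace.exists_lipschitz hu
  have : LipschitzOnWith ⟨Real.exp (L * (b - a)), (Real.exp_pos _).le⟩ (X a) T.domain :=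
    LipschitzOnWith.of_dist_le_mul fun x hx y hy => by
      rw [mul_comm]; exact hX.dist_le hab hL hX hx hy
  exact this.continuousOn

/-! ### Evaluation of piecewise constant fields -/

variable (T) in
theorem eval_apply (φ : T.Elem → Tensor d) (x : Space d) (i j : Fin d) :
    T.eval φ x i j = ∑ K, (interior (T.cell K)).indicator (fun _ => φ K i j) x := by
  rw [eval, Matrix.sum_apply]
  refine Finset.sum_congr rfl fun K _ => ?_
  by_cases hx : x ∈ interior (T.cell K)
  · simp [hx]
  · simp [hx]

variable (T) in
theorem measurable_eval (φ : T.Elem → Tensor d) (i j : Fin d) :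
    Measurable fun x => T.eval φ x i j := by
  simp only [eval_apply]
  exact Finset.measurable_sum _ fun K _ =>
    measurable_const.indicator isOpen_interior.measurableSet

variable (T) in
theorem abs_eval_le (φ : T.Elem → Tensor d) (x : Space d) (i j : Fin d) :
    |T.eval φ x i j| ≤ ∑ K, |φ K i j| := by
  rw [eval_apply]
  refine (Finset.abs_sum_le_sum_abs _ _).trans (Finset.sum_le_sum fun K _ => ?_)
  by_cases hx : x ∈ interior (T.cell K)
  · simp [hx]
  · simp [hx]

variable (T) in
theorem isSymm_eval {φ : T.Elem → Tensor d} (hφ : φ ∈ T.StressSpace) (x : Space d) :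
    (T.eval φ x).IsSymm := by
  ext i j
  rw [Matrix.transpose_apply, eval_apply, eval_apply]
  exact Finset.sum_congr rfl fun K _ => by rw [(hφ K).apply]

theorem IsBackwardFlow.integrableOn_eval {u : Space d → Space d} (hu : u ∈ T.VelocitySpace)
    {a b : ℝ} (hab : a ≤ b) {X : ℝ → Space d → Space d} (hX : T.IsBackwardFlow u a b X)
    (φ : T.Elem → Tensor d) (K : T.Elem) (i j : Fin d) :
    IntegrableOn (fun x => T.eval φ (X a x) i j) (T.cell K) := by
  have h1 : AEMeasurable (X a) (volume.restrict (T.cell K)) := by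
    rw [← T.cell_ae_eq_interior]
    exact ((hX.continuousOn hu hab).mono (T.interior_cell_subset_domain K)).aemeasurable
      isOpen_interior.measurableSet
  have h2 := (T.measurable_eval φ i j).comp_aemeasurable h1
  have : IsFiniteMeasure (volume.restrict (T.cell K)) :=
    ⟨by rw [Measure.restrict_apply_univ]; exact (T.isCompact_cell K).measure_lt_top⟩
  exact Integrable.of_bound h2.aestronglyMeasurable (∑ K, |φ K i j|)
    (.of_forall fun x => T.abs_eval_le φ _ i j)

end Mesh

/-! ### Traces of piecewise constant fields along rays -/

/-- The parameters of a ray that lie in a convex set form an interval; if they accumulate at zero,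
they contain all small positive ones. Hence one-sided limits of piecewise constant fields exist at
every point. -/
theorem eventually_ray_or {E : Type*} [NormedAddCommGroup E] [NormedSpace ℝ E] {I : Set E}
    (hI : Convex ℝ I) (x v : E) :
    (∀ᶠ δ : ℝ in 𝓝[>] 0, x + δ • v ∈ I) ∨ ∀ᶠ δ : ℝ in 𝓝[>] 0, x + δ • v ∉ I := by
  by_cases h : ∃ᶠ δ : ℝ in 𝓝[>] 0, x + δ • v ∈ I
  · left
    obtain ⟨δ₀, h₀, hpos⟩ := (h.and_eventually self_mem_nhdsWithin).exists
    filter_upwards [Ioo_mem_nhdsGT (show (0 : ℝ) < δ₀ from hpos)] with δ hδ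
    obtain ⟨δ₁, h₁, hδ₁⟩ := (h.and_eventually (Ioo_mem_nhdsGT hδ.1)).exists
    have hne : 0 < δ₀ - δ₁ := by linarith [hδ₁.2, hδ.2]
    have := hI h₁ h₀ (a := (δ₀ - δ) / (δ₀ - δ₁)) (b := (δ - δ₁) / (δ₀ - δ₁))
      (div_nonneg (by linarith [hδ.2]) hne.le) (div_nonneg (by linarith [hδ₁.2]) hne.le)
      (by field_simp; ring)
    convert this using 1
    rw [smul_add, smul_add, smul_smul, smul_smul, add_add_add_comm, ← add_smul, ← add_smul]
    congr 2
    · rw [show (δ₀ - δ) / (δ₀ - δ₁) + (δ - δ₁) / (δ₀ - δ₁) = 1 by field_simp; ring, one_smul]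
    · field_simp; ring
  · right
    exact Filter.not_frequently.1 h

namespace Mesh

variable (T : Mesh d)

open Classical in
/-- The indicator of the points from which the direction `w x` enters the element `K`. -/
def side (w : Space d → Space d) (K : T.Elem) (x : Space d) : ℝ :=
  if ∀ᶠ δ : ℝ in 𝓝[>] 0, x + δ • w x ∈ interior (T.cell K) then 1 else 0

theorem eventually_eval_eq (w : Space d → Space d) (φ : T.Elem → Tensor d) (x : Space d) :
    ∀ᶠ δ : ℝ in 𝓝[>] 0, T.eval φ (x + δ • w x) = ∑ K, T.side w K x • φ K := by
  have h : ∀ K, ∀ᶠ δ : ℝ in 𝓝[>] 0,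
      (interior (T.cell K)).indicator (fun _ => φ K) (x + δ • w x) = T.side w K x • φ K := by
    intro K
    rcases eventually_ray_or (T.convex_cell K).interior x (w x) with h | h
    · have hs : T.side w K x = 1 := if_pos h
      filter_upwards [h] with δ hδ
      rw [hs, one_smul, Set.indicator_of_mem hδ]
    · have hs : T.side w K x = 0 := if_neg fun h' => by
        obtain ⟨δ, h1, h2⟩ := (h.and h').exists
        exact h1 h2
      filter_upwards [h] with δ hδ
      rw [hs, zero_smul, Set.indicator_of_notMem hδ]
  filter_upwards [Filter.eventually_all.2 h] with δ hδ
  exact Finset.sum_congr rfl fun K _ => hδ K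

theorem downstream_eq (w : Space d → Space d) (φ : T.Elem → Tensor d) (x : Space d) :
    T.downstream w φ x = ∑ K, T.side w K x • φ K :=
  (tendsto_const_nhds.congr' ((T.eventually_eval_eq w φ x).mono fun _ h => h.symm)).limUnder_eq

theorem upstream_eq (w : Space d → Space d) (φ : T.Elem → Tensor d) (x : Space d) :
    T.upstream w φ x = ∑ K, T.side (fun y => -w y) K x • φ K := by
  have h0 : Filter.Tendsto (fun δ : ℝ => -δ) (𝓝[<] 0) (𝓝[>] 0) := by
    simpa using tendsto_neg_nhdsLT (a := (0 : ℝ))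
  have h := h0.eventually (T.eventually_eval_eq (fun y => -w y) φ x)
  simp only [smul_neg, neg_smul, neg_neg] at h
  exact (tendsto_const_nhds.congr' (h.mono fun _ h => h.symm)).limUnder_eq

variable {T}

theorem side_eq_one_or (w : Space d → Space d) (K : T.Elem) (x : Space d) :
    T.side w K x = 1 ∨ T.side w K x = 0 := by
  unfold side
  split_ifs
  · exact Or.inl rfl
  · exact Or.inr rfl

theorem eq_of_side {w : Space d → Space d} {K L : T.Elem} {x : Space d} (hK : T.side w K x = 1)
    (hL : T.side w L x = 1) : K = L := by
  unfold side at hK hL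
  split_ifs at hK hL with h1 h2
  · by_contra hne
    obtain ⟨δ, h, h'⟩ := (h1.and h2).exists
    exact Set.disjoint_left.1 (T.disjoint_interior_cell hne) h h'
  · norm_num at hL
  · norm_num at hK
  · norm_num at hK

/-- A ray enters at most one element interior. The value zero remains when it enters none, for
instance when it runs along a face. -/
theorem sum_side_smul (w : Space d → Space d) (x : Space d) :
    (∀ φ : T.Elem → Tensor d, ∑ K, T.side w K x • φ K = 0) ∨
      ∃ K, ∀ φ : T.Elem → Tensor d, ∑ L, T.side w L x • φ L = φ K := by
  by_cases h : ∃ K, T.side w K x = 1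
  · right
    obtain ⟨K, hK⟩ := h
    refine ⟨K, fun φ => ?_⟩
    rw [Finset.sum_eq_single K, hK, one_smul]
    · intro L _ hL
      rcases side_eq_one_or w L x with h1 | h1
      · exact absurd (eq_of_side h1 hK) hL
      · rw [h1, zero_smul]
    · simp
  · left
    push Not at h
    refine fun φ => Finset.sum_eq_zero fun K _ => ?_
    rw [(side_eq_one_or w K x).resolve_left (h K), zero_smul]

theorem measurable_side {w : Space d → Space d} (hw : Continuous w) (K : T.Elem) :
    Measurable (T.side w K) := by
  have hseq : Filter.Tendsto (fun n : ℕ => 1 / ((n : ℝ) + 1)) Filter.atTop (𝓝[>] 0) :=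
    tendsto_nhdsWithin_iff.2 ⟨tendsto_one_div_add_atTop_nhds_zero_nat,
      .of_forall fun n => Set.mem_Ioi.2 (by positivity)⟩
  -- By the dichotomy for rays, testing the sequence `1 / (n + 1)` is enough, which exhibits the set
  -- as a countable liminf of open sets.
  have hset : {x | ∀ᶠ δ : ℝ in 𝓝[>] 0, x + δ • w x ∈ interior (T.cell K)} =
      Filter.liminf (fun n : ℕ => {x | x + (1 / ((n : ℝ) + 1)) • w x ∈ interior (T.cell K)})
        Filter.atTop := by
    ext x
    rw [Filter.mem_liminf_iff_eventually_mem]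
    refine ⟨fun h => hseq.eventually h, fun h => ?_⟩
    rcases eventually_ray_or (T.convex_cell K).interior x (w x) with h1 | h1
    · exact h1
    · obtain ⟨n, h2, h3⟩ := (h.and (hseq.eventually h1)).exists
      exact absurd h2 h3
  refine Measurable.ite ?_ measurable_const measurable_const
  rw [hset]
  refine MeasurableSet.measurableSet_liminf fun n => IsOpen.measurableSet ?_
  exact isOpen_interior.preimage (f := fun x : Space d => x + (1 / ((n : ℝ) + 1)) • w x)
    (by fun_prop)

end Mesh

/-! ### Finiteness of the surface measure of a simplex -/

/-- The hull is covered by an affine, hence Lipschitz, image of the unit cube in `ℝ^m`. -/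
theorem euclideanHausdorffMeasure_convexHull_lt_top {m : ℕ} (s : Finset (Space d))
    (hs : s.card = m + 1) : μHE[m] (convexHull ℝ (s : Set (Space d))) < ⊤ := by
  classical
  let e : Fin (m + 1) ≃ s := (s.equivFinOfCardEq hs).symm
  let A : (Fin m → ℝ) →L[ℝ] Space d := LinearMap.toContinuousLinearMap
    (∑ i : Fin m, (LinearMap.proj i : (Fin m → ℝ) →ₗ[ℝ] ℝ).smulRight
      ((e i.succ : Space d) - e 0))
  have hA : ∀ t, A t = ∑ i : Fin m, t i • ((e i.succ : Space d) - e 0) := fun t => by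
    simp [A]
  let f : (Fin m → ℝ) → Space d := fun t => (e 0 : Space d) + A t
  have hf : LipschitzWith ‖A‖₊ f := by
    refine LipschitzWith.of_dist_le_mul fun x y => ?_
    simp only [f, dist_add_left]
    exact A.lipschitz.dist_le_mul x y
  have hsub : convexHull ℝ (s : Set (Space d)) ⊆ f '' Set.Icc 0 1 := by
    intro x hx
    obtain ⟨c, hc0, hc1, hcx⟩ := Finset.mem_convexHull'.1 hx
    have hsum : ∀ {M : Type} [AddCommMonoid M] (g : Space d → M),
        ∑ y ∈ s, g y = ∑ i : Fin (m + 1), g (e i) := fun g => by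
      rw [← Finset.sum_coe_sort s g]
      exact (Equiv.sum_comp e fun y : s => g y).symm
    rw [hsum c, Fin.sum_univ_succ] at hc1
    rw [hsum, Fin.sum_univ_succ] at hcx
    refine ⟨fun i => c (e i.succ), ⟨fun i => hc0 _ (e i.succ).2, fun i => ?_⟩, ?_⟩
    · have h1 := hc0 _ (e 0).2
      have h2 := Finset.single_le_sum (f := fun i : Fin m => c (e i.succ))
        (fun i _ => hc0 _ (e i.succ).2) (Finset.mem_univ i)
      change c (e i.succ) ≤ 1
      linarith
    · simp only [f, hA, smul_sub, Finset.sum_sub_distrib]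
      rw [← hcx, ← Finset.sum_smul, eq_sub_of_add_eq hc1, sub_smul, one_smul]
      abel
  have hfin : Measure.hausdorffMeasure (m : ℝ) (f '' Set.Icc 0 1) < ⊤ := by
    refine ((hf.lipschitzOnWith (s := Set.Icc 0 1)).hausdorffMeasure_image_le
      (Nat.cast_nonneg m)).trans_lt ?_
    have hv : (Measure.hausdorffMeasure (m : ℝ) : Measure (Fin m → ℝ)) = volume := by
      simpa using hausdorffMeasure_pi_real (ι := Fin m)
    rw [hv]
    exact ENNReal.mul_lt_top (ENNReal.rpow_lt_top_of_nonneg (Nat.cast_nonneg m) ENNReal.coe_ne_top)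
      isCompact_Icc.measure_lt_top
  rw [Measure.euclideanHausdorffMeasure_def, Measure.smul_apply, ENNReal.smul_def, smul_eq_mul]
  exact ENNReal.mul_lt_top ENNReal.coe_lt_top ((measure_mono hsub).trans_lt hfin)

/-! ### The jump term -/

namespace Mesh

variable {T : Mesh d}

theorem faceSet_lt_top (hd : 0 < d) (F : T.InternalFace) : μHE[d - 1] (T.faceSet F) < ⊤ :=
  euclideanHausdorffMeasure_convexHull_lt_top F.1 (by rw [F.2.2.1]; omega)

theorem isFiniteMeasure_face (hd : 0 < d) (F : T.InternalFace) :
    IsFiniteMeasure ((μHE[d - 1] : Measure (Space d)).restrict (T.faceSet F)) :=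
  ⟨by rw [Measure.restrict_apply_univ]; exact faceSet_lt_top hd F⟩

/-- The weight `|w · n|` on a face. -/
def flux (T : Mesh d) (w : Space d → Space d) (F : T.InternalFace) (x : Space d) : ℝ :=
  |inner ℝ (w x) (T.normal F)|

theorem integrableOn_flux_mul (hd : 0 < d) {w : Space d → Space d} (hw : w ∈ T.VelocitySpace)
    (F : T.InternalFace) {f : Space d → ℝ} (hf : Measurable f) {C : ℝ} (hC : ∀ x, |f x| ≤ C) :
    IntegrableOn (fun x => T.flux w F x * f x) (T.faceSet F) μHE[d - 1] := by
  have := isFiniteMeasure_face hd F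
  obtain ⟨M, hM⟩ := VelocitySpace.exists_bound hw
  have hcont : Continuous (T.flux w F) := (hw.1.inner continuous_const).abs
  refine Integrable.of_bound (hcont.measurable.mul hf).aestronglyMeasurable
    (M * ‖T.normal F‖ * C) (.of_forall fun x => ?_)
  rw [norm_mul]
  have h1 : ‖T.flux w F x‖ ≤ M * ‖T.normal F‖ := by
    rw [flux, Real.norm_eq_abs, abs_abs]
    exact (abs_real_inner_le_norm _ _).trans (mul_le_mul_of_nonneg_right (hM x) (norm_nonneg _))
  exact mul_le_mul h1 (hC x) (norm_nonneg _) ((norm_nonneg _).trans h1)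

/-- The coefficient of `ψ L : φ K` in the jump term. -/
def jumpCoeff (T : Mesh d) (w : Space d → Space d) (L K : T.Elem) : ℝ :=
  ∑ F : T.InternalFace, ∫ x in T.faceSet F, T.flux w F x *
    ((T.side w L x - T.side (fun y => -w y) L x) * T.side w K x) ∂μHE[d - 1]

theorem integrableOn_jumpCoeff (hd : 0 < d) {w : Space d → Space d} (hw : w ∈ T.VelocitySpace)
    (F : T.InternalFace) (L K : T.Elem) :
    IntegrableOn (fun x => T.flux w F x *
      ((T.side w L x - T.side (fun y => -w y) L x) * T.side w K x)) (T.faceSet F) μHE[d - 1] := by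
  refine integrableOn_flux_mul hd hw F (((measurable_side hw.1 L).sub
    (measurable_side hw.1.neg L)).mul (measurable_side hw.1 K)) (C := 1) fun x => ?_
  rcases side_eq_one_or w L x with h1 | h1 <;>
    rcases side_eq_one_or (fun y => -w y) L x with h2 | h2 <;>
    rcases side_eq_one_or w K x with h3 | h3 <;> simp [h1, h2, h3]

theorem jump_integrand_eq (w : Space d → Space d) (F : T.InternalFace) (ψ φ : T.Elem → Tensor d)
    (x : Space d) :
    T.flux w F x * ddot (T.downstream w ψ x - T.upstream w ψ x) (T.downstream w φ x) =
      ∑ L, ∑ K, T.flux w F x *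
        ((T.side w L x - T.side (fun y => -w y) L x) * T.side w K x) * ddot (ψ L) (φ K) := by
  rw [downstream_eq, upstream_eq, downstream_eq, ← Finset.sum_sub_distrib, LogScheme.ddot_sum_left,
    Finset.mul_sum]
  refine Finset.sum_congr rfl fun L _ => ?_
  rw [← sub_smul, ddot_smul_left, ddot_comm, LogScheme.ddot_sum_left, Finset.mul_sum,
    Finset.mul_sum]
  refine Finset.sum_congr rfl fun K _ => ?_
  rw [ddot_smul_left, ddot_comm]
  ring

theorem integrableOn_jump (hd : 0 < d) {w : Space d → Space d} (hw : w ∈ T.VelocitySpace)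
    (F : T.InternalFace) (ψ φ : T.Elem → Tensor d) :
    IntegrableOn (fun x => T.flux w F x *
      ddot (T.downstream w ψ x - T.upstream w ψ x) (T.downstream w φ x)) (T.faceSet F)
      μHE[d - 1] := by
  simp only [jump_integrand_eq]
  exact integrable_finsetSum _ fun L _ => integrable_finsetSum _ fun K _ =>
    (integrableOn_jumpCoeff hd hw F L K).mul_const _

theorem jumpTerm_eq (hd : 0 < d) {w : Space d → Space d} (hw : w ∈ T.VelocitySpace)
    (ψ φ : T.Elem → Tensor d) :
    T.jumpTerm w ψ φ = ∑ L, ∑ K, T.jumpCoeff w L K * ddot (ψ L) (φ K) := by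
  have h : ∀ F : T.InternalFace, ∫ x in T.faceSet F, T.flux w F x *
      ddot (T.downstream w ψ x - T.upstream w ψ x) (T.downstream w φ x) ∂μHE[d - 1] =
      ∑ L, ∑ K, (∫ x in T.faceSet F, T.flux w F x *
        ((T.side w L x - T.side (fun y => -w y) L x) * T.side w K x) ∂μHE[d - 1]) *
          ddot (ψ L) (φ K) := by
    intro F
    simp only [jump_integrand_eq]
    rw [integral_finsetSum _ fun L _ => integrable_finsetSum _ fun K _ =>
      (integrableOn_jumpCoeff hd hw F L K).mul_const _]
    refine Finset.sum_congr rfl fun L _ => ?_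
    rw [integral_finsetSum _ fun K _ => (integrableOn_jumpCoeff hd hw F L K).mul_const _]
    exact Finset.sum_congr rfl fun K _ => integral_mul_const _ _
  calc T.jumpTerm w ψ φ = ∑ F, ∫ x in T.faceSet F, T.flux w F x *
      ddot (T.downstream w ψ x - T.upstream w ψ x) (T.downstream w φ x) ∂μHE[d - 1] := rfl
    _ = _ := by
      simp only [h, jumpCoeff, Finset.sum_mul]
      rw [Finset.sum_comm]
      exact Finset.sum_congr rfl fun L _ => Finset.sum_comm

theorem energy_zero : energy (0 : Tensor d) = d := by
  simp [energy]

/-- The bound of the negative part of the jump term. -/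
def fluxBound (T : Mesh d) (w : Space d → Space d) : ℝ :=
  (d + 1) * ∑ F : T.InternalFace, ∫ x in T.faceSet F, T.flux w F x ∂μHE[d - 1]

theorem fluxBound_nonneg (w : Space d → Space d) : 0 ≤ T.fluxBound w :=
  mul_nonneg (by positivity) (Finset.sum_nonneg fun _ _ => integral_nonneg fun _ => abs_nonneg _)

/-- By convexity the left factor tested with `e^{ψ⁺} - 1` is at least `energy ψ⁺ - energy ψ⁻ ≥
-energy ψ⁻`. The factor `d + 1` covers an upstream value of zero, whose energy is `d`; if the ray
enters no element downstream, the pairing is zero. -/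
theorem neg_energy_le_jump (w : Space d → Space d) {ψ : T.Elem → Tensor d}
    (hψ : ∀ K, (ψ K).IsSymm) (x : Space d) :
    -((d + 1) * (1 + ∑ K, energy (ψ K))) ≤ ddot (T.downstream w ψ x - T.upstream w ψ x)
      (T.downstream w (fun K => NormedSpace.exp (ψ K) - 1) x) := by
  have h0 : ∀ K, 0 ≤ energy (ψ K) := fun K => energy_nonneg (hψ K)
  set 𝓔 := ∑ K, energy (ψ K)
  have h𝓔 : 0 ≤ 𝓔 := Finset.sum_nonneg fun K _ => h0 K
  rw [downstream_eq, downstream_eq, upstream_eq]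
  rcases sum_side_smul w x with h | ⟨K, h⟩
  · rw [h (fun K => NormedSpace.exp (ψ K) - 1), ddot_comm]
    simp only [ddot, Matrix.zero_apply, zero_mul, Finset.sum_const_zero]
    have : (0 : ℝ) ≤ (d + 1) * (1 + 𝓔) := by positivity
    linarith
  · rw [h (fun K => NormedSpace.exp (ψ K) - 1), h ψ]
    have key : ∀ a : Tensor d, a.IsSymm → energy a ≤ (d + 1) * (1 + 𝓔) →
        -((d + 1) * (1 + 𝓔)) ≤ ddot (ψ K - a) (NormedSpace.exp (ψ K) - 1) := fun a ha hle => by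
      have h1 := energy_sub_le (hψ K) ha
      have h2 := h0 K
      linarith
    rcases sum_side_smul (T := T) (fun y => -w y) x with h' | ⟨L, h'⟩
    · rw [h' ψ]
      refine key 0 Matrix.isSymm_zero ?_
      rw [energy_zero]
      nlinarith [(Nat.cast_nonneg d : (0 : ℝ) ≤ d)]
    · rw [h' ψ]
      refine key _ (hψ L) ?_
      have : energy (ψ L) ≤ 𝓔 :=
        Finset.single_le_sum (f := fun K => energy (ψ K)) (fun K _ => h0 K) (Finset.mem_univ L)
      nlinarith [(Nat.cast_nonneg d : (0 : ℝ) ≤ d)]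

theorem neg_fluxBound_le_jumpTerm (hd : 0 < d) {w : Space d → Space d} (hw : w ∈ T.VelocitySpace)
    {ψ : T.Elem → Tensor d} (hψ : ∀ K, (ψ K).IsSymm) :
    -T.fluxBound w * (1 + ∑ K, energy (ψ K)) ≤
      T.jumpTerm w ψ (fun K => NormedSpace.exp (ψ K) - 1) := by
  set 𝓔 := ∑ K, energy (ψ K)
  have e : -T.fluxBound w * (1 + 𝓔) = ∑ F : T.InternalFace, ∫ x in T.faceSet F,
      T.flux w F x * -((d + 1) * (1 + 𝓔)) ∂μHE[d - 1] := by
    simp only [integral_mul_const]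
    rw [← Finset.sum_mul, fluxBound]
    ring
  rw [e]
  refine Finset.sum_le_sum fun F _ => integral_mono ?_ (integrableOn_jump hd hw F ψ _) fun x => ?_
  · exact integrableOn_flux_mul hd hw F measurable_const
      (C := |-((d + 1) * (1 + 𝓔))|) fun x => le_rfl
  · exact mul_le_mul_of_nonneg_left (neg_energy_le_jump w hψ x) (abs_nonneg _)

end Mesh

/-! ### The algebraic scheme with a vanishing time step included. -/

namespace LogScheme

variable {V Q ι : Type*} [AddCommGroup V] [Module ℝ V] [AddCommGroup Q] [Module ℝ Q] [Fintype ι]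
  (D : LogScheme d V Q ι)

/-- Only the mass terms remain, so the solution is the old state; positive definiteness gives
uniqueness, and `Re > 0` is what determines the velocity. -/
theorem exists_unique_step_zero {Re : ℝ} (hRe : 0 < Re) (Wi ε : ℝ) (un : V) {a : ι → Tensor d}
    (ha : ∀ K, (a K).IsSymm) : ∃! Y : V × (ι → Tensor d), (∀ K, (Y.2 K).IsSymm) ∧
        ∃ p, ∀ v q φ, (∀ K, (φ K).IsSymm) → 0 = D.form Re Wi ε 0 un a Y.1 p Y.2 v q φ := by
  have hform : ∀ u p ψ v q φ, D.form Re Wi ε 0 un a u p ψ v q φ =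
      Re * D.m (u - un) v + ∑ K, D.vol K * ddot (ψ K - a K) (φ K) := fun u p ψ v q φ => by
    simp [form]
  simp only [hform]
  refine ⟨(un, a), ⟨ha, 0, fun v q φ _ => by simp [ddot]⟩, ?_⟩
  rintro ⟨u, ψ⟩ ⟨hψ, -, h⟩
  have h1 := h (u - un) 0 0 (fun K => Matrix.isSymm_zero)
  have h2 := h 0 0 (fun K => ψ K - a K) (fun K => (hψ K).sub (ha K))
  have hu : u = un := by
    by_contra hne
    have := D.m_pos (u - un) (sub_ne_zero.2 hne)
    simp only [Pi.zero_apply, ddot, Matrix.zero_apply, mul_zero, Finset.sum_const_zero,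
      add_zero] at h1
    exact (mul_pos hRe this).ne h1
  simp only [map_zero, mul_zero, zero_add] at h2
  have h3 := (Finset.sum_eq_zero_iff_of_nonneg
    (fun K _ => mul_nonneg (D.vol_pos K).le (ddot_self_nonneg (ψ K - a K)))).1 h2.symm
  refine Prod.ext hu (funext fun K => ?_)
  have h4 := (mul_eq_zero.1 (h3 K (Finset.mem_univ K))).resolve_left (D.vol_pos K).ne'
  exact sub_eq_zero.1 (ddot_self_eq_zero h4)

theorem exists_unique_step_nonneg [FiniteDimensional ℝ V] {Re Wi ε : ℝ} (hRe : 0 ≤ Re)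
    (hWi : 0 < Wi) (hε₀ : 0 ≤ ε) (hε₁ : ε < 1) (un : V) (R₀ : ℝ) (hR₀ : 0 ≤ R₀) :
    ∃ c₀ : ℝ, 0 < c₀ ∧ ∀ δ, 0 ≤ δ → δ < c₀ → (Re = 0 → 0 < δ) → ∀ a : ι → Tensor d,
      (∀ K, (a K).IsSymm) → (∀ K i j, |a K i j| ≤ R₀) →
      ∃! Y : V × (ι → Tensor d), (∀ K, (Y.2 K).IsSymm) ∧
        ∃ p, ∀ v q φ, (∀ K, (φ K).IsSymm) → 0 = D.form Re Wi ε δ un a Y.1 p Y.2 v q φ := by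
  obtain ⟨c₀, hc₀, h⟩ := D.exists_unique_step hRe hWi hε₀ hε₁ un R₀ hR₀
  refine ⟨c₀, hc₀, fun δ hδ hδc hδR a ha haR => ?_⟩
  rcases hδ.eq_or_lt with rfl | hpos
  · have hRe' : 0 < Re := lt_of_le_of_ne hRe fun e => (hδR e.symm).false
    exact D.exists_unique_step_zero hRe' Wi ε un ha
  · exact h δ hpos hδc a ha haR

end LogScheme

theorem linearMap_apply_eq_sum (ℓ : Tensor d →ₗ[ℝ] ℝ) (X : Tensor d) :
    ℓ X = ∑ i, ∑ j, ℓ (Matrix.single i j 1) * X i j := by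
  conv_lhs => rw [Matrix.matrix_eq_sum_single X]
  simp only [map_sum]
  refine Finset.sum_congr rfl fun i _ => Finset.sum_congr rfl fun j _ => ?_
  have : Matrix.single i j (X i j) = X i j • Matrix.single i j (1 : ℝ) := by
    rw [Matrix.smul_single, smul_eq_mul, mul_one]
  rw [this, map_smul, smul_eq_mul, mul_comm]

/-- Contraction with a fixed tensor. -/
def ddotRight (φ : Tensor d) : Tensor d →ₗ[ℝ] ℝ where
  toFun X := ddot X φ
  map_add' X Y := ddot_add_left X Y φ
  map_smul' r X := ddot_smul_left r X φ

namespace Mesh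

variable {T : Mesh d}

/-! ### Elementwise integrals -/

/-- `f` is integrable on the element `K` with integral `r`. -/
def HasCellIntegral (T : Mesh d) (K : T.Elem) (f : Space d → ℝ) (r : ℝ) : Prop :=
  IntegrableOn f (T.cell K) ∧ ∫ x in T.cell K, f x = r

namespace HasCellIntegral

variable {K : T.Elem} {f g : Space d → ℝ} {r s : ℝ}

theorem add (hf : T.HasCellIntegral K f r) (hg : T.HasCellIntegral K g s) :
    T.HasCellIntegral K (fun x => f x + g x) (r + s) :=
  ⟨hf.1.add hg.1, by rw [integral_add hf.1 hg.1, hf.2, hg.2]⟩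

theorem const_mul (hf : T.HasCellIntegral K f r) (c : ℝ) :
    T.HasCellIntegral K (fun x => c * f x) (c * r) :=
  ⟨hf.1.const_mul c, by rw [integral_const_mul, hf.2]⟩

theorem const (c : ℝ) : T.HasCellIntegral K (fun _ => c) (T.vol K * c) :=
  ⟨(HasExt.of_continuous continuous_const).integrableOn, T.integral_const_cell K c⟩

theorem of_hasExt (hf : T.HasExt K f) : T.HasCellIntegral K f (∫ x in T.cell K, f x) :=
  ⟨hf.integrableOn, rfl⟩

theorem sum {ι : Type*} (t : Finset ι) {F : ι → Space d → ℝ} {R : ι → ℝ}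
    (h : ∀ i ∈ t, T.HasCellIntegral K (F i) (R i)) :
    T.HasCellIntegral K (fun x => ∑ i ∈ t, F i x) (∑ i ∈ t, R i) :=
  ⟨integrable_finsetSum _ fun i hi => (h i hi).1, by
    rw [integral_finsetSum _ fun i hi => (h i hi).1]
    exact Finset.sum_congr rfl fun i hi => (h i hi).2⟩

theorem linear {G : Space d → Tensor d} (ℓ : Tensor d →ₗ[ℝ] ℝ)
    (hG : ∀ i j, IntegrableOn (fun x => G x i j) (T.cell K)) :
    T.HasCellIntegral K (fun x => ℓ (G x)) (ℓ (.of fun i j => ∫ x in T.cell K, G x i j)) := by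
  have h : (fun x => ℓ (G x)) = fun x => ∑ i, ∑ j, ℓ (Matrix.single i j 1) * G x i j :=
    funext fun x => linearMap_apply_eq_sum ℓ (G x)
  rw [h, linearMap_apply_eq_sum ℓ (.of fun i j => ∫ x in T.cell K, G x i j)]
  exact sum _ fun i _ => sum _ fun j _ => const_mul ⟨hG i j, rfl⟩ _

end HasCellIntegral

/-- The bilinear form obtained by integrating over every element a bilinear expression. -/
def integralForm (T : Mesh d) {V W : Type*} [AddCommGroup V] [Module ℝ V] [AddCommGroup W]
    [Module ℝ W] (β : T.Elem → V → W → Space d → ℝ) (hext : ∀ K v w, T.HasExt K (β K v w))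
    (hadd₁ : ∀ K v v' w, ∀ x ∈ interior (T.cell K), β K (v + v') w x = β K v w x + β K v' w x)
    (hsmul₁ : ∀ K (r : ℝ) v w x, β K (r • v) w x = r * β K v w x)
    (hadd₂ : ∀ K v w w', ∀ x ∈ interior (T.cell K), β K v (w + w') x = β K v w x + β K v w' x)
    (hsmul₂ : ∀ K (r : ℝ) v w x, β K v (r • w) x = r * β K v w x) : V →ₗ[ℝ] W →ₗ[ℝ] ℝ :=
  LinearMap.mk₂ ℝ (fun v w => ∑ K, ∫ x in T.cell K, β K v w x)
    (fun v v' w => by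
      rw [← Finset.sum_add_distrib]
      refine Finset.sum_congr rfl fun K _ => ?_
      rw [T.integral_congr_cell (hadd₁ K v v' w),
        integral_add (hext K v w).integrableOn (hext K v' w).integrableOn])
    (fun r v w => by
      rw [smul_eq_mul, Finset.mul_sum]
      refine Finset.sum_congr rfl fun K _ => ?_
      rw [← integral_const_mul]
      exact T.integral_congr_cell fun x _ => hsmul₁ K r v w x)
    (fun v w w' => by
      rw [← Finset.sum_add_distrib]
      refine Finset.sum_congr rfl fun K _ => ?_
      rw [T.integral_congr_cell (hadd₂ K v w w'),
        integral_add (hext K v w).integrableOn (hext K v w').integrableOn])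
    (fun r v w => by
      rw [smul_eq_mul, Finset.mul_sum]
      refine Finset.sum_congr rfl fun K _ => ?_
      rw [← integral_const_mul]
      exact T.integral_congr_cell fun x _ => hsmul₂ K r v w x)

theorem eq_zero_of_sum_integral {f : T.Elem → Space d → ℝ} (hf : ∀ K, T.HasExt K (f K))
    (h0 : ∀ K x, 0 ≤ f K x) (h : ∑ K, ∫ x in T.cell K, f K x = 0) (K : T.Elem) :
    ∀ x ∈ interior (T.cell K), f K x = 0 :=
  (hf K).eq_zero_of_integral (h0 K) ((Finset.sum_eq_zero_iff_of_nonneg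
    fun K _ => integral_nonneg (h0 K)).1 h K (Finset.mem_univ K))

theorem hasExt_ddot_grad {u v : Space d → Space d} (hu : u ∈ T.VelocitySpace)
    (hv : v ∈ T.VelocitySpace) (K : T.Elem) :
    T.HasExt K fun x => ddot (grad u x) (grad v x) :=
  HasExt.sum _ fun i _ => HasExt.sum _ fun j _ =>
    (VelocitySpace.hasExt_grad hu K i j).mul (VelocitySpace.hasExt_grad hv K i j)

theorem hasExt_inner {u v : Space d → Space d} (hu : u ∈ T.VelocitySpace)
    (hv : v ∈ T.VelocitySpace) (K : T.Elem) : T.HasExt K fun x => inner ℝ (u x) (v x) :=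
  HasExt.of_continuous (hu.1.inner hv.1)

theorem hasExt_convection {u v w : Space d → Space d} (hu : u ∈ T.VelocitySpace)
    (hv : v ∈ T.VelocitySpace) (hw : w ∈ T.VelocitySpace) (K : T.Elem) :
    T.HasExt K fun x => inner ℝ (fderiv ℝ u x (w x)) (v x) := by
  simp only [inner_eq_sum, fderiv_apply_eq_sum]
  exact HasExt.sum _ fun i _ => (HasExt.sum _ fun j _ => (VelocitySpace.hasExt_grad hu K i j).mul
    (.of_continuous (VelocitySpace.continuous_coord hw j))).mul
      (.of_continuous (VelocitySpace.continuous_coord hv i))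

theorem hasExt_div {v : Space d → Space d} (hv : v ∈ T.VelocitySpace) (K : T.Elem) :
    T.HasExt K fun x => div v x :=
  HasExt.sum Finset.univ (F := fun i x => grad v x i i) fun i _ =>
    VelocitySpace.hasExt_grad hv K i i

theorem hasExt_pressure_div {q : T.Elem → Space d → ℝ} (hq : q ∈ T.PressureSpace)
    {v : Space d → Space d} (hv : v ∈ T.VelocitySpace) (K : T.Elem) :
    T.HasExt K fun x => q K x * div v x :=
  (HasExt.of_continuous (hq K).continuous).mul (hasExt_div hv K)

/-! ### The algebraic scheme of a mesh -/

theorem ddot_add_right (A B C : Tensor d) : ddot A (B + C) = ddot A B + ddot A C := by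
  rw [ddot_comm, ddot_add_left, ddot_comm, ddot_comm C]

theorem ddot_smul_right (r : ℝ) (A B : Tensor d) : ddot A (r • B) = r * ddot A B := by
  rw [ddot_comm, ddot_smul_left, ddot_comm]

variable (T)

/-- The stiffness form. -/
def stiffness : T.velocity →ₗ[ℝ] T.velocity →ₗ[ℝ] ℝ :=
  T.integralForm (fun _ u v x => ddot (grad u.1 x) (grad v.1 x))
    (fun K u v => hasExt_ddot_grad u.2 v.2 K)
    (fun K u u' v x hx => by
      rw [Submodule.coe_add, VelocitySpace.grad_add u.2 u'.2 hx, ddot_add_left])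
    (fun K r u v x => by rw [Submodule.coe_smul, grad_smul, ddot_smul_left])
    (fun K u v v' x hx => by
      rw [Submodule.coe_add, VelocitySpace.grad_add v.2 v'.2 hx, ddot_add_right])
    (fun K r u v x => by rw [Submodule.coe_smul, grad_smul, ddot_smul_right])

/-- The mass form. -/
def mass : T.velocity →ₗ[ℝ] T.velocity →ₗ[ℝ] ℝ :=
  T.integralForm (fun _ u v x => inner ℝ (u.1 x) (v.1 x))
    (fun K u v => hasExt_inner u.2 v.2 K)
    (fun K u u' v x hx => by rw [Submodule.coe_add, Pi.add_apply, inner_add_left])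
    (fun K r u v x => by rw [Submodule.coe_smul, Pi.smul_apply, real_inner_smul_left])
    (fun K u v v' x hx => by rw [Submodule.coe_add, Pi.add_apply, inner_add_right])
    (fun K r u v x => by rw [Submodule.coe_smul, Pi.smul_apply, real_inner_smul_right])

/-- The convection form with transporting velocity `w`. -/
def convection (w : T.velocity) : T.velocity →ₗ[ℝ] T.velocity →ₗ[ℝ] ℝ :=
  T.integralForm (fun _ u v x => inner ℝ (fderiv ℝ u.1 x (w.1 x)) (v.1 x))
    (fun K u v => hasExt_convection u.2 v.2 w.2 K)
    (fun K u u' v x hx => by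
      obtain ⟨_, -, h⟩ := VelocitySpace.exists_grad u.2 K
      obtain ⟨_, -, h'⟩ := VelocitySpace.exists_grad u'.2 K
      rw [Submodule.coe_add, fderiv_add (h x hx).1 (h' x hx).1, add_apply, inner_add_left])
    (fun K r u v x => by
      rw [Submodule.coe_smul, fderiv_const_smul_field, Pi.smul_apply, smul_apply,
        real_inner_smul_left])
    (fun K u v v' x hx => by rw [Submodule.coe_add, Pi.add_apply, inner_add_right])
    (fun K r u v x => by rw [Submodule.coe_smul, Pi.smul_apply, real_inner_smul_right])

/-- The divergence form. -/
def divergence : T.pressure →ₗ[ℝ] T.velocity →ₗ[ℝ] ℝ :=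
  T.integralForm (fun K q v x => q.1 K x * div v.1 x)
    (fun K q v => hasExt_pressure_div q.2 v.2 K)
    (fun K q q' v x hx => by
      rw [Submodule.coe_add, Pi.add_apply, Pi.add_apply, add_mul])
    (fun K r q v x => by
      rw [Submodule.coe_smul, Pi.smul_apply, Pi.smul_apply, smul_eq_mul, mul_assoc])
    (fun K q v v' x hx => by
      rw [Submodule.coe_add, div, VelocitySpace.grad_add v.2 v'.2 hx, Matrix.trace_add, mul_add]
      rfl)
    (fun K r q v x => by
      rw [Submodule.coe_smul, div, grad_smul, Matrix.trace_smul, smul_eq_mul, mul_left_comm]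
      rfl)

/-- The integral of the velocity gradient over an element. -/
def gradIntegral (K : T.Elem) : T.velocity →ₗ[ℝ] Tensor d where
  toFun v := .of fun i j => ∫ x in T.cell K, grad v.1 x i j
  map_add' u v := by
    ext i j
    simp only [Matrix.of_apply, Matrix.add_apply]
    rw [← integral_add (VelocitySpace.hasExt_grad u.2 K i j).integrableOn
      (VelocitySpace.hasExt_grad v.2 K i j).integrableOn]
    refine T.integral_congr_cell fun x hx => ?_
    rw [Submodule.coe_add, VelocitySpace.grad_add u.2 v.2 hx, Matrix.add_apply]
  map_smul' r u := by
    ext i j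
    simp only [Matrix.of_apply, Matrix.smul_apply, RingHom.id_apply, smul_eq_mul]
    rw [← integral_const_mul]
    refine T.integral_congr_cell fun x _ => ?_
    rw [Submodule.coe_smul, grad_smul, Matrix.smul_apply, smul_eq_mul]

variable {T}

theorem hasCellIntegral_grad (ℓ : Tensor d →ₗ[ℝ] ℝ) (K : T.Elem) (v : T.velocity) :
    T.HasCellIntegral K (fun x => ℓ (grad v.1 x)) (ℓ (T.gradIntegral K v)) :=
  HasCellIntegral.linear ℓ fun i j => (VelocitySpace.hasExt_grad v.2 K i j).integrableOn

/-- The algebraic scheme of a mesh with transporting velocity `w` and jump coefficients `j`. -/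
def scheme (hd : 0 < d) (w : T.velocity) (j : T.Elem → T.Elem → ℝ) (C : ℝ) (hC : 0 ≤ C)
    (hj : ∀ ψ : T.Elem → Tensor d, (∀ K, (ψ K).IsSymm) → -C * (1 + ∑ K, energy (ψ K)) ≤
      ∑ L, ∑ K, j L K * ddot (ψ L) (NormedSpace.exp (ψ K) - 1)) :
    LogScheme d T.velocity T.pressure T.Elem where
  A := T.stiffness
  m := T.mass
  c := T.convection w
  b := T.divergence
  g := T.gradIntegral
  vol := T.vol
  j := j
  A_symm u v := Finset.sum_congr rfl fun K _ => integral_congr_ae (.of_forall fun x => ddot_comm _ _)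
  A_pos v hv := by
    refine lt_of_le_of_ne (Finset.sum_nonneg fun K _ => integral_nonneg fun x =>
      ddot_self_nonneg _) fun h => hv (Subtype.ext ?_)
    exact VelocitySpace.eq_zero_of_grad hd v.2 fun K x hx => ddot_self_eq_zero
      (eq_zero_of_sum_integral (fun K => hasExt_ddot_grad v.2 v.2 K)
        (fun K x => ddot_self_nonneg _) h.symm K x hx)
  m_pos v hv := by
    refine lt_of_le_of_ne (Finset.sum_nonneg fun K _ => integral_nonneg fun x =>
      real_inner_self_nonneg) fun h => hv (Subtype.ext ?_)
    exact VelocitySpace.eq_zero v.2 fun K x hx => inner_self_eq_zero.1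
      (eq_zero_of_sum_integral (fun K => hasExt_inner v.2 v.2 K)
        (fun K x => real_inner_self_nonneg) h.symm K x hx)
  vol_pos := T.vol_pos
  trace_g u hu := by
    -- The constant pressure `1` tests the total divergence.
    have h := hu ⟨fun _ _ => 1, fun _ => IsPolyOn.const 1⟩
    rw [← h]
    refine Finset.sum_congr rfl fun K _ => ?_
    simp only [one_mul]
    exact (hasCellIntegral_grad (Matrix.traceLinearMap (Fin d) ℝ ℝ) K u).2.symm
  jumpBound := C
  jumpBound_nonneg := hC
  le_jump := hj

/-! ### Decompositions -/

/-- Since `ψ` is constant on an element, the linear maps of `exists_linear_decomposition` are fixed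
there and send the affine gradient to affine fields. -/
theorem exists_isDecomposition {u : Space d → Space d} (hu : u ∈ T.VelocitySpace)
    {ψ : T.Elem → Tensor d} (hψ : ψ ∈ T.StressSpace) : ∃ Ω B N, T.IsDecomposition u ψ Ω B N := by
  choose G hG hGu using fun K => VelocitySpace.exists_grad hu K
  choose Ω B N h using fun K => exists_linear_decomposition (hψ K)
  have hP : ∀ Λ : T.Elem → Tensor d →ₗ[ℝ] Tensor d, (fun K x => Λ K (G K x)) ∈ T.TensorP1 := by
    intro Λ K i j
    have h1 : ∀ x, Λ K (G K x) i j = ∑ k, ∑ l, Λ K (Matrix.single k l 1) i j * G K x k l := fun x =>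
      linearMap_apply_eq_sum (Matrix.entryLinearMap ℝ ℝ i j ∘ₗ Λ K) (G K x)
    simp only [h1]
    exact IsPolyOn.sum _ fun k _ => IsPolyOn.sum _ fun l _ => (hG K k l).const_mul _
  refine ⟨_, _, _, hP Ω, hP B, hP N, fun K x hx => ?_⟩
  obtain ⟨h1, h2, h3, h4, h5⟩ := h K (G K x)
  exact ⟨h1, h2, h3, h4, (hGu K x hx).2.trans h5⟩

/-! ### Averages of tensor fields -/

/-- The mean values of a tensor field over the elements. -/
def average (T : Mesh d) (ψ : T.Elem → Space d → Tensor d) (K : T.Elem) : Tensor d :=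
  (T.vol K)⁻¹ • .of fun i j => ∫ x in T.cell K, ψ K x i j

theorem isSymm_average {ψ : T.Elem → Space d → Tensor d} (h : ∀ K x, (ψ K x).IsSymm) (K : T.Elem) :
    (T.average ψ K).IsSymm := by
  refine Matrix.IsSymm.smul (Matrix.IsSymm.ext fun i j => ?_) _
  simp only [Matrix.of_apply, (h K _).apply i j]

theorem abs_average_le {ψ : T.Elem → Space d → Tensor d} {C : ℝ} (h : ∀ K x i j, |ψ K x i j| ≤ C)
    (K : T.Elem) (i j : Fin d) : |T.average ψ K i j| ≤ C := by
  have h1 : ‖∫ x in T.cell K, ψ K x i j‖ ≤ C * T.vol K :=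
    norm_setIntegral_le_of_norm_le_const (T.isCompact_cell K).measure_lt_top fun x _ => h K x i j
  rw [average, Matrix.smul_apply, Matrix.of_apply, smul_eq_mul, abs_mul,
    abs_of_pos (inv_pos.2 (T.vol_pos K)), inv_mul_le_iff₀ (T.vol_pos K), mul_comm _ C]
  exact h1

theorem average_congr {ψ ψ' : T.Elem → Space d → Tensor d}
    (h : ∀ K, ∀ x ∈ interior (T.cell K), ψ K x = ψ' K x) : T.average ψ = T.average ψ' := by
  funext K
  rw [average, average]
  congr 1
  ext i j
  exact T.integral_congr_cell fun x hx => congrFun (congrFun (h K x hx) i) j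

/-! ### The discrete variational form -/

/-- On an element `ψ` and `φ` are constant and the stretching is linear in the gradient, so
integration passes to the gradient and to the old stress. The identity holds for every
decomposition, which therefore drops out. -/
theorem form_eq_scheme (hd : 0 < d) (w : T.velocity) (j : T.Elem → T.Elem → ℝ) (C : ℝ) (hC : 0 ≤ C)
    (hj : ∀ ψ : T.Elem → Tensor d, (∀ K, (ψ K).IsSymm) → -C * (1 + ∑ K, energy (ψ K)) ≤
      ∑ L, ∑ K, j L K * ddot (ψ L) (NormedSpace.exp (ψ K) - 1)) (Re Wi ε Δt : ℝ)
    {ψold : T.Elem → Space d → Tensor d}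
    (hold : ∀ K i k, IntegrableOn (fun x => ψold K x i k) (T.cell K)) (u : T.velocity)
    (p : T.pressure) {ψ : T.Elem → Tensor d} (hψ : ψ ∈ T.StressSpace)
    {Ω B N : T.Elem → Space d → Tensor d} (hdec : T.IsDecomposition u ψ Ω B N) (v : T.velocity)
    (q : T.pressure) (φ : T.Elem → Tensor d) :
    T.form Re Wi ε Δt w ψold u p ψ Ω B v q φ + Δt * ∑ L, ∑ K, j L K * ddot (ψ L) (φ K) =
      (scheme hd w j C hC hj).form Re Wi ε Δt w (T.average ψold) u p ψ v q φ := by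
  have key : ∀ K, ∫ x in T.cell K,
    (Re * inner ℝ ((u.1 x - w.1 x) + Δt • fderiv ℝ u.1 x (w.1 x)) (v.1 x)
      + Δt * (-(p.1 K x * div v.1 x) + q.1 K x * div u.1 x
          + (1 - ε) * ddot (grad u.1 x) (grad v.1 x)
          + ε / Wi * ddot (NormedSpace.exp (ψ K)) (grad v.1 x))
      + ddot (ψ K - ψold K x) (φ K)
      - Δt * ddot (Ω K x * ψ K - ψ K * Ω K x) (φ K)
      - Δt * (2 * ddot (B K x) (φ K))
      - Δt * (1 / Wi * ddot (NormedSpace.exp (-ψ K) - 1) (φ K))) =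
    Re * ((∫ x in T.cell K, inner ℝ ((u - w : T.velocity).1 x) (v.1 x))
        + Δt * ∫ x in T.cell K, inner ℝ (fderiv ℝ u.1 x (w.1 x)) (v.1 x))
      + Δt * (-(∫ x in T.cell K, p.1 K x * div v.1 x) + (∫ x in T.cell K, q.1 K x * div u.1 x)
          + (1 - ε) * (∫ x in T.cell K, ddot (grad u.1 x) (grad v.1 x))
          + ε / Wi * ddot (NormedSpace.exp (ψ K)) (T.gradIntegral K v))
      + T.vol K * ddot (ψ K - T.average ψold K) (φ K)
      - Δt * ddot (stretching (ψ K) (T.gradIntegral K u)) (φ K)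
      - Δt * (1 / Wi * (T.vol K * ddot (NormedSpace.exp (-ψ K) - 1) (φ K))) := by
    intro K
    have i1 := HasCellIntegral.of_hasExt (hasExt_inner (u - w : T.velocity).2 v.2 K)
    have i2 := HasCellIntegral.of_hasExt (hasExt_convection u.2 v.2 w.2 K)
    have i3 := HasCellIntegral.of_hasExt (hasExt_pressure_div p.2 v.2 K)
    have i4 := HasCellIntegral.of_hasExt (hasExt_pressure_div q.2 u.2 K)
    have i5 := HasCellIntegral.of_hasExt (hasExt_ddot_grad u.2 v.2 K)
    have i6 := hasCellIntegral_grad (ddotRight (NormedSpace.exp (ψ K))) K v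
    have i7 := HasCellIntegral.linear (ddotRight (φ K)) (hold K)
    have i8 := hasCellIntegral_grad (ddotRight (φ K) ∘ₗ stretching (ψ K)) K u
    have i9 : T.HasCellIntegral K _ _ :=
      .const (ddot (ψ K) (φ K) - Δt * (1 / Wi * ddot (NormedSpace.exp (-ψ K) - 1) (φ K)))
    have tot := ((((((((i1.const_mul Re).add (i2.const_mul (Re * Δt))).add
      (i3.const_mul (-Δt))).add (i4.const_mul Δt)).add (i5.const_mul (Δt * (1 - ε)))).add
      (i6.const_mul (Δt * (ε / Wi)))).add (i7.const_mul (-1))).add (i8.const_mul (-Δt))).add i9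
    have hav : (Matrix.of fun i k => ∫ x in T.cell K, ψold K x i k) =
        T.vol K • T.average ψold K := by
      rw [average, smul_smul, mul_inv_cancel₀ (T.vol_pos K).ne', one_smul]
    refine (T.integral_congr_cell fun x hx => ?_).trans (tot.2.trans ?_)
    · obtain ⟨h1, h2, h3, h4, h5⟩ := hdec.2.2.2 K x hx
      have hs : (ddotRight (φ K) ∘ₗ stretching (ψ K)) (grad u.1 x) =
          ddot (Ω K x * ψ K - ψ K * Ω K x) (φ K) + 2 * ddot (B K x) (φ K) := by
        rw [LinearMap.comp_apply, stretching_eq (hψ K) h1 h2 h3 h4 h5]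
        show ddot _ _ = _
        rw [ddot_add_left, ddot_smul_left]
      have hd1 : ddotRight (NormedSpace.exp (ψ K)) (grad v.1 x) =
        ddot (NormedSpace.exp (ψ K)) (grad v.1 x) := ddot_comm _ _
      have hd2 : ddotRight (φ K) (ψold K x) = ddot (ψold K x) (φ K) := rfl
      have hi : inner ℝ ((u - w : T.velocity).1 x) (v.1 x) = inner ℝ (u.1 x - w.1 x) (v.1 x) := rfl
      rw [hs, hd1, hd2, hi, inner_add_left, real_inner_smul_left, ddot_sub_left]
      ring
    · have hd1 : ddotRight (NormedSpace.exp (ψ K)) (T.gradIntegral K v) =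
        ddot (NormedSpace.exp (ψ K)) (T.gradIntegral K v) := ddot_comm _ _
      have hd2 : ddotRight (φ K) (T.vol K • T.average ψold K) =
        T.vol K * ddot (T.average ψold K) (φ K) := ddot_smul_left _ _ _
      have hd3 : (ddotRight (φ K) ∘ₗ stretching (ψ K)) (T.gradIntegral K u) =
        ddot (stretching (ψ K) (T.gradIntegral K u)) (φ K) := rfl
      rw [hav, hd1, hd2, hd3, ddot_sub_left (ψ K)]
      ring
  have hA : T.stiffness u v = ∑ K, ∫ x in T.cell K, ddot (grad u.1 x) (grad v.1 x) := rfl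
  have hm : T.mass (u - w) v = ∑ K, ∫ x in T.cell K, inner ℝ ((u - w : T.velocity).1 x) (v.1 x) :=
    rfl
  have hc : T.convection w u v =
    ∑ K, ∫ x in T.cell K, inner ℝ (fderiv ℝ u.1 x (w.1 x)) (v.1 x) := rfl
  have hb : ∀ (q : T.pressure) (v : T.velocity),
    T.divergence q v = ∑ K, ∫ x in T.cell K, q.1 K x * div v.1 x := fun _ _ => rfl
  rw [Mesh.form, Finset.sum_congr rfl fun K _ => key K, LogScheme.form]
  simp only [scheme, hA, hm, hc, hb]
  simp only [Finset.sum_sub_distrib, Finset.sum_add_distrib, ← Finset.mul_sum,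
    Finset.sum_neg_distrib]

/-- The zero jump coefficients are admissible. -/
theorem zero_le_jump (ψ : T.Elem → Tensor d) (_ : ∀ K, (ψ K).IsSymm) :
    -(0 : ℝ) * (1 + ∑ K, energy (ψ K)) ≤
      ∑ L, ∑ K, (0 : T.Elem → T.Elem → ℝ) L K * ddot (ψ L) (NormedSpace.exp (ψ K) - 1) := by
  simp

theorem fluxBound_le_jump (hd : 0 < d) (w : T.velocity) (ψ : T.Elem → Tensor d)
    (hψ : ∀ K, (ψ K).IsSymm) : -T.fluxBound w.1 * (1 + ∑ K, energy (ψ K)) ≤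
      ∑ L, ∑ K, T.jumpCoeff w.1 L K * ddot (ψ L) (NormedSpace.exp (ψ K) - 1) := by
  rw [← jumpTerm_eq hd w.2 ψ fun K => NormedSpace.exp (ψ K) - 1]
  exact neg_fluxBound_le_jumpTerm hd w.2 hψ

theorem existsUnique_of_scheme {D : LogScheme d T.velocity T.pressure T.Elem} {Re Wi ε Δt : ℝ}
    {w : T.velocity} {a : T.Elem → Tensor d}
    {S : (Space d → Space d) → (T.Elem → Tensor d) → Prop}
    (hS : ∀ u ψ, S u ψ ↔ ∃ hu : u ∈ T.velocity, (∀ K, (ψ K).IsSymm) ∧ ∃ p, ∀ v q φ,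
      (∀ K, (φ K).IsSymm) → 0 = D.form Re Wi ε Δt w a ⟨u, hu⟩ p ψ v q φ)
    (h : ∃! Y : T.velocity × (T.Elem → Tensor d), (∀ K, (Y.2 K).IsSymm) ∧ ∃ p, ∀ v q φ,
      (∀ K, (φ K).IsSymm) → 0 = D.form Re Wi ε Δt w a Y.1 p Y.2 v q φ) :
    ∃! Y : (Space d → Space d) × (T.Elem → Tensor d), S Y.1 Y.2 := by
  obtain ⟨⟨u, ψ⟩, h1, h2⟩ := h
  refine ⟨(u.1, ψ), (hS _ _).2 ⟨u.2, h1⟩, ?_⟩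
  rintro ⟨u', ψ'⟩ h'
  obtain ⟨hu', h'⟩ := (hS _ _).1 h'
  have := h2 (⟨u', hu'⟩, ψ') h'
  exact congrArg (fun Y : T.velocity × (T.Elem → Tensor d) => (Y.1.1, Y.2)) this

/-- The existential over decompositions disappears: any one yields the same algebraic form, and one
always exists. -/
theorem isDGStep_iff (hd : 0 < d) (w : T.velocity) {Re Wi ε Δt : ℝ} (ψn : T.Elem → Tensor d)
    (u : Space d → Space d) (ψ : T.Elem → Tensor d) :
    T.IsDGStep Re Wi ε Δt w ψn u ψ ↔ ∃ hu : u ∈ T.velocity, (∀ K, (ψ K).IsSymm) ∧ ∃ p, ∀ v q φ,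
      (∀ K, (φ K).IsSymm) → 0 = (scheme hd w (T.jumpCoeff w.1) _ (fluxBound_nonneg w.1)
        (fluxBound_le_jump hd w)).form Re Wi ε Δt w (T.average fun K _ => ψn K) ⟨u, hu⟩ p ψ v q φ := by
  have hold : ∀ K i k, IntegrableOn (fun _ : Space d => ψn K i k) (T.cell K) := fun K i k =>
    (HasExt.of_continuous continuous_const).integrableOn
  constructor
  · rintro ⟨hu, hψ, p, hp, Ω, B, N, hdec, h⟩
    refine ⟨hu, hψ, ⟨p, hp⟩, fun v q φ hφ => ?_⟩
    rw [← form_eq_scheme hd w _ _ _ _ Re Wi ε Δt hold ⟨u, hu⟩ ⟨p, hp⟩ hψ hdec v q φ,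
      ← jumpTerm_eq hd w.2]
    exact h v v.2 q q.2 φ hφ
  · rintro ⟨hu, hψ, p, h⟩
    obtain ⟨Ω, B, N, hdec⟩ := exists_isDecomposition hu hψ
    refine ⟨hu, hψ, p, p.2, Ω, B, N, hdec, fun v hv q hq φ hφ => ?_⟩
    have := h ⟨v, hv⟩ ⟨q, hq⟩ φ hφ
    rwa [← form_eq_scheme hd w _ _ _ _ Re Wi ε Δt hold ⟨u, hu⟩ p hψ hdec ⟨v, hv⟩ ⟨q, hq⟩ φ,
      ← jumpTerm_eq hd w.2] at this

theorem isCharacteristicStep_iff (hd : 0 < d) (w : T.velocity) {Re Wi ε tn Δt : ℝ} (hΔ : 0 ≤ Δt)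
    (ψn : T.Elem → Tensor d) {X : ℝ → Space d → Space d}
    (hX : T.IsBackwardFlow w tn (tn + Δt) X) (u : Space d → Space d) (ψ : T.Elem → Tensor d) :
    T.IsCharacteristicStep Re Wi ε tn Δt w ψn u ψ ↔
      ∃ hu : u ∈ T.velocity, (∀ K, (ψ K).IsSymm) ∧ ∃ p, ∀ v q φ, (∀ K, (φ K).IsSymm) →
        0 = (scheme hd w 0 0 le_rfl zero_le_jump).form Re Wi ε Δt w
          (T.average fun _ x => T.eval ψn (X tn x)) ⟨u, hu⟩ p ψ v q φ := by
  have hle : tn ≤ tn + Δt := by linarith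
  constructor
  · rintro ⟨hu, hψ, p, hp, Ω, B, N, Y, hdec, hY, h⟩
    refine ⟨hu, hψ, ⟨p, hp⟩, fun v q φ hφ => ?_⟩
    -- The step may come with another flow `Y`; flows agree on the domain, hence so do the averages.
    have hav : (T.average fun _ x => T.eval ψn (X tn x)) =
        T.average fun _ x => T.eval ψn (Y tn x) :=
      average_congr fun K x hx => by
        rw [hX.eqOn w.2 hle hY (T.interior_cell_subset_domain K hx)]
    rw [hav, ← form_eq_scheme hd w _ _ _ _ Re Wi ε Δt
      (fun K i k => hY.integrableOn_eval w.2 hle ψn K i k) ⟨u, hu⟩ ⟨p, hp⟩ hψ hdec v q φ]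
    simpa using h v v.2 q q.2 φ hφ
  · rintro ⟨hu, hψ, p, h⟩
    obtain ⟨Ω, B, N, hdec⟩ := exists_isDecomposition hu hψ
    refine ⟨hu, hψ, p, p.2, Ω, B, N, X, hdec, hX, fun v hv q hq φ hφ => ?_⟩
    have := h ⟨v, hv⟩ ⟨q, hq⟩ φ hφ
    rw [← form_eq_scheme hd w _ _ _ _ Re Wi ε Δt
      (fun K i k => hX.integrableOn_eval w.2 hle ψn K i k) ⟨u, hu⟩ p hψ hdec ⟨v, hv⟩ ⟨q, hq⟩ φ]
      at this
    simpa using this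

end Mesh

end OldroydLog

end

/-! ### The two methods on a mesh. -/

theorem mainTheorem11 {d : ℕ} (hd : d = 2 ∨ d = 3) (T : OldroydLog.Mesh d)
    (Re Wi ε : ℝ) (hRe : 0 ≤ Re) (hWi : 0 < Wi) (hε₀ : 0 ≤ ε) (hε₁ : ε < 1)
    (un : OldroydLog.Space d → OldroydLog.Space d) (hun : un ∈ T.VelocitySpace)
    (ψn : T.Elem → OldroydLog.Tensor d) (hψn : ψn ∈ T.StressSpace) :
    (∃ c₀ : ℝ, 0 < c₀ ∧ ∀ (n : ℕ) (Δt : ℝ), 0 ≤ Δt → Δt < c₀ → (Re = 0 → 0 < Δt) →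
      ∃! Y : (OldroydLog.Space d → OldroydLog.Space d) × (T.Elem → OldroydLog.Tensor d),
        T.IsCharacteristicStep Re Wi ε (n * Δt) Δt un ψn Y.1 Y.2) ∧
    (∃ c₀ : ℝ, 0 < c₀ ∧ ∀ Δt : ℝ, 0 ≤ Δt → Δt < c₀ → (Re = 0 → 0 < Δt) →
      ∃! Y : (OldroydLog.Space d → OldroydLog.Space d) × (T.Elem → OldroydLog.Tensor d),
        T.IsDGStep Re Wi ε Δt un ψn Y.1 Y.2) := by
  have hd0 : 0 < d := by omega
  let w : T.velocity := ⟨un, hun⟩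
  -- A bound for the averaged old stress of both methods, independent of the flow, of `n` and of
  -- `Δt`; hence `c₀` can be fixed before them.
  set R₀ : ℝ := ∑ i, ∑ j, ∑ K, |ψn K i j| with hR₀
  have hR₀0 : 0 ≤ R₀ := Finset.sum_nonneg fun _ _ => Finset.sum_nonneg fun _ _ =>
    Finset.sum_nonneg fun _ _ => abs_nonneg _
  have hentry : ∀ i j, ∑ K, |ψn K i j| ≤ R₀ := fun i j =>
    (Finset.single_le_sum (f := fun j => ∑ K, |ψn K i j|)
      (fun _ _ => Finset.sum_nonneg fun _ _ => abs_nonneg _) (Finset.mem_univ j)).trans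
    (Finset.single_le_sum (f := fun i => ∑ j, ∑ K, |ψn K i j|)
      (fun _ _ => Finset.sum_nonneg fun _ _ => Finset.sum_nonneg fun _ _ => abs_nonneg _)
      (Finset.mem_univ i))
  refine ⟨?_, ?_⟩
  · obtain ⟨c₀, hc₀, h⟩ := (OldroydLog.Mesh.scheme hd0 w 0 0 le_rfl
      OldroydLog.Mesh.zero_le_jump).exists_unique_step_nonneg hRe hWi hε₀ hε₁ w R₀ hR₀0
    refine ⟨c₀, hc₀, fun n Δt hΔ hΔc hΔR => ?_⟩
    obtain ⟨X, hX⟩ := OldroydLog.Mesh.exists_isBackwardFlow hun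
      (show (n * Δt : ℝ) ≤ n * Δt + Δt by linarith)
    exact OldroydLog.Mesh.existsUnique_of_scheme
      (fun u ψ => OldroydLog.Mesh.isCharacteristicStep_iff hd0 w hΔ ψn hX u ψ)
      (h Δt hΔ hΔc hΔR _ (OldroydLog.Mesh.isSymm_average fun K x => T.isSymm_eval hψn _)
        (OldroydLog.Mesh.abs_average_le fun K x i j => (T.abs_eval_le ψn _ i j).trans (hentry i j)))
  · obtain ⟨c₀, hc₀, h⟩ := (OldroydLog.Mesh.scheme hd0 w (T.jumpCoeff un) _
      (OldroydLog.Mesh.fluxBound_nonneg un)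
      (OldroydLog.Mesh.fluxBound_le_jump hd0 w)).exists_unique_step_nonneg hRe hWi hε₀ hε₁ w R₀ hR₀0
    refine ⟨c₀, hc₀, fun Δt hΔ hΔc hΔR => ?_⟩
    exact OldroydLog.Mesh.existsUnique_of_scheme
      (fun u ψ => OldroydLog.Mesh.isDGStep_iff hd0 w ψn u ψ)
      (h Δt hΔ hΔc hΔR _ (OldroydLog.Mesh.isSymm_average fun K x => hψn K)
        (OldroydLog.Mesh.abs_average_le fun K x i j => (Finset.single_le_sum
          (f := fun K => |ψn K i j|) (fun _ _ => abs_nonneg _) (Finset.mem_univ K)).trans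
            (hentry i j)))
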